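/- **Setting.** Let $\mu$ be a $\sigma$-finite measure on a measurable space $\mathcal X$, let $\Theta\subset\mathbb R^p$ be open, and let $\{f_\theta:\theta\in\Theta\}$ be an identifiable family of probability densities with respect to $\mu$ (jointly measurable in $(\theta,x)$) with common support $\{x: f_\theta(x)>0\}$ not depending on $\theta$. Let $g:\mathbb R^p\to\mathbb R^r$, $r<p$, be differentiable on $\Theta$ with a continuous $p\times r$ matrix $G(\theta)=\partial g^T(\theta)/\partial\theta$ of rank $r$, and let $\Theta_0=\{\theta\in\Theta: g(\theta)=0\}$. Let $\beta,\gamma\ge 0$, and let $X_1,X_2,\dots$ be i.i.d. with density $f_{\theta_0}$, where $\theta_0\in\Theta_0$ (the null hypothesis $H_0$). Put $u_\theta=\partial_\theta\log f_\theta$ and $$d_\gamma(h,f)=\int\Big\{f^{1+\gamma}-\big(1+\tfrac1\gamma\big)f^\gamma h+\tfrac1\gamma h^{1+\gamma}\Big\}d\mu\quad(\gamma>0),\qquad d_0(h,f)=\int h\log(h/f)\,d\mu,$$ $$V_\theta(x)=\int f_\theta^{1+\beta}d\mu-\big(1+\tfrac1\beta\big)f_\theta^\beta(x)\quad(\beta>0),\qquad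 V_\theta(x)=-\log f_\theta(x)\quad(\beta=0),$$ $$J_\beta(\theta)=\int u_\theta u_\theta^Tf_\theta^{1+\beta}d\mu,\qquad K_\beta(\theta)=\int u_\theta u_\theta^Tf_\theta^{1+2\beta}d\mu-\xi_\beta\xi_\beta^T,\qquad \xi_\beta(\theta)=\int u_\theta f_\theta^{1+\beta}d\mu,$$ $$A_\gamma(\theta)=(1+\gamma)\Big(\int f_\theta^{\gamma-1}\,\frac{\partial f_\theta}{\partial\theta_j}\,\frac{\partial f_\theta}{\partial\theta_i}\,d\mu\Big)_{i,j},\qquad B_\beta=J_\beta^{-1}G\,[G^TJ_\beta^{-1}G]^{-1}G^TJ_\beta^{-1}.$$ **Regularity conditions.** There is an open set $\omega\subset\Theta$ containing $\theta_0$ such that: 1. for $\mu$-almost every $x$, $\theta\mapsto f_\theta(x)$ is three times continuously differentiable on $\omega$; 2. $\int f_\theta^{1+\beta}d\mu$ and $\int f_\theta^\beta f_{\theta_0}d\mu$ can be differentiated three times with respect to $\theta\in\omega$, and the derivatives can be taken under the integral sign; 3. $J_\beta(\theta_0)$ is positive definite, and the integrals defining $K_\beta(\theta_0)$ converge absolutely;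 4. for $P_{\theta_0}$-almost every $x$, the third partial derivatives of $V_\theta(x)$ are bounded in absolute value, for all $\theta\in\omega$, by a function $M(x)$ with $\int M f_{\theta_0}d\mu<\infty$; 5. $\int f_\theta^{1+\gamma}d\mu$ and, for each $\tau\in\omega$, $d_\gamma(f_\theta,f_\tau)$ can be differentiated twice with respect to $\theta\in\omega$ under the integral sign, and the second derivatives of $d_\gamma(f_\theta,f_\tau)$ in $\theta$ are continuous in $(\theta,\tau)\in\omega\times\omega$. **Estimators.** A minimum density power divergence estimator (MDPDE) is a sequence $\hat\theta_\beta=\hat\theta_{n,\beta}$ of measurable functions of $X_1,\dots,X_n$ that is consistent for $\theta_0$ and, with probability tending to one, is a root in $\Theta$ of $\frac1n\sum_{i=1}^nu_\theta(X_i)f_\theta^\beta(X_i)-\int u_\theta f_\theta^{1+\beta}d\mu=0$. A restricted one (RMDPDE) is a sequence $\tilde\theta_\beta=\tilde\theta_{n,\beta}$ of measurable functions of $X_1,\dots,X_n$ that is consistent for $\theta_0$ and, with probability tending to one, minimizes (at least locally) $\frac1n\sum_{i=1}^nV_\theta(X_i)$ subject to $\theta\in\Theta_0$. **Theorem.** Under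 these conditions an MDPDE and an RMDPDE exist. The matrix $A_\gamma(\theta_0)B_\beta(\theta_0)K_\beta(\theta_0)B_\beta(\theta_0)$ has, counted with algebraic multiplicity, exactly $$k=\operatorname{rank}\big(B_\beta K_\beta B_\beta A_\gamma B_\beta K_\beta B_\beta\big)(\theta_0)$$ nonzero eigenvalues $\lambda_1,\dots,\lambda_k$, and they are all real. For every MDPDE $\hat\theta_\beta$ and every RMDPDE $\tilde\theta_\beta$, $$T_\gamma(\hat\theta_\beta,\tilde\theta_\beta)=2n\,d_\gamma\big(f_{\hat\theta_\beta},f_{\tilde\theta_\beta}\big)\ \xrightarrow{\ \mathcal L\ }\ \sum_{i=1}^k\lambda_iZ_i^2\qquad(n\to\infty),$$ where $Z_1,\dots,Z_k$ are independent standard normal variables. -/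

import Mathlib

open MeasureTheory ProbabilityTheory Filter Topology Matrix Polynomial

namespace DPD

noncomputable section

/-- The parameter space `ℝ^p` with its Euclidean norm. -/
abbrev Param (p : ℕ) : Type := EuclideanSpace ℝ (Fin p)

/-- The `i`-th partial derivative at `θ` of a real function of the parameter. -/
def partialDeriv {p : ℕ} (F : Param p → ℝ) (θ : Param p) (i : Fin p) : ℝ :=
  fderiv ℝ F θ (EuclideanSpace.single i 1)

section Model

variable {𝒳 : Type*} [MeasurableSpace 𝒳]

/-- `f` is an identifiable parametric family of probability densities with respect to `μ`,
indexed by the open set `Θ ⊆ ℝ^p`, whose support does not depend on the parameter. Only the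
values `f θ x` with `θ ∈ Θ` matter; the family is taken jointly measurable in `(θ, x)`, so that
functions of estimators such as `d_γ(f_θ, f_τ)` are random variables. -/
structure IsParametricModel {p : ℕ} (μ : Measure 𝒳) (Θ : Set (Param p))
    (f : Param p → 𝒳 → ℝ) : Prop where
  isOpen : IsOpen Θ
  measurable : Measurable (Function.uncurry f)
  nonneg : ∀ θ ∈ Θ, ∀ x, 0 ≤ f θ x
  integral_eq_one : ∀ θ ∈ Θ, ∫ x, f θ x ∂μ = 1
  common_support : ∀ θ ∈ Θ, ∀ τ ∈ Θ, {x | 0 < f θ x} = {x | 0 < f τ x}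
  identifiable : ∀ θ ∈ Θ, ∀ τ ∈ Θ, f θ =ᵐ[μ] f τ → θ = τ

/-- The distribution `P_θ` with density `f θ` with respect to `μ`. -/
def modelLaw {p : ℕ} (μ : Measure 𝒳) (f : Param p → 𝒳 → ℝ) (θ : Param p) : Measure 𝒳 :=
  μ.withDensity (fun x => ENNReal.ofReal (f θ x))

/-- The integrand of the density power divergence `d_β(h, f)`, at a point where the densities
take the values `h` and `f`. -/
def dpdIntegrand (β h f : ℝ) : ℝ :=
  if β = 0 then h * Real.log (h / f)
  else f ^ (1 + β) - (1 + 1 / β) * f ^ β * h + 1 / β * h ^ (1 + β)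

/-- The density power divergence `d_β(h, f)` with tuning parameter `β ≥ 0`. -/
def dpd (μ : Measure 𝒳) (β : ℝ) (h f : 𝒳 → ℝ) : ℝ :=
  ∫ x, dpdIntegrand β (h x) (f x) ∂μ

/-- The function `V_θ(x)` whose sample mean is the objective function of the minimum density
power divergence estimators. -/
def objective {p : ℕ} (μ : Measure 𝒳) (f : Param p → 𝒳 → ℝ) (β : ℝ) (θ : Param p) (x : 𝒳) : ℝ :=
  if β = 0 then -Real.log (f θ x)
  else ∫ y, f θ y ^ (1 + β) ∂μ - (1 + 1 / β) * f θ x ^ β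

/-- The empirical objective function `n⁻¹ ∑ V_θ(x_i)` of the data `x_1, …, x_n`. -/
def empObjective {p : ℕ} (μ : Measure 𝒳) (f : Param p → 𝒳 → ℝ) (β : ℝ) {n : ℕ}
    (x : Fin n → 𝒳) (θ : Param p) : ℝ :=
  (n : ℝ)⁻¹ * ∑ i, objective μ f β θ (x i)

/-- The likelihood score `u_θ(x)`, by coordinates. -/
def score {p : ℕ} (f : Param p → 𝒳 → ℝ) (θ : Param p) (x : 𝒳) (i : Fin p) : ℝ :=
  partialDeriv (fun τ => Real.log (f τ x)) θ i

/-- The vector `ξ_β(θ)` when the true density is `f θ`. -/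
def xiVec {p : ℕ} (μ : Measure 𝒳) (f : Param p → 𝒳 → ℝ) (β : ℝ) (θ : Param p) : Fin p → ℝ :=
  fun i => ∫ x, score f θ x i * f θ x ^ (1 + β) ∂μ

/-- The matrix `J_β(θ)` when the true density is `f θ`. -/
def jMat {p : ℕ} (μ : Measure 𝒳) (f : Param p → 𝒳 → ℝ) (β : ℝ) (θ : Param p) :
    Matrix (Fin p) (Fin p) ℝ :=
  Matrix.of fun i j => ∫ x, score f θ x i * score f θ x j * f θ x ^ (1 + β) ∂μ

/-- The matrix `K_β(θ)` when the true density is `f θ`. -/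
def kMat {p : ℕ} (μ : Measure 𝒳) (f : Param p → 𝒳 → ℝ) (β : ℝ) (θ : Param p) :
    Matrix (Fin p) (Fin p) ℝ :=
  Matrix.of fun i j => ∫ x, score f θ x i * score f θ x j * f θ x ^ (1 + 2 * β) ∂μ
    - xiVec μ f β θ i * xiVec μ f β θ j

/-- The matrix `A_γ(θ)`. -/
def aMat {p : ℕ} (μ : Measure 𝒳) (f : Param p → 𝒳 → ℝ) (γ : ℝ) (θ : Param p) :
    Matrix (Fin p) (Fin p) ℝ :=
  Matrix.of fun i j => (1 + γ) * ∫ x, f θ x ^ (γ - 1)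
    * partialDeriv (fun τ => f τ x) θ j * partialDeriv (fun τ => f τ x) θ i ∂μ

/-- The `p × r` matrix `G(θ) = ∂gᵀ(θ)/∂θ` of the constraint function `g`. -/
def gMat {p r : ℕ} (g : Param p → Param r) (θ : Param p) : Matrix (Fin p) (Fin r) ℝ :=
  Matrix.of fun i j => partialDeriv (fun τ => g τ j) θ i

/-- `g` is differentiable on `Θ` with a continuous derivative matrix `G` of rank `r`. -/
structure IsConstraint {p r : ℕ} (Θ : Set (Param p)) (g : Param p → Param r) : Prop where
  differentiable : ∀ θ ∈ Θ, DifferentiableAt ℝ g θ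
  continuous : ContinuousOn (gMat g) Θ
  rank : ∀ θ ∈ Θ, (gMat g θ).rank = r

/-- The null set `Θ₀ = {θ ∈ Θ : g θ = 0}`. -/
def nullSet {p r : ℕ} (Θ : Set (Param p)) (g : Param p → Param r) : Set (Param p) :=
  {θ | θ ∈ Θ ∧ g θ = 0}

/-- `B_β(θ) = J⁻¹ G [Gᵀ J⁻¹ G]⁻¹ Gᵀ J⁻¹`. -/
def bMat {p r : ℕ} (μ : Measure 𝒳) (f : Param p → 𝒳 → ℝ) (g : Param p → Param r) (β : ℝ)
    (θ : Param p) : Matrix (Fin p) (Fin p) ℝ :=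
  (jMat μ f β θ)⁻¹ * gMat g θ * ((gMat g θ)ᵀ * (jMat μ f β θ)⁻¹ * gMat g θ)⁻¹
    * (gMat g θ)ᵀ * (jMat μ f β θ)⁻¹

/-- `A_γ(θ) B_β(θ) K_β(θ) B_β(θ)`. -/
def limitMat {p r : ℕ} (μ : Measure 𝒳) (f : Param p → 𝒳 → ℝ) (g : Param p → Param r) (β γ : ℝ)
    (θ : Param p) : Matrix (Fin p) (Fin p) ℝ :=
  aMat μ f γ θ * bMat μ f g β θ * kMat μ f β θ * bMat μ f g β θ

/-- `k = rank (B K B A B K B)`. -/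
def limitRank {p r : ℕ} (μ : Measure 𝒳) (f : Param p → 𝒳 → ℝ) (g : Param p → Param r) (β γ : ℝ)
    (θ : Param p) : ℕ :=
  (bMat μ f g β θ * kMat μ f β θ * bMat μ f g β θ * aMat μ f γ θ
    * bMat μ f g β θ * kMat μ f β θ * bMat μ f g β θ).rank

/-- The integral `∫ F θ x dμ(x)` can be differentiated `m` times with respect to `θ ∈ U`, and all
its directional (in particular partial) derivatives up to order `m` are obtained by
differentiating under the integral sign. The case `j = 0` says that `F θ` is integrable. -/
def DiffUnderIntegral {p : ℕ} (μ : Measure 𝒳) (m : ℕ) (U : Set (Param p))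
    (F : Param p → 𝒳 → ℝ) : Prop :=
  (∀ j < m, ∀ θ ∈ U, DifferentiableAt ℝ (iteratedFDeriv ℝ j (fun τ => ∫ x, F τ x ∂μ)) θ) ∧
  ∀ j ≤ m, ∀ θ ∈ U, ∀ v : Fin j → Param p,
    Integrable (fun x => iteratedFDeriv ℝ j (fun τ => F τ x) θ v) μ ∧
    iteratedFDeriv ℝ j (fun τ => ∫ x, F τ x ∂μ) θ v
      = ∫ x, iteratedFDeriv ℝ j (fun τ => F τ x) θ v ∂μ

/-- The Lehmann and Basu et al. conditions with tuning parameter `β`, for the true density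
`f θ₀`, on the open neighbourhood `U ⊆ Θ` of `θ₀` (the common support is part of
`IsParametricModel`). At `θ₀` the general `J_β(θ)` is `jMat`, the true density being `f θ₀`. -/
structure LehmannBasu {p : ℕ} (μ : Measure 𝒳) (Θ : Set (Param p)) (f : Param p → 𝒳 → ℝ)
    (β : ℝ) (θ₀ : Param p) (U : Set (Param p)) : Prop where
  isOpen : IsOpen U
  subset : U ⊆ Θ
  mem : θ₀ ∈ U
  smooth : ∀ᵐ x ∂μ, ContDiffOn ℝ 3 (fun θ => f θ x) U
  diff_power : DiffUnderIntegral μ 3 U (fun θ x => f θ x ^ (1 + β))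
  diff_cross : DiffUnderIntegral μ 3 U (fun θ x => f θ x ^ β * f θ₀ x)
  posDef : (jMat μ f β θ₀).PosDef
  /-- the third partial derivatives of `V_θ(x)` are dominated by a function with a finite mean
  under the true density -/
  dominated : ∃ M : 𝒳 → ℝ, Integrable (fun x => M x * f θ₀ x) μ ∧
    ∀ᵐ x ∂μ, 0 < f θ₀ x → ∀ θ ∈ U,
      ‖iteratedFDeriv ℝ 3 (fun τ => objective μ f β τ x) θ‖ ≤ M x
  /-- the integrals that define `K_β(θ₀)` exist -/
  finite_kMat : ∀ i : Fin p, Integrable (fun x => score f θ₀ x i ^ 2 * f θ₀ x ^ (1 + 2 * β)) μ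

/-- Regularity of the divergence `d_γ` on the model near the true parameter: the integrals
`∫ f_θ^{1+γ} dμ` and `d_γ(f_θ, f_τ)` can be differentiated twice with respect to `θ` under the
integral sign, and the second derivatives of the latter are continuous in `(θ, τ)`. -/
structure DivergenceRegular {p : ℕ} (μ : Measure 𝒳) (f : Param p → 𝒳 → ℝ) (γ : ℝ)
    (U : Set (Param p)) : Prop where
  diff_power : DiffUnderIntegral μ 2 U (fun θ x => f θ x ^ (1 + γ))
  diff_dpd : ∀ τ ∈ U, DiffUnderIntegral μ 2 U (fun θ x => dpdIntegrand γ (f θ x) (f τ x))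
  continuous : ∀ v : Fin 2 → Param p, ContinuousOn
    (fun q : Param p × Param p => iteratedFDeriv ℝ 2 (fun θ => dpd μ γ (f θ) (f q.2)) q.1 v)
    (U ×ˢ U)

/-- `θ` is a root in `Θ` of the minimum density power divergence estimating equation for the data
`x_1, …, x_n`. -/
def IsEstimatingRoot {p : ℕ} (μ : Measure 𝒳) (Θ : Set (Param p)) (f : Param p → 𝒳 → ℝ) (β : ℝ)
    {n : ℕ} (x : Fin n → 𝒳) (θ : Param p) : Prop :=
  θ ∈ Θ ∧ ∀ j : Fin p, (n : ℝ)⁻¹ * ∑ i, score f θ (x i) j * f θ (x i) ^ β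
    - ∫ y, score f θ y j * f θ y ^ (1 + β) ∂μ = 0

/-- `θ` minimizes the empirical objective function (at least locally) subject to `g θ = 0`. -/
def IsRestrictedMin {p r : ℕ} (μ : Measure 𝒳) (Θ : Set (Param p)) (f : Param p → 𝒳 → ℝ)
    (g : Param p → Param r) (β : ℝ) {n : ℕ} (x : Fin n → 𝒳) (θ : Param p) : Prop :=
  θ ∈ nullSet Θ g ∧ IsLocalMinOn (empObjective μ f β x) (nullSet Θ g) θ

variable {Ω : Type*} [MeasurableSpace Ω]

/-- The first `n` observations. -/
def sample (X : ℕ → Ω → 𝒳) (n : ℕ) (ω : Ω) : Fin n → 𝒳 := fun i => X i ω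

/-- `X 0, X 1, …` is a random sample (iid observations) from the distribution `ν`. -/
structure IsRandomSample (P : Measure Ω) (X : ℕ → Ω → 𝒳) (ν : Measure 𝒳) : Prop where
  measurable : ∀ i, Measurable (X i)
  indep : iIndepFun X P
  law : ∀ i, P.map (X i) = ν

/-- `T n`, a measurable function of the first `n` observations for each `n`, is a consistent
sequence of estimators of `θ₀` and, with probability tending to one, its value has the property
`C` that defines the estimator. -/
structure IsConsistentSeq {p : ℕ} (P : Measure Ω) (X : ℕ → Ω → 𝒳) (θ₀ : Param p)
    (C : ∀ n : ℕ, (Fin n → 𝒳) → Param p → Prop)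
    (T : ∀ n : ℕ, (Fin n → 𝒳) → Param p) : Prop where
  measurable : ∀ n, Measurable (T n)
  consistent : TendstoInMeasure P (fun n ω => T n (sample X n ω)) atTop (fun _ => θ₀)
  property : Tendsto (fun n => P {ω | ¬ C n (sample X n ω) (T n (sample X n ω))}) atTop (𝓝 0)

/-- `T` is a minimum density power divergence estimator: a consistent sequence of roots of the
estimating equation. -/
def IsMDPDE {p : ℕ} (μ : Measure 𝒳) (Θ : Set (Param p)) (f : Param p → 𝒳 → ℝ) (β : ℝ)
    (θ₀ : Param p) (P : Measure Ω) (X : ℕ → Ω → 𝒳)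
    (T : ∀ n : ℕ, (Fin n → 𝒳) → Param p) : Prop :=
  IsConsistentSeq P X θ₀ (fun _ x θ => IsEstimatingRoot μ Θ f β x θ) T

/-- `T` is a restricted minimum density power divergence estimator: a consistent sequence of
minimizers of the empirical objective function subject to `g θ = 0`. -/
def IsRMDPDE {p r : ℕ} (μ : Measure 𝒳) (Θ : Set (Param p)) (f : Param p → 𝒳 → ℝ)
    (g : Param p → Param r) (β : ℝ) (θ₀ : Param p) (P : Measure Ω) (X : ℕ → Ω → 𝒳)
    (T : ∀ n : ℕ, (Fin n → 𝒳) → Param p) : Prop :=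
  IsConsistentSeq P X θ₀ (fun _ x θ => IsRestrictedMin μ Θ f g β x θ) T

/-- The test statistic `2 n d_γ(f_θ̂, f_θ̃)` computed from the first `n` observations. -/
def testStat {p : ℕ} (μ : Measure 𝒳) (f : Param p → 𝒳 → ℝ) (γ : ℝ) (X : ℕ → Ω → 𝒳)
    (T S : ∀ n : ℕ, (Fin n → 𝒳) → Param p) (n : ℕ) (ω : Ω) : ℝ :=
  2 * n * dpd μ γ (f (T n (sample X n ω))) (f (S n (sample X n ω)))

end Model

end

end DPD

open DPD

/-!
Let `z n` be the sample mean of `u f^β - ξ` at `θ₀`; by the central limit theorem `√n z n` is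
asymptotically `N(0, K)`. Smallness in probability is encoded by one filter on `ℕ × Ω`, along which
`o(z)` has its usual deterministic meaning. Linearising the estimating equation gives
`θ̂ - θ₀ = J⁻¹ z + o(z)`, and the Lagrange condition for the constrained minimum gives
`θ̃ - θ₀ = (J⁻¹ - B) z + o(z)`, so that `θ̂ - θ̃ = B z + o(z)`. As `d_γ` vanishes to second order on
the diagonal with Hessian `A`, the statistic is `n (B z)ᵀ A (B z) + o(n ‖z‖²)`. Its limit is a
Gaussian quadratic form whose matrix `K^{1/2} B A B K^{1/2}` is symmetric and has the nonzero
eigenvalues of `A B K B`.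

Both estimators exist because the empirical objective, by its quadratic expansion, is with high
probability larger on every fixed small sphere around `θ₀` than at `θ₀`, so it has a minimizer
inside, which can be selected measurably.
-/

namespace DPD

section MeasurableSelection

variable {α E : Type*} [MeasurableSpace α] [PseudoMetricSpace E] [MeasurableSpace E]
  [SecondCountableTopology E] {Γ : α → Set E}

open TopologicalSpace in
theorem exists_measurable_nonempty_inter_closedBall_of_le [Nonempty E] {q : α → E → Prop}
    (hq : ∀ x, MeasurableSet {a | q a x})
    (hΓ : ∀ x r, MeasurableSet {a | (Γ a ∩ Metric.closedBall x r).Nonempty}) {r : ℝ}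
    (h : ∀ a, ∃ y ∈ Γ a, ∀ x, dist y x ≤ r → q a x) (hr : 0 < r) :
    ∃ f : α → E, Measurable f ∧
      ∀ a, q a (f a) ∧ (Γ a ∩ Metric.closedBall (f a) r).Nonempty := by
  classical
  let p (j : ℕ) (a : α) : Prop :=
    q a (denseSeq E j) ∧ (Γ a ∩ Metric.closedBall (denseSeq E j) r).Nonempty
  have hp : ∀ j, MeasurableSet {a | p j a} := fun j => (hq _).inter (hΓ _ r)
  have hex : ∀ a, ∃ j, p j a := fun a => by
    obtain ⟨y, hy, hyq⟩ := h a
    obtain ⟨j, hj⟩ := (denseRange_denseSeq E).exists_dist_lt y hr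
    exact ⟨j, hyq _ hj.le, y, hy, hj.le⟩
  exact ⟨fun a => denseSeq E (Nat.find (hex a)),
    Measurable.find (fun _ => measurable_const) hp hex, fun a => Nat.find_spec (hex a)⟩

/-- The Kuratowski–Ryll-Nardzewski selection theorem. -/
theorem exists_measurable_forall_mem [BorelSpace E] [CompleteSpace E] (hcl : ∀ a, IsClosed (Γ a))
    (hne : ∀ a, (Γ a).Nonempty)
    (hΓ : ∀ x r, MeasurableSet {a | (Γ a ∩ Metric.closedBall x r).Nonempty}) :
    ∃ f : α → E, Measurable f ∧ ∀ a, f a ∈ Γ a := by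
  rcases isEmpty_or_nonempty α with _ | ⟨⟨a₀⟩⟩
  · exact ⟨isEmptyElim, measurable_of_empty _, isEmptyElim⟩
  have hE : Nonempty E := ⟨(hne a₀).some⟩
  let Approx (n : ℕ) : Type _ := {f : α → E // Measurable f ∧
    ∀ a, (Γ a ∩ Metric.closedBall (f a) ((1 / 2) ^ n)).Nonempty}
  have hstart : Nonempty (Approx 0) := by
    obtain ⟨f, hf, h⟩ := exists_measurable_nonempty_inter_closedBall_of_le (q := fun _ _ => True)
      (by simp) hΓ (fun a => ⟨_, (hne a).some_mem, by simp⟩) (r := (1 / 2) ^ 0) (by simp)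
    exact ⟨f, hf, fun a => (h a).2⟩
  have hstep : ∀ n (f : Approx n), ∃ f' : Approx (n + 1),
      ∀ a, dist (f.1 a) (f'.1 a) ≤ 2 * (1 / 2) ^ n := by
    rintro n ⟨f, hf, h⟩
    obtain ⟨f', hf', h'⟩ := exists_measurable_nonempty_inter_closedBall_of_le
      (q := fun a x => dist (f a) x ≤ 2 * (1 / 2) ^ n) (r := (1 / 2) ^ (n + 1))
      (fun x => measurableSet_le (hf.dist measurable_const) measurable_const) hΓ
      (fun a => (h a).imp fun y hy => ⟨hy.1, fun x hx => by
        have hpow : (1 / 2 : ℝ) ^ (n + 1) ≤ (1 / 2) ^ n :=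
          pow_le_pow_of_le_one (by norm_num) (by norm_num) n.le_succ
        linarith [dist_triangle_left (f a) x y, Metric.mem_closedBall.1 hy.2]⟩) (by positivity)
    exact ⟨⟨f', hf', fun a => (h' a).2⟩, fun a => (h' a).1⟩
  choose next hnext using hstep
  let s (n : ℕ) : Approx n := Nat.rec hstart.some next n
  have hcauchy : ∀ a, CauchySeq fun n => (s n).1 a := fun a =>
    cauchySeq_of_le_geometric (1 / 2) 2 (by norm_num) fun n => hnext n (s n) a
  choose f hf using fun a => cauchySeq_tendsto_of_complete (hcauchy a)
  refine ⟨f, measurable_of_tendsto_metrizable (fun n => (s n).2.1) (tendsto_pi_nhds.2 hf),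
    fun a => ?_⟩
  choose y hyΓ hy using fun n => (s n).2.2 a
  have hyf : Tendsto y atTop (𝓝 (f a)) :=
    (tendsto_iff_of_dist (squeeze_zero (fun _ => dist_nonneg) hy
      (tendsto_pow_atTop_nhds_zero_of_lt_one (by norm_num) (by norm_num)))).2 (hf a)
  exact (hcl a).mem_of_tendsto hyf (Eventually.of_forall hyΓ)

end MeasurableSelection

section MeasurableArgmin

variable {α E : Type*} [MeasurableSpace α] [PseudoMetricSpace E] {F : E → α → ℝ}

open TopologicalSpace in
theorem measurableSet_argmin_inter_nonempty [CompactSpace E] (hm : ∀ θ, Measurable (F θ))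
    (hc : ∀ a, Continuous fun θ => F θ a) {C : Set E} (hC : IsClosed C) :
    MeasurableSet {a | ({θ | ∀ τ, F θ a ≤ F τ a} ∩ C).Nonempty} := by
  rcases C.eq_empty_or_nonempty with rfl | hne
  · simp
  have hCne : Nonempty C := hne.to_subtype
  have hEne : Nonempty E := ⟨hne.some⟩
  -- The minimum over `C` is at most the infimum over `E`, tested on dense sequences.
  have hset : {a | ({θ | ∀ τ, F θ a ≤ F τ a} ∩ C).Nonempty} =
      ⋂ (i : ℕ) (k : ℕ), ⋃ j : ℕ,
        {a | F (denseSeq C j) a < F (denseSeq E i) a + 1 / ((k : ℝ) + 1)} := by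
    ext a
    simp only [Set.mem_ofPred_eq, Set.mem_iInter, Set.mem_iUnion]
    constructor
    · rintro ⟨θ, hθ, hθC⟩ i k
      have hopen : IsOpen {t : C | F t a < F (denseSeq E i) a + 1 / ((k : ℝ) + 1)} :=
        isOpen_lt ((hc a).comp continuous_subtype_val) continuous_const
      exact (denseRange_denseSeq C).exists_mem_open hopen
        ⟨⟨θ, hθC⟩, (hθ _).trans_lt (lt_add_of_pos_right _ (by positivity))⟩
    · intro h
      obtain ⟨θ, hθC, hθ⟩ := hC.isCompact.exists_isMinOn hne (hc a).continuousOn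
      have hdense : ∀ i, F θ a ≤ F (denseSeq E i) a := fun i =>
        le_of_forall_pos_lt_add fun ε hε => by
          obtain ⟨k, hk⟩ := exists_nat_one_div_lt hε
          obtain ⟨j, hj⟩ := h i k
          linarith [isMinOn_iff.1 hθ _ (denseSeq C j).2]
      exact ⟨θ, fun τ => (denseRange_denseSeq E).induction_on τ
        (isClosed_le continuous_const (hc a)) hdense, hθC⟩
  rw [hset]
  exact .iInter fun i => .iInter fun k => .iUnion fun j =>
    measurableSet_lt (hm _) ((hm _).add_const _)

theorem exists_measurable_argmin [MeasurableSpace E] [BorelSpace E] {K : Set E}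
    (hK : IsCompact K) (hne : K.Nonempty) (hm : ∀ θ ∈ K, Measurable (F θ))
    (hc : ∀ a, ContinuousOn (fun θ => F θ a) K) :
    ∃ T : α → E, Measurable T ∧ ∀ a, T a ∈ K ∧ ∀ τ ∈ K, F (T a) a ≤ F τ a := by
  have hKcompact : CompactSpace K := isCompact_iff_compactSpace.1 hK
  have hKne : Nonempty K := hne.to_subtype
  have hcK : ∀ a, Continuous fun θ : K => F θ a := fun a => (hc a).domRestrict
  obtain ⟨T, hT, hmin⟩ := exists_measurable_forall_mem
    (Γ := fun a => {θ : K | ∀ τ : K, F θ a ≤ F τ a})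
    (fun a => by
      simp only [Set.ofPred_forall]
      exact isClosed_iInter fun τ => isClosed_le (hcK a) continuous_const)
    (fun a => by
      obtain ⟨θ, -, hθ⟩ := isCompact_univ.exists_isMinOn Set.univ_nonempty (hcK a).continuousOn
      exact ⟨θ, fun τ => hθ (Set.mem_univ τ)⟩)
    fun x r => measurableSet_argmin_inter_nonempty (F := fun (θ : K) a => F θ a)
      (fun θ => hm θ θ.2) hcK Metric.isClosed_closedBall
  exact ⟨fun a => T a, measurable_subtype_coe.comp hT,
    fun a => ⟨(T a).2, fun τ hτ => hmin a ⟨τ, hτ⟩⟩⟩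

end MeasurableArgmin

section ProbFilter

variable {ι Ω : Type*} {l : Filter ι} [MeasurableSpace Ω] {P : Measure Ω}

/-- The filter on `ι × Ω` along which a property holds eventually if it holds with probability
tending to one along `l`. Convergence to a constant along it is convergence in probability, and
`=o` and `=O` along it are the stochastic order symbols. -/
def probFilter (l : Filter ι) (P : Measure Ω) : Filter (ι × Ω) where
  sets := {S | Tendsto (fun n => P {ω | (n, ω) ∉ S}) l (𝓝 0)}
  univ_sets := by simpa using tendsto_const_nhds
  sets_of_superset {S T} hS hST := tendsto_of_tendsto_of_tendsto_of_le_of_le tendsto_const_nhds hS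
    (fun _ => zero_le) fun n => measure_mono fun ω hω h => hω (hST h)
  inter_sets {S T} hS hT := by
    have hunion : Tendsto (fun n => P {ω | (n, ω) ∉ S} + P {ω | (n, ω) ∉ T}) l (𝓝 0) := by
      simpa only [add_zero] using Tendsto.add hS hT
    exact tendsto_of_tendsto_of_tendsto_of_le_of_le tendsto_const_nhds hunion (fun _ => zero_le)
      fun n => (measure_mono fun ω hω => not_and_or.1 hω).trans (measure_union_le _ _)

theorem eventually_probFilter {p : ι × Ω → Prop} :
    (∀ᶠ q in probFilter l P, p q) ↔ Tendsto (fun n => P {ω | ¬ p (n, ω)}) l (𝓝 0) := Iff.rfl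

theorem tendstoInMeasure_const_iff {E : Type*} [PseudoMetricSpace E] {f : ι → Ω → E} {c : E} :
    TendstoInMeasure P f l (fun _ => c) ↔
      Tendsto (fun q : ι × Ω => f q.1 q.2) (probFilter l P) (𝓝 c) := by
  simp only [tendstoInMeasure_iff_dist, Metric.tendsto_nhds, eventually_probFilter, not_lt,
    gt_iff_lt]

theorem eventually_probFilter_of_ae {p : ι × Ω → Prop} (h : ∀ᵐ ω ∂P, ∀ n, p (n, ω)) :
    ∀ᶠ q in probFilter l P, p q :=
  eventually_probFilter.2 <| tendsto_const_nhds.congr fun n =>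
    (ae_iff.1 (h.mono fun _ hω => hω n)).symm

theorem tendsto_fst_probFilter : Tendsto Prod.fst (probFilter l P) l := fun s hs =>
  eventually_probFilter.2 <| tendsto_const_nhds.congr' <| by
    filter_upwards [hs] with n hn
    simp [show n ∈ s from hn]

variable [IsProbabilityMeasure P] {Ω' : Type*} [MeasurableSpace Ω'] {P' : Measure Ω'}
  [IsProbabilityMeasure P'] {E F : Type*} [NormedAddCommGroup E] [MeasurableSpace E]
  [OpensMeasurableSpace E] [NormedAddCommGroup F] {N : ι → Ω → E} {Z : Ω' → E}

theorem exists_eventually_measure_le_norm_lt (hN : TendstoInDistribution N l Z (fun _ => P) P')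
    {η : ENNReal} (hη : 0 < η) : ∃ C > 0, ∀ᶠ n in l, P {ω | C ≤ ‖N n ω‖} < η := by
  have hclosed : ∀ C : ℝ, IsClosed {x : E | C ≤ ‖x‖} := fun C =>
    isClosed_le continuous_const continuous_norm
  have hlaw : Tendsto (fun C : ℝ => P'.map Z {x | C ≤ ‖x‖}) atTop (𝓝 0) := by
    have hempty : ⋂ C : ℝ, {x : E | C ≤ ‖x‖} = ∅ :=
      Set.eq_empty_of_forall_notMem fun x hx =>
        (lt_add_one ‖x‖).not_ge (Set.mem_iInter.1 hx (‖x‖ + 1))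
    simpa [hempty, Function.comp_def] using tendsto_measure_iInter_atTop (μ := P'.map Z)
      (fun C => (hclosed C).measurableSet.nullMeasurableSet)
      (fun C D hCD x (hx : D ≤ ‖x‖) => hCD.trans hx) ⟨0, measure_ne_top _ _⟩
  obtain ⟨C, hCη, hC⟩ := ((hlaw.eventually_lt_const hη).and (eventually_gt_atTop 0)).exists
  refine ⟨C, hC, ?_⟩
  have hlimsup := ProbabilityMeasure.limsup_measure_closed_le_of_tendsto hN.tendsto (hclosed C)
  filter_upwards [eventually_lt_of_limsup_lt (hlimsup.trans_lt hCη)] with n hn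
  rwa [ProbabilityMeasure.coe_mk, Measure.map_apply_of_aemeasurable (hN.forall_aemeasurable n)
    (hclosed C).measurableSet] at hn

theorem tendsto_zero_of_isLittleO_probFilter (hN : TendstoInDistribution N l Z (fun _ => P) P')
    {R : ι × Ω → F} (hR : R =o[probFilter l P] fun q => N q.1 q.2) :
    Tendsto R (probFilter l P) (𝓝 0) := by
  refine Metric.tendsto_nhds.2 fun δ hδ =>
    eventually_probFilter.2 <| ENNReal.tendsto_nhds_zero.2 fun η hη => ?_
  have hη2 : 0 < η / 2 := ENNReal.half_pos hη.ne'
  obtain ⟨C, hC, hbound⟩ := exists_eventually_measure_le_norm_lt hN hη2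
  have hsmall := eventually_probFilter.1 (hR.def (div_pos hδ hC))
  filter_upwards [hbound, ENNReal.tendsto_nhds_zero.1 hsmall _ hη2] with n hn hRn
  refine (measure_mono fun ω hω => ?_).trans ((measure_union_le _ _).trans
    ((add_le_add hn.le hRn).trans_eq (ENNReal.add_halves η)))
  refine or_iff_not_imp_right.2 fun hle => ?_
  have hδR : δ ≤ δ / C * ‖N n ω‖ := by
    have hω' : δ ≤ ‖R (n, ω)‖ := by simpa using hω
    exact hω'.trans (by simpa using hle)
  rw [div_mul_eq_mul_div, le_div_iff₀ hC] at hδR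
  exact le_of_mul_le_mul_left hδR hδ

end ProbFilter

section QuadraticForms

variable {ι κ : Type*} [Fintype ι] [Fintype κ]

theorem rank_transpose_mul_self_mul {R m n o : Type*} [Field R] [LinearOrder R]
    [IsStrictOrderedRing R] [Fintype m] [Fintype n] [Fintype o] (X : Matrix m n R)
    (Y : Matrix n o R) : (Xᵀ * X * Y).rank = (X * Y).rank := by
  have hker : (Xᵀ * X * Y).mulVecLin.ker = (X * Y).mulVecLin.ker := by
    rw [mulVecLin_mul (Xᵀ * X), mulVecLin_mul X, LinearMap.ker_comp, LinearMap.ker_comp,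
      ker_mulVecLin_transpose_mul_self]
  have h₁ := (Xᵀ * X * Y).mulVecLin.finrank_range_add_finrank_ker
  have h₂ := (X * Y).mulVecLin.finrank_range_add_finrank_ker
  rw [hker] at h₁
  exact Nat.add_right_cancel (h₁.trans h₂.symm)

theorem rank_transpose_mul_self_mul_mul_transpose_mul_self {R m n : Type*} [Field R]
    [LinearOrder R] [IsStrictOrderedRing R] [Fintype m] [Fintype n] (X : Matrix m n R)
    (A : Matrix n n R) : (Xᵀ * X * A * (Xᵀ * X)).rank = (X * A * Xᵀ).rank := by
  calc (Xᵀ * X * A * (Xᵀ * X)).rank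
      = (Xᵀ * X * (A * (Xᵀ * X))).rank := by rw [Matrix.mul_assoc (Xᵀ * X)]
    _ = (X * (A * (Xᵀ * X))).rank := rank_transpose_mul_self_mul X _
    _ = (Xᵀ * X * (Aᵀ * Xᵀ)).rank := by
      rw [← rank_transpose]
      simp only [transpose_mul, transpose_transpose, Matrix.mul_assoc]
    _ = (X * (Aᵀ * Xᵀ)).rank := rank_transpose_mul_self_mul X _
    _ = (X * A * Xᵀ).rank := by
      rw [← rank_transpose]
      simp only [transpose_mul, transpose_transpose, Matrix.mul_assoc]

theorem prod_X_sub_C_eq_X_pow_mul_prod {R : Type*} [CommRing R] (l : ι → R)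
    (e : κ ≃ {i // l i ≠ 0}) :
    ∏ i, (Polynomial.X - C (l i)) =
      Polynomial.X ^ (Fintype.card ι - Fintype.card κ) * ∏ i, (Polynomial.X - C (l (e i))) := by
  classical
  have hzero : ∏ i : {i // ¬ l i ≠ 0}, (Polynomial.X - C (l i)) =
      Polynomial.X ^ (Fintype.card ι - Fintype.card κ) := by
    rw [Fintype.card_congr e, ← Fintype.card_subtype_compl, ← Finset.card_univ,
      ← Finset.prod_const]
    exact Finset.prod_congr rfl fun i _ => by rw [not_not.1 i.2, map_zero, sub_zero]
  rw [← Fintype.prod_subtype_mul_prod_subtype (fun i => l i ≠ 0), hzero, mul_comm,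
    Equiv.prod_comp e fun i => Polynomial.X - C (l i)]

theorem map_comp_pi_of_injective {α : Type*} [MeasurableSpace α] (ν : Measure α)
    [IsProbabilityMeasure ν] {e : κ → ι} (he : Function.Injective e) :
    (Measure.pi fun _ : ι => ν).map (fun z => z ∘ e) = Measure.pi fun _ : κ => ν := by
  have hindep : iIndepFun (fun i (z : ι → α) => z i) (Measure.pi fun _ : ι => ν) :=
    iIndepFun_pi (X := fun _ x => x) fun _ => aemeasurable_id
  have hlaw := (iIndepFun_iff_map_fun_eq_pi_map
    fun i => (measurable_pi_apply (e i)).aemeasurable).1 (hindep.precomp he)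
  simp only [(measurePreserving_eval (fun _ : ι => ν) _).map_eq] at hlaw
  exact hlaw

theorem map_sum_mul_sq_pi_eq {ν : Measure ℝ} [IsProbabilityMeasure ν] (l : ι → ℝ)
    (e : κ ≃ {i // l i ≠ 0}) :
    (Measure.pi fun _ : ι => ν).map (fun z => ∑ i, l i * z i ^ 2) =
      (Measure.pi fun _ : κ => ν).map fun z => ∑ i, l (e i) * z i ^ 2 := by
  have hsum : ∀ z : ι → ℝ, ∑ i, l i * z i ^ 2 = ∑ i, l (e i) * z (e i) ^ 2 := fun z => by
    rw [← Fintype.sum_subtype_add_sum_subtype (fun i => l i ≠ 0),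
      Equiv.sum_comp e fun i => l i * z i ^ 2, add_eq_left]
    exact Finset.sum_eq_zero fun i _ => by rw [not_not.1 i.2, zero_mul]
  rw [← map_comp_pi_of_injective ν (Subtype.val_injective.comp e.injective),
    Measure.map_map (by fun_prop) (by fun_prop)]
  simp only [hsum, Function.comp_def]

variable [DecidableEq ι] {K N : Matrix ι ι ℝ}

/-- Diagonalize the form and use the rotation invariance of the Gaussian law. -/
theorem map_dotProduct_mulVec_stdGaussian (hN : N.IsHermitian) :
    (stdGaussian (EuclideanSpace ℝ ι)).map (fun x => x.ofLp ⬝ᵥ N *ᵥ x.ofLp) =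
      (Measure.pi fun _ : ι => gaussianReal 0 1).map
        fun z => ∑ i, hN.eigenvalues i * z i ^ 2 := by
  set b := hN.eigenvectorBasis
  have hb : ∀ i, toEuclideanCLM (𝕜 := ℝ) N (b i) = hN.eigenvalues i • b i := fun i => by
    ext j
    exact congrFun (hN.mulVec_eigenvectorBasis i) j
  have hdiag : ∀ z : ι → ℝ, (∑ i, z i • b i).ofLp ⬝ᵥ N *ᵥ (∑ i, z i • b i).ofLp =
      ∑ i, hN.eigenvalues i * z i ^ 2 := fun z => by
    rw [← inner_toEuclideanCLM]
    simp only [map_sum, map_smul, hb, smul_smul, b.orthonormal.inner_sum, conj_trivial]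
    exact Finset.sum_congr rfl fun i _ => by ring
  rw [stdGaussian_eq_map_pi_orthonormalBasis b, Measure.map_map (by fun_prop) (by fun_prop)]
  exact congrArg₂ _ (funext hdiag) rfl

open scoped MatrixOrder Matrix.Norms.L2Operator

theorem isHermitian_sqrt : (CFC.sqrt K).IsHermitian :=
  (CFC.sqrt_nonneg K).isSelfAdjoint

theorem isHermitian_sqrt_mul_mul_sqrt (hN : N.IsHermitian) :
    (CFC.sqrt K * N * CFC.sqrt K).IsHermitian := by
  simpa only [isHermitian_sqrt.eq] using isHermitian_mul_mul_conjTranspose (CFC.sqrt K) hN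

theorem map_dotProduct_mulVec_multivariateGaussian (hN : N.IsHermitian) :
    (multivariateGaussian 0 K).map (fun x => x.ofLp ⬝ᵥ N *ᵥ x.ofLp) =
      (Measure.pi fun _ : ι => gaussianReal 0 1).map
        fun z => ∑ i, (isHermitian_sqrt_mul_mul_sqrt (K := K) hN).eigenvalues i * z i ^ 2 := by
  rw [← map_dotProduct_mulVec_stdGaussian, multivariateGaussian,
    Measure.map_map (by fun_prop) (by fun_prop)]
  congr 1
  ext x
  have hsqrt : (CFC.sqrt K)ᵀ = CFC.sqrt K := isHermitian_sqrt
  simp only [Function.comp_apply, zero_add, ofLp_toEuclideanCLM, ← mulVec_mulVec]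
  rw [dotProduct_mulVec x.ofLp (CFC.sqrt K), ← mulVec_transpose, hsqrt]

/-- `A B K B` is conjugated to the symmetric matrix of the Gaussian quadratic form of `B A B` by
moving factors cyclically, which does not change the characteristic polynomial. -/
theorem exists_eigenvalues_ne_zero {p : ℕ} {K A B : Matrix (Fin p) (Fin p) ℝ} (hK : K.PosSemidef)
    (hA : A.IsSymm) (hB : B.IsSymm) :
    ∃ lam : Fin (B * K * B * A * B * K * B).rank → ℝ, (∀ i, lam i ≠ 0) ∧
      (A * B * K * B).charpoly =
        Polynomial.X ^ (p - (B * K * B * A * B * K * B).rank)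
          * ∏ i, (Polynomial.X - C (lam i)) ∧
      (multivariateGaussian 0 K).map (fun x => (B *ᵥ x.ofLp) ⬝ᵥ A *ᵥ (B *ᵥ x.ofLp)) =
        (Measure.pi fun _ => gaussianReal 0 1).map fun z => ∑ i, lam i * z i ^ 2 := by
  set S := CFC.sqrt K
  have hS : Sᵀ = S := isHermitian_sqrt
  have hSS : S * S = K := CFC.sqrt_mul_sqrt_self K hK.nonneg
  have hN : (B * A * B).IsHermitian := by
    rw [IsHermitian, conjTranspose_eq_transpose_of_trivial]
    simp only [transpose_mul, hA.eq, hB.eq, Matrix.mul_assoc]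
  have hM : (S * (B * A * B) * S).IsHermitian := isHermitian_sqrt_mul_mul_sqrt hN
  have hrank : (B * K * B * A * B * K * B).rank = Fintype.card {i // hM.eigenvalues i ≠ 0} := by
    have h := rank_transpose_mul_self_mul_mul_transpose_mul_self (S * B) A
    rw [← hM.rank_eq_card_non_zero_eigs]
    simpa only [transpose_mul, hS, hB.eq, ← hSS, Matrix.mul_assoc] using h
  let e : Fin (B * K * B * A * B * K * B).rank ≃ {i // hM.eigenvalues i ≠ 0} :=
    Fintype.equivOfCardEq ((Fintype.card_fin _).trans hrank)
  refine ⟨fun i => hM.eigenvalues (e i), fun i => (e i).2, ?_, ?_⟩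
  · calc (A * B * K * B).charpoly = ((A * B * S) * (S * B)).charpoly := by
          simp only [← hSS, Matrix.mul_assoc]
      _ = (S * (B * A * B) * S).charpoly := by
          rw [charpoly_mul_comm]
          simp only [Matrix.mul_assoc]
      _ = ∏ i, (Polynomial.X - C (hM.eigenvalues i)) := hM.charpoly_eq
      _ = _ := by rw [prod_X_sub_C_eq_X_pow_mul_prod _ e, Fintype.card_fin, Fintype.card_fin]
  · rw [← map_sum_mul_sq_pi_eq _ e, ← map_dotProduct_mulVec_multivariateGaussian hN]
    congr 1
    ext x
    rw [dotProduct_comm, dotProduct_mulVec, ← mulVec_transpose, hB.eq, dotProduct_comm]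
    simp only [mulVec_mulVec, Matrix.mul_assoc]

end QuadraticForms

section Sample

variable {𝒳 Ω E : Type*} [MeasurableSpace 𝒳] [MeasurableSpace Ω] {P : Measure Ω}
  {X : ℕ → Ω → 𝒳} {ν : Measure 𝒳}

theorem IsRandomSample.ae_forall (hX : IsRandomSample P X ν) {p : 𝒳 → Prop} (h : ∀ᵐ x ∂ν, p x) :
    ∀ᵐ ω ∂P, ∀ i, p (X i ω) :=
  ae_all_iff.2 fun i => ae_of_ae_map (hX.measurable i).aemeasurable (by rwa [hX.law i])

theorem IsRandomSample.measurePreserving (hX : IsRandomSample P X ν) (i : ℕ) :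
    MeasurePreserving (X i) P ν := ⟨hX.measurable i, hX.law i⟩

theorem IsRandomSample.isProbabilityMeasure [IsProbabilityMeasure P] (hX : IsRandomSample P X ν) :
    IsProbabilityMeasure ν :=
  hX.law 0 ▸ Measure.isProbabilityMeasure_map (hX.measurable 0).aemeasurable

theorem IsRandomSample.identDistrib_comp [MeasurableSpace E] (hX : IsRandomSample P X ν)
    {w : 𝒳 → E} (hw : AEMeasurable w ν) (i : ℕ) :
    IdentDistrib (fun ω => w (X i ω)) (fun ω => w (X 0 ω)) P P :=
  IdentDistrib.comp_of_aemeasurable ⟨(hX.measurable i).aemeasurable,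
    (hX.measurable 0).aemeasurable, by rw [hX.law, hX.law]⟩ (by rwa [hX.law])

theorem IsRandomSample.iIndepFun_comp [MeasurableSpace E] (hX : IsRandomSample P X ν)
    {w : 𝒳 → E} (hw : AEMeasurable w ν) : iIndepFun (fun i ω => w (X i ω)) P :=
  hX.indep.comp₀ (fun _ => w) (fun i => (hX.measurable i).aemeasurable) fun i => by rwa [hX.law]

theorem IsRandomSample.integral_comp [NormedAddCommGroup E] [NormedSpace ℝ E]
    (hX : IsRandomSample P X ν) {w : 𝒳 → E} (hw : AEStronglyMeasurable w ν) (i : ℕ) :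
    ∫ ω, w (X i ω) ∂P = ∫ x, w x ∂ν := by
  rw [← hX.law i, integral_map (hX.measurable i).aemeasurable (by rwa [hX.law])]

end Sample

section SampleMean

variable {𝒳 Ω E : Type*} {X : ℕ → Ω → 𝒳} [NormedAddCommGroup E]

/-- The sample mean of `w (X i)` over the first `q.1` observations, at the outcome `q.2`. -/
noncomputable def sampleMean [NormedSpace ℝ E] (X : ℕ → Ω → 𝒳) (w : 𝒳 → E) (q : ℕ × Ω) : E :=
  (q.1 : ℝ)⁻¹ • ∑ i, w (sample X q.1 q.2 i)

theorem sampleMean_eq_sum_range [NormedSpace ℝ E] (w : 𝒳 → E) (q : ℕ × Ω) :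
    sampleMean X w q = (q.1 : ℝ)⁻¹ • ∑ k ∈ Finset.range q.1, w (X k q.2) := by
  rw [← Fin.sum_univ_eq_sum_range fun k => w (X k q.2)]
  rfl

theorem inner_sqrt_smul_sampleMean [InnerProductSpace ℝ E] (w : 𝒳 → E) (n : ℕ) (ω : Ω) (t : E) :
    inner ℝ (√n • sampleMean X w (n, ω)) t =
      (√n)⁻¹ * ∑ k ∈ Finset.range n, inner ℝ (w (X k ω)) t := by
  rw [sampleMean_eq_sum_range, smul_smul, ← div_eq_mul_inv, Real.sqrt_div_self', one_div,
    inner_smul_left, sum_inner, conj_trivial]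

variable [MeasurableSpace 𝒳] [MeasurableSpace Ω] {P : Measure Ω} {ν : Measure 𝒳}
  [NormedSpace ℝ E] [MeasurableSpace E] [BorelSpace E]

theorem IsRandomSample.aemeasurable_sampleMean [SecondCountableTopology E]
    (hX : IsRandomSample P X ν) {w : 𝒳 → E} (hw : AEMeasurable w ν) (n : ℕ) :
    AEMeasurable (fun ω => sampleMean X w (n, ω)) P := by
  have hcomp : ∀ i, AEMeasurable (fun ω => w (X i ω)) P := fun i =>
    hw.comp_quasiMeasurePreserving (hX.measurePreserving i).quasiMeasurePreserving
  have hsum : AEMeasurable (fun ω => ∑ i, w (sample X n ω i)) P :=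
    Finset.aemeasurable_fun_sum _ fun i _ => hcomp i
  exact hsum.const_smul (n : ℝ)⁻¹

theorem IsRandomSample.tendsto_sampleMean [CompleteSpace E] [IsProbabilityMeasure P]
    (hX : IsRandomSample P X ν) {w : 𝒳 → E} (hw : Integrable w ν) :
    Tendsto (sampleMean X w) (probFilter atTop P) (𝓝 (∫ x, w x ∂ν)) := by
  have hint : ∀ i, Integrable (fun ω => w (X i ω)) P := fun i =>
    (hX.measurePreserving i).integrable_comp_of_integrable hw
  have hlln := strong_law_ae (fun i ω => w (X i ω)) (hint 0)
    (fun i j hij => (hX.iIndepFun_comp hw.1.aemeasurable).indepFun hij)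
    (hX.identDistrib_comp hw.1.aemeasurable)
  rw [hX.integral_comp hw.1 0] at hlln
  refine (tendstoInMeasure_const_iff (f := fun n ω => sampleMean X w (n, ω))).1
    (tendstoInMeasure_of_tendsto_ae (fun n => ?_) ?_)
  · have hsum : AEStronglyMeasurable (fun ω => ∑ i, w (sample X n ω i)) P :=
      Finset.aestronglyMeasurable_fun_sum _ fun i _ => (hint i).1
    exact hsum.const_smul (n : ℝ)⁻¹
  · simpa only [sampleMean_eq_sum_range] using hlln

end SampleMean

section CentralLimit

theorem tendstoInDistribution_congr_law {ι E Ω Ω' Ω'' : Type*} {l : Filter ι} [TopologicalSpace E]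
    [MeasurableSpace E] [OpensMeasurableSpace E] [MeasurableSpace Ω] [MeasurableSpace Ω']
    [MeasurableSpace Ω''] {P : Measure Ω} [IsProbabilityMeasure P] {P' : Measure Ω'}
    [IsProbabilityMeasure P'] {P'' : Measure Ω''} [IsProbabilityMeasure P''] {Y : ι → Ω → E}
    {Z : Ω' → E} {Z' : Ω'' → E} (h : TendstoInDistribution Y l Z (fun _ => P) P')
    (hZ' : AEMeasurable Z' P'') (hlaw : P'.map Z = P''.map Z') :
    TendstoInDistribution Y l Z' (fun _ => P) P'' where
  forall_aemeasurable := h.forall_aemeasurable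
  aemeasurable_limit := hZ'
  tendsto := by simpa only [hlaw] using h.tendsto

section CramerWold

variable {Ω Ω' E : Type*} [MeasurableSpace Ω] [MeasurableSpace Ω'] {P : Measure Ω}
  {P' : Measure Ω'} [NormedAddCommGroup E] [InnerProductSpace ℝ E] [SecondCountableTopology E]
  [MeasurableSpace E] [BorelSpace E]

theorem charFun_map_eq_charFun_map_inner {Y : Ω → E} (hY : AEMeasurable Y P) (t : E) :
    charFun (P.map Y) t = charFun (P.map fun ω => inner ℝ (Y ω) t) 1 := by
  have hYt : AEMeasurable (fun ω => inner ℝ (Y ω) t) P := hY.inner_const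
  rw [charFun_apply, charFun_apply, integral_map hY (Measurable.aestronglyMeasurable (by fun_prop)),
    integral_map hYt (Measurable.aestronglyMeasurable (by fun_prop))]
  simp

theorem tendstoInDistribution_of_forall_inner [IsProbabilityMeasure P] [IsProbabilityMeasure P']
    [FiniteDimensional ℝ E] {Y : ℕ → Ω → E} {Z : Ω' → E} (hY : ∀ n, AEMeasurable (Y n) P)
    (hZ : AEMeasurable Z P')
    (h : ∀ t, TendstoInDistribution (fun n ω => inner ℝ (Y n ω) t) atTop
      (fun ω => inner ℝ (Z ω) t) (fun _ => P) P') :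
    TendstoInDistribution Y atTop Z (fun _ => P) P' where
  forall_aemeasurable := hY
  aemeasurable_limit := hZ
  tendsto := ProbabilityMeasure.tendsto_iff_tendsto_charFun.2 fun t => by
    simpa only [ProbabilityMeasure.coe_mk, charFun_map_eq_charFun_map_inner (hY _),
      charFun_map_eq_charFun_map_inner hZ] using
      ProbabilityMeasure.tendsto_iff_tendsto_charFun.1 (h t).tendsto 1

end CramerWold

variable {𝒳 ι : Type*} [MeasurableSpace 𝒳] {ν : Measure 𝒳} [Fintype ι]

/-- The matrix of second moments of a random vector. -/
noncomputable def secondMoment (ν : Measure 𝒳) (w : 𝒳 → EuclideanSpace ℝ ι) : Matrix ι ι ℝ :=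
  Matrix.of fun i j => ∫ x, w x i * w x j ∂ν

theorem dotProduct_secondMoment_mulVec {w : 𝒳 → EuclideanSpace ℝ ι} (hw : MemLp w 2 ν)
    (t : ι → ℝ) : t ⬝ᵥ secondMoment ν w *ᵥ t = ∫ x, inner ℝ (w x) (WithLp.toLp 2 t) ^ 2 ∂ν := by
  have hsq : ∀ x, inner ℝ (w x) (WithLp.toLp 2 t) ^ 2 =
      ∑ i, ∑ j, t i * (t j * (w x i * w x j)) := fun x => by
    simp only [PiLp.inner_apply, pow_two, Finset.sum_mul_sum, RCLike.inner_apply, conj_trivial]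
    exact Finset.sum_congr rfl fun i _ => Finset.sum_congr rfl fun j _ => by ring
  have hint : ∀ i j, Integrable (fun x => t i * (t j * (w x i * w x j))) ν := fun i j =>
    (((hw.eval_piLp i).integrable_mul (hw.eval_piLp j)).const_mul _).const_mul _
  simp only [hsq]
  rw [integral_finsetSum _ fun i _ => integrable_finsetSum _ fun j _ => hint i j]
  simp only [integral_finsetSum _ fun j _ => hint _ j, integral_const_mul, dotProduct, mulVec,
    secondMoment, Matrix.of_apply, Finset.mul_sum]
  exact Finset.sum_congr rfl fun i _ => Finset.sum_congr rfl fun j _ => by ring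

theorem posSemidef_secondMoment {w : 𝒳 → EuclideanSpace ℝ ι} (hw : MemLp w 2 ν) :
    (secondMoment ν w).PosSemidef := by
  refine Matrix.PosSemidef.of_dotProduct_mulVec_nonneg ?_ fun t => ?_
  · ext i j
    simp only [secondMoment, Matrix.conjTranspose_apply, Matrix.of_apply, star_trivial, mul_comm]
  · rw [star_trivial, dotProduct_secondMoment_mulVec hw]
    exact integral_nonneg fun x => sq_nonneg _

theorem map_inner_multivariateGaussian [DecidableEq ι] {S : Matrix ι ι ℝ} (hS : S.PosSemidef)
    (t : EuclideanSpace ℝ ι) : (multivariateGaussian 0 S).map (fun x => inner ℝ x t) =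
      gaussianReal 0 (t.ofLp ⬝ᵥ S *ᵥ t.ofLp).toNNReal := by
  refine Measure.ext_of_charFun (funext fun s => ?_)
  have hnonneg : 0 ≤ t.ofLp ⬝ᵥ S *ᵥ t.ofLp := by
    simpa only [star_trivial] using hS.dotProduct_mulVec_nonneg t.ofLp
  have hinner : ∀ x : EuclideanSpace ℝ ι, inner ℝ (inner ℝ x t) s = inner ℝ x (s • t) := fun x => by
    rw [inner_smul_right]
    rfl
  have hsmul : charFun ((multivariateGaussian 0 S).map fun x => inner ℝ x t) s =
      charFun (multivariateGaussian 0 S) (s • t) := by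
    rw [charFun_apply, charFun_apply, integral_map (by fun_prop)
      (Measurable.aestronglyMeasurable (by fun_prop))]
    simp only [hinner]
  rw [hsmul, charFun_multivariateGaussian hS, charFun_gaussianReal, Real.coe_toNNReal _ hnonneg]
  simp only [inner_zero_right, WithLp.ofLp_smul, mulVec_smul, dotProduct_smul, smul_dotProduct,
    smul_eq_mul, Complex.ofReal_mul, Complex.ofReal_zero, zero_mul]
  ring_nf

variable {Ω : Type*} [MeasurableSpace Ω] {P : Measure Ω} [IsProbabilityMeasure P] {X : ℕ → Ω → 𝒳}

theorem IsRandomSample.tendstoInDistribution_sqrt_smul_sampleMean [DecidableEq ι]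
    (hX : IsRandomSample P X ν) {w : 𝒳 → EuclideanSpace ℝ ι} (hw : MemLp w 2 ν)
    (hmean : ∫ x, w x ∂ν = 0) :
    TendstoInDistribution (fun (n : ℕ) ω => √n • sampleMean X w (n, ω)) atTop id (fun _ => P)
      (multivariateGaussian 0 (secondMoment ν w)) := by
  have hw' : AEMeasurable w ν := hw.1.aemeasurable
  refine tendstoInDistribution_of_forall_inner
    (fun n => (hX.aemeasurable_sampleMean hw' n).const_smul (√n : ℝ)) aemeasurable_id fun t => ?_
  have hprob := hX.isProbabilityMeasure
  have hwt : AEMeasurable (fun x => inner ℝ (w x) t) ν := hw'.inner_const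
  have hmean_t : ∫ x, inner ℝ (w x) t ∂ν = 0 := by
    simp only [real_inner_comm t]
    rw [integral_inner (hw.integrable one_le_two), hmean, inner_zero_right]
  have hmean_P : ∫ ω, inner ℝ (w (X 0 ω)) t ∂P = 0 :=
    (hX.integral_comp hwt.aestronglyMeasurable 0).trans hmean_t
  have hwt_comp : AEMeasurable (fun ω => inner ℝ (w (X 0 ω)) t) P :=
    hwt.comp_quasiMeasurePreserving (hX.measurePreserving 0).quasiMeasurePreserving
  have hvar : Var[fun ω => inner ℝ (w (X 0 ω)) t; P] =
      t.ofLp ⬝ᵥ secondMoment ν w *ᵥ t.ofLp := by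
    rw [dotProduct_secondMoment_mulVec hw, variance_of_integral_eq_zero
      hwt_comp hmean_P]
    exact hX.integral_comp (hwt.pow_const 2).aestronglyMeasurable 0
  have hlimit : HasLaw (fun x => inner ℝ (id x) t)
      (gaussianReal 0 Var[fun ω => inner ℝ (w (X 0 ω)) t; P].toNNReal)
      (multivariateGaussian 0 (secondMoment ν w)) :=
    ⟨by fun_prop, hvar ▸ map_inner_multivariateGaussian (posSemidef_secondMoment hw) t⟩
  have hclt := tendstoInDistribution_inv_sqrt_mul_sum_sub hlimit
    (X := fun i ω => inner ℝ (w (X i ω)) t)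
    ((hw.inner_const t).comp_measurePreserving (hX.measurePreserving 0)) (hX.iIndepFun_comp hwt)
    (hX.identDistrib_comp hwt)
  simpa only [inner_sqrt_smul_sampleMean, hmean_P, mul_zero, sub_zero] using hclt

end CentralLimit

section Calculus

variable {E : Type*} [NormedAddCommGroup E] [NormedSpace ℝ E]

theorem differentiableAt_iteratedFDeriv_fderiv {F : Type*} [NormedAddCommGroup F]
    [NormedSpace ℝ F] {φ : E → F} {θ : E} {n : ℕ}
    (h : DifferentiableAt ℝ (iteratedFDeriv ℝ (n + 1) φ) θ) :
    DifferentiableAt ℝ (iteratedFDeriv ℝ n (fderiv ℝ φ)) θ := by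
  have heq : iteratedFDeriv ℝ n (fderiv ℝ φ) = continuousMultilinearCurryRightEquiv' ℝ n E F ∘
      iteratedFDeriv ℝ (n + 1) φ := by
    ext1 y
    rw [Function.comp_apply, iteratedFDeriv_succ_eq_comp_right]
    simp
  rw [heq]
  exact ((continuousMultilinearCurryRightEquiv' ℝ n E F).toContinuousLinearEquiv :
    (E [×n.succ]→L[ℝ] F) →L[ℝ] (E [×n]→L[ℝ] E →L[ℝ] F)).differentiableAt.comp θ h

theorem differentiableAt_iteratedFDeriv_zero_iff {F : Type*} [NormedAddCommGroup F]
    [NormedSpace ℝ F] {φ : E → F} {θ : E} :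
    DifferentiableAt ℝ (iteratedFDeriv ℝ 0 φ) θ ↔ DifferentiableAt ℝ φ θ := by
  rw [iteratedFDeriv_zero_eq_comp]
  exact (continuousMultilinearCurryFin0 ℝ E F).symm.comp_differentiableAt_iff

set_option maxSynthPendingDepth 5 in
theorem norm_fderiv_fderiv_fderiv (φ : E → ℝ) (θ : E) :
    ‖fderiv ℝ (fderiv ℝ (fderiv ℝ φ)) θ‖ = ‖iteratedFDeriv ℝ 3 φ θ‖ := by
  rw [← norm_iteratedFDeriv_fderiv, ← norm_iteratedFDeriv_fderiv, ← norm_iteratedFDeriv_fderiv,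
    norm_iteratedFDeriv_zero]

theorem fderiv_comp_of_hasDerivAt {h h₁ : ℝ → ℝ} (hh : ∀ y, 0 < y → HasDerivAt h (h₁ y) y)
    {F : E → ℝ} {θ : E} (hF : DifferentiableAt ℝ F θ) (hpos : 0 < F θ) :
    fderiv ℝ (fun τ => h (F τ)) θ = h₁ (F θ) • fderiv ℝ F θ :=
  ((hh _ hpos).comp_hasFDerivAt θ hF.hasFDerivAt).fderiv

theorem hasFDerivAt_fderiv_comp {h h₁ h₂ : ℝ → ℝ} (hh : ∀ y, 0 < y → HasDerivAt h (h₁ y) y)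
    (hh₁ : ∀ y, 0 < y → HasDerivAt h₁ (h₂ y) y) {F : E → ℝ} {U : Set E} (hU : IsOpen U) {θ : E}
    (hθ : θ ∈ U) (hF : ∀ τ ∈ U, DifferentiableAt ℝ F τ) (hF₁ : DifferentiableAt ℝ (fderiv ℝ F) θ)
    (hpos : ∀ τ ∈ U, 0 < F τ) :
    HasFDerivAt (fderiv ℝ fun τ => h (F τ)) (h₁ (F θ) • fderiv ℝ (fderiv ℝ F) θ +
      (h₂ (F θ) • fderiv ℝ F θ).smulRight (fderiv ℝ F θ)) θ := by
  have heq : (fderiv ℝ fun τ => h (F τ)) =ᶠ[𝓝 θ] fun τ => h₁ (F τ) • fderiv ℝ F τ := by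
    filter_upwards [hU.mem_nhds hθ] with τ hτ
    exact fderiv_comp_of_hasDerivAt hh (hF τ hτ) (hpos τ hτ)
  refine HasFDerivAt.congr_of_eventuallyEq ?_ heq
  exact ((hh₁ _ (hpos θ hθ)).comp_hasFDerivAt θ (hF θ hθ).hasFDerivAt).fun_smul hF₁.hasFDerivAt

theorem fderiv_fderiv_comp_apply {h h₁ h₂ : ℝ → ℝ} (hh : ∀ y, 0 < y → HasDerivAt h (h₁ y) y)
    (hh₁ : ∀ y, 0 < y → HasDerivAt h₁ (h₂ y) y) {F : E → ℝ} {U : Set E} (hU : IsOpen U) {θ : E}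
    (hθ : θ ∈ U) (hF : ∀ τ ∈ U, DifferentiableAt ℝ F τ) (hF₁ : DifferentiableAt ℝ (fderiv ℝ F) θ)
    (hpos : ∀ τ ∈ U, 0 < F τ) (v w : E) :
    fderiv ℝ (fderiv ℝ fun τ => h (F τ)) θ v w =
      h₂ (F θ) * fderiv ℝ F θ v * fderiv ℝ F θ w + h₁ (F θ) * fderiv ℝ (fderiv ℝ F) θ v w := by
  rw [(hasFDerivAt_fderiv_comp hh hh₁ hU hθ hF hF₁ hpos).fderiv]
  simp only [_root_.add_apply, _root_.smul_apply, smul_eq_mul,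
    ContinuousLinearMap.smulRight_apply]
  ring

theorem fderiv_comp_eq_zero_of_forall_eq {F : E → ℝ} {U : Set E} {θ : E} {c : ℝ} (hU : IsOpen U)
    (h : ∀ τ ∈ U, F τ = c) (hθ : θ ∈ U) (g : ℝ → ℝ) : fderiv ℝ (fun τ => g (F τ)) θ = 0 := by
  have hconst : (fun τ => g (F τ)) =ᶠ[𝓝 θ] fun _ => g c := by
    filter_upwards [hU.mem_nhds hθ] with τ hτ
    rw [h τ hτ]
  rw [hconst.fderiv_eq, fderiv_fun_const, Pi.zero_apply]

theorem fderiv_fderiv_comp_eq_zero_of_forall_eq {F : E → ℝ} {U : Set E} {θ : E} {c : ℝ}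
    (hU : IsOpen U) (h : ∀ τ ∈ U, F τ = c) (hθ : θ ∈ U) (g : ℝ → ℝ) :
    fderiv ℝ (fderiv ℝ fun τ => g (F τ)) θ = 0 := by
  have hconst : (fderiv ℝ fun τ => g (F τ)) =ᶠ[𝓝 θ] fun _ => 0 := by
    filter_upwards [hU.mem_nhds hθ] with τ hτ
    exact fderiv_comp_eq_zero_of_forall_eq hU h hτ g
  rw [hconst.fderiv_eq, fderiv_fun_const, Pi.zero_apply]

/-- `φ` is three times differentiable at the points of `U`. Iterated `fderiv`s are used because the
Taylor expansions apply the second derivative as a bilinear form. -/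
structure ThriceDifferentiableOn (φ : E → ℝ) (U : Set E) : Prop where
  differentiableAt : ∀ θ ∈ U, DifferentiableAt ℝ φ θ
  differentiableAt_fderiv : ∀ θ ∈ U, DifferentiableAt ℝ (fderiv ℝ φ) θ
  differentiableAt_fderiv_fderiv : ∀ θ ∈ U, DifferentiableAt ℝ (fderiv ℝ (fderiv ℝ φ)) θ

theorem ThriceDifferentiableOn.of_contDiffOn {φ : E → ℝ} {U : Set E} (hU : IsOpen U)
    (h : ContDiffOn ℝ 3 φ U) : ThriceDifferentiableOn φ U := by
  have h1 : ContDiffOn ℝ 2 (fderiv ℝ φ) U := h.fderiv_of_isOpen hU (by norm_num)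
  have h2 : ContDiffOn ℝ 1 (fderiv ℝ (fderiv ℝ φ)) U := h1.fderiv_of_isOpen hU (by norm_num)
  exact ⟨fun θ hθ => (h.contDiffAt (hU.mem_nhds hθ)).differentiableAt (by norm_num),
    fun θ hθ => (h1.contDiffAt (hU.mem_nhds hθ)).differentiableAt (by norm_num),
    fun θ hθ => (h2.contDiffAt (hU.mem_nhds hθ)).differentiableAt (by norm_num)⟩

theorem ThriceDifferentiableOn.fderiv_sub_const_mul {φ ψ : E → ℝ} {U : Set E}
    (hφ : ThriceDifferentiableOn φ U) (hψ : ThriceDifferentiableOn ψ U) (a : ℝ) {θ : E}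
    (hθ : θ ∈ U) : fderiv ℝ (fun τ => φ τ - a * ψ τ) θ = fderiv ℝ φ θ - a • fderiv ℝ ψ θ :=
  ((hφ.differentiableAt θ hθ).hasFDerivAt.sub
    ((hψ.differentiableAt θ hθ).hasFDerivAt.const_mul a)).fderiv

theorem ThriceDifferentiableOn.hasFDerivAt_fderiv_sub_const_mul {φ ψ : E → ℝ} {U : Set E}
    (hU : IsOpen U) (hφ : ThriceDifferentiableOn φ U) (hψ : ThriceDifferentiableOn ψ U) (a : ℝ)
    {θ : E} (hθ : θ ∈ U) : HasFDerivAt (fderiv ℝ fun τ => φ τ - a * ψ τ)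
      (fderiv ℝ (fderiv ℝ φ) θ - a • fderiv ℝ (fderiv ℝ ψ) θ) θ := by
  have heq : (fderiv ℝ fun τ => φ τ - a * ψ τ) =ᶠ[𝓝 θ]
      fun τ => fderiv ℝ φ τ - a • fderiv ℝ ψ τ := by
    filter_upwards [hU.mem_nhds hθ] with τ hτ using hφ.fderiv_sub_const_mul hψ a hτ
  exact ((hφ.differentiableAt_fderiv θ hθ).hasFDerivAt.sub
    ((hψ.differentiableAt_fderiv θ hθ).hasFDerivAt.const_smul a)).congr_of_eventuallyEq heq

set_option maxSynthPendingDepth 5 in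
theorem ThriceDifferentiableOn.sub_const_mul {φ ψ : E → ℝ} {U : Set E} (hU : IsOpen U)
    (hφ : ThriceDifferentiableOn φ U) (hψ : ThriceDifferentiableOn ψ U) (a : ℝ) :
    ThriceDifferentiableOn (fun τ => φ τ - a * ψ τ) U where
  differentiableAt θ hθ := (hφ.differentiableAt θ hθ).sub ((hψ.differentiableAt θ hθ).const_mul a)
  differentiableAt_fderiv θ hθ :=
    (hφ.hasFDerivAt_fderiv_sub_const_mul hU hψ a hθ).differentiableAt
  differentiableAt_fderiv_fderiv θ hθ := by
    have heq : (fderiv ℝ (fderiv ℝ fun τ => φ τ - a * ψ τ)) =ᶠ[𝓝 θ]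
        fun τ => fderiv ℝ (fderiv ℝ φ) τ - a • fderiv ℝ (fderiv ℝ ψ) τ := by
      filter_upwards [hU.mem_nhds hθ] with τ hτ
        using (hφ.hasFDerivAt_fderiv_sub_const_mul hU hψ a hτ).fderiv
    refine DifferentiableAt.congr_of_eventuallyEq ?_ heq
    exact (hφ.differentiableAt_fderiv_fderiv θ hθ).fun_sub
      ((hψ.differentiableAt_fderiv_fderiv θ hθ).fun_const_smul a)

end Calculus

section DiffUnderIntegral

variable {𝒳 : Type*} [MeasurableSpace 𝒳] {μ : Measure 𝒳} {p m : ℕ} {U : Set (Param p)}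
  {F : Param p → 𝒳 → ℝ} {θ : Param p}

theorem DiffUnderIntegral.differentiableAt (h : DiffUnderIntegral μ m U F) (hm : 0 < m)
    (hθ : θ ∈ U) : DifferentiableAt ℝ (fun τ => ∫ x, F τ x ∂μ) θ :=
  differentiableAt_iteratedFDeriv_zero_iff.1 (h.1 0 hm θ hθ)

theorem DiffUnderIntegral.differentiableAt_fderiv (h : DiffUnderIntegral μ m U F) (hm : 1 < m)
    (hθ : θ ∈ U) : DifferentiableAt ℝ (fderiv ℝ fun τ => ∫ x, F τ x ∂μ) θ :=
  differentiableAt_iteratedFDeriv_zero_iff.1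
    (differentiableAt_iteratedFDeriv_fderiv (h.1 1 hm θ hθ))

theorem DiffUnderIntegral.thriceDifferentiableOn (h : DiffUnderIntegral μ 3 U F) :
    ThriceDifferentiableOn (fun τ => ∫ x, F τ x ∂μ) U where
  differentiableAt _ hθ := h.differentiableAt (by norm_num) hθ
  differentiableAt_fderiv _ hθ := h.differentiableAt_fderiv (by norm_num) hθ
  differentiableAt_fderiv_fderiv θ hθ := differentiableAt_iteratedFDeriv_zero_iff.1 <|
    differentiableAt_iteratedFDeriv_fderiv <|
      differentiableAt_iteratedFDeriv_fderiv (h.1 2 (by norm_num) θ hθ)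

theorem DiffUnderIntegral.integrable_fderiv (h : DiffUnderIntegral μ m U F) (hm : 1 ≤ m)
    (hθ : θ ∈ U) (v : Param p) : Integrable (fun x => fderiv ℝ (fun τ => F τ x) θ v) μ := by
  simpa using (h.2 1 hm θ hθ fun _ => v).1

theorem DiffUnderIntegral.fderiv_apply (h : DiffUnderIntegral μ m U F) (hm : 1 ≤ m)
    (hθ : θ ∈ U) (v : Param p) : fderiv ℝ (fun τ => ∫ x, F τ x ∂μ) θ v =
      ∫ x, fderiv ℝ (fun τ => F τ x) θ v ∂μ := by
  simpa using (h.2 1 hm θ hθ fun _ => v).2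

theorem DiffUnderIntegral.integrable_fderiv_fderiv (h : DiffUnderIntegral μ m U F) (hm : 2 ≤ m)
    (hθ : θ ∈ U) (v w : Param p) :
    Integrable (fun x => fderiv ℝ (fderiv ℝ fun τ => F τ x) θ v w) μ := by
  simpa [iteratedFDeriv_two_apply] using (h.2 2 hm θ hθ ![v, w]).1

theorem DiffUnderIntegral.fderiv_fderiv_apply (h : DiffUnderIntegral μ m U F) (hm : 2 ≤ m)
    (hθ : θ ∈ U) (v w : Param p) : fderiv ℝ (fderiv ℝ fun τ => ∫ x, F τ x ∂μ) θ v w =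
      ∫ x, fderiv ℝ (fderiv ℝ fun τ => F τ x) θ v w ∂μ := by
  simpa [iteratedFDeriv_two_apply] using (h.2 2 hm θ hθ ![v, w]).2

end DiffUnderIntegral

section RegularPoint

variable {𝒳 : Type*} {p : ℕ} {U : Set (Param p)} {f : Param p → 𝒳 → ℝ}
  {x : 𝒳} {θ : Param p}

/-- The density at `x` is a positive, three times continuously differentiable function on the open
set `U`; almost every point of the support is such, and all differentiations take place there. -/
structure IsRegularPoint (f : Param p → 𝒳 → ℝ) (U : Set (Param p)) (x : 𝒳) : Prop where
  isOpen : IsOpen U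
  pos : ∀ θ ∈ U, 0 < f θ x
  contDiffOn : ContDiffOn ℝ 3 (fun θ => f θ x) U

theorem IsRegularPoint.thriceDifferentiableOn (h : IsRegularPoint f U x) :
    ThriceDifferentiableOn (fun θ => f θ x) U := .of_contDiffOn h.isOpen h.contDiffOn

theorem IsRegularPoint.fderiv_comp (h : IsRegularPoint f U x) (hθ : θ ∈ U) {g g₁ : ℝ → ℝ}
    (hg : ∀ y, 0 < y → HasDerivAt g (g₁ y) y) (v : Param p) :
    fderiv ℝ (fun τ => g (f τ x)) θ v = g₁ (f θ x) * fderiv ℝ (fun τ => f τ x) θ v := by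
  rw [fderiv_comp_of_hasDerivAt hg (F := fun τ => f τ x)
    (h.thriceDifferentiableOn.differentiableAt θ hθ) (h.pos θ hθ)]
  rfl

theorem IsRegularPoint.fderiv_fderiv_comp (h : IsRegularPoint f U x) (hθ : θ ∈ U) {g g₁ g₂ : ℝ → ℝ}
    (hg : ∀ y, 0 < y → HasDerivAt g (g₁ y) y) (hg₁ : ∀ y, 0 < y → HasDerivAt g₁ (g₂ y) y)
    (v w : Param p) :
    fderiv ℝ (fderiv ℝ fun τ => g (f τ x)) θ v w =
      g₂ (f θ x) * fderiv ℝ (fun τ => f τ x) θ v * fderiv ℝ (fun τ => f τ x) θ w +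
        g₁ (f θ x) * fderiv ℝ (fderiv ℝ fun τ => f τ x) θ v w :=
  fderiv_fderiv_comp_apply (F := fun τ => f τ x) hg hg₁ h.isOpen hθ
    h.thriceDifferentiableOn.differentiableAt
    (h.thriceDifferentiableOn.differentiableAt_fderiv θ hθ) h.pos v w

theorem hasDerivAt_rpow (s : ℝ) (y : ℝ) (hy : 0 < y) :
    HasDerivAt (fun y : ℝ => y ^ s) (s * y ^ (s - 1)) y :=
  Real.hasDerivAt_rpow_const (Or.inl hy.ne')

theorem IsRegularPoint.score_eq (h : IsRegularPoint f U x) (hθ : θ ∈ U) (i : Fin p) :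
    score f θ x i = (f θ x)⁻¹ * fderiv ℝ (fun τ => f τ x) θ (EuclideanSpace.single i 1) :=
  h.fderiv_comp hθ (fun _ hy => Real.hasDerivAt_log hy.ne') _

theorem IsRegularPoint.fderiv_eq_score_mul (h : IsRegularPoint f U x) (hθ : θ ∈ U) (i : Fin p) :
    fderiv ℝ (fun τ => f τ x) θ (EuclideanSpace.single i 1) = score f θ x i * f θ x := by
  rw [h.score_eq hθ, mul_comm, mul_inv_cancel_left₀ (h.pos θ hθ).ne']

theorem IsRegularPoint.fderiv_rpow (h : IsRegularPoint f U x) (hθ : θ ∈ U) (s : ℝ) (i : Fin p) :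
    fderiv ℝ (fun τ => f τ x ^ s) θ (EuclideanSpace.single i 1) =
      s * (score f θ x i * f θ x ^ s) := by
  rw [h.fderiv_comp hθ (hasDerivAt_rpow s), h.fderiv_eq_score_mul hθ,
    show s * f θ x ^ (s - 1) * (score f θ x i * f θ x) =
      s * (score f θ x i * (f θ x ^ (s - 1) * f θ x)) by ring, ← Real.rpow_add_one (h.pos θ hθ).ne',
    sub_add_cancel]

theorem IsRegularPoint.thriceDifferentiableOn_rpow (h : IsRegularPoint f U x) (s : ℝ) :
    ThriceDifferentiableOn (fun θ => f θ x ^ s) U :=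
  .of_contDiffOn h.isOpen (h.contDiffOn.rpow_const_of_ne fun θ hθ => (h.pos θ hθ).ne')

theorem IsRegularPoint.thriceDifferentiableOn_neg_log (h : IsRegularPoint f U x) :
    ThriceDifferentiableOn (fun θ => -Real.log (f θ x)) U :=
  .of_contDiffOn h.isOpen (h.contDiffOn.log fun θ hθ => (h.pos θ hθ).ne').neg

theorem score_eq_zero_of_forall_eq_zero (hU : IsOpen U) (h : ∀ τ ∈ U, f τ x = 0) (hθ : θ ∈ U)
    (i : Fin p) : score f θ x i = 0 := by
  rw [score, partialDeriv, fderiv_comp_eq_zero_of_forall_eq hU h hθ]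
  rfl

end RegularPoint

section Law

variable {𝒳 : Type*} [MeasurableSpace 𝒳] {μ : Measure 𝒳} {p : ℕ} {Θ : Set (Param p)}
  {f : Param p → 𝒳 → ℝ} {θ : Param p}

theorem IsParametricModel.measurable_apply (hf : IsParametricModel μ Θ f) (θ : Param p) :
    Measurable (f θ) := hf.measurable.of_uncurry_left

theorem IsParametricModel.integrable (hf : IsParametricModel μ Θ f) (hθ : θ ∈ Θ) :
    Integrable (f θ) μ :=
  .of_integral_ne_zero (by rw [hf.integral_eq_one θ hθ]; exact one_ne_zero)

theorem IsParametricModel.ae_modelLaw_iff (hf : IsParametricModel μ Θ f) {q : 𝒳 → Prop} :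
    (∀ᵐ x ∂modelLaw μ f θ, q x) ↔ ∀ᵐ x ∂μ, 0 < f θ x → q x := by
  rw [modelLaw, ae_withDensity_iff (hf.measurable_apply θ).ennreal_ofReal]
  simp

theorem IsParametricModel.integrable_modelLaw_iff (hf : IsParametricModel μ Θ f) (hθ : θ ∈ Θ)
    {h : 𝒳 → ℝ} : Integrable h (modelLaw μ f θ) ↔ Integrable (fun x => h x * f θ x) μ := by
  rw [modelLaw, integrable_withDensity_iff (hf.measurable_apply θ).ennreal_ofReal (by simp)]
  simp only [ENNReal.toReal_ofReal (hf.nonneg θ hθ _)]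

theorem IsParametricModel.integral_modelLaw (hf : IsParametricModel μ Θ f) (hθ : θ ∈ Θ)
    (h : 𝒳 → ℝ) : ∫ x, h x ∂modelLaw μ f θ = ∫ x, h x * f θ x ∂μ := by
  rw [modelLaw, integral_withDensity_eq_integral_toReal_smul
    (hf.measurable_apply θ).ennreal_ofReal (by simp)]
  simp only [ENNReal.toReal_ofReal (hf.nonneg θ hθ _), smul_eq_mul, mul_comm]

theorem IsParametricModel.isProbabilityMeasure (hf : IsParametricModel μ Θ f) (hθ : θ ∈ Θ) :
    IsProbabilityMeasure (modelLaw μ f θ) := by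
  constructor
  rw [modelLaw, withDensity_apply _ .univ, setLIntegral_univ,
    ← ofReal_integral_eq_lintegral_ofReal (hf.integrable hθ) (ae_of_all _ (hf.nonneg θ hθ)),
    hf.integral_eq_one θ hθ, ENNReal.ofReal_one]

end Law

section Matrices

variable {l m n p : ℕ}

theorem clm_ext_single {E : Type*} [NormedAddCommGroup E] [NormedSpace ℝ E]
    {S T : Param p →L[ℝ] E}
    (h : ∀ i, S (EuclideanSpace.single i 1) = T (EuclideanSpace.single i 1)) : S = T :=
  ContinuousLinearMap.coe_injective <| (EuclideanSpace.basisFun (Fin p) ℝ).toBasis.ext fun i => by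
    simpa using h i

theorem bilinear_eq_sum_single (T : Param p →L[ℝ] Param p →L[ℝ] ℝ) :
    T = ∑ i, ∑ j, T (EuclideanSpace.single i 1) (EuclideanSpace.single j 1) •
      (EuclideanSpace.proj i : Param p →L[ℝ] ℝ).smulRight
        (EuclideanSpace.proj j : Param p →L[ℝ] ℝ) := by
  refine clm_ext_single fun i => clm_ext_single fun j => ?_
  simp [_root_.sum_apply]

set_option maxSynthPendingDepth 5 in
theorem tendsto_bilinear_of_tendsto_single {ι : Type*} {a : Filter ι}
    {T : ι → Param p →L[ℝ] Param p →L[ℝ] ℝ} {T₀ : Param p →L[ℝ] Param p →L[ℝ] ℝ}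
    (h : ∀ i j, Tendsto (fun q => T q (EuclideanSpace.single i 1) (EuclideanSpace.single j 1)) a
      (𝓝 (T₀ (EuclideanSpace.single i 1) (EuclideanSpace.single j 1)))) :
    Tendsto T a (𝓝 T₀) := by
  rw [bilinear_eq_sum_single T₀, funext fun q => bilinear_eq_sum_single (T q)]
  exact tendsto_finsetSum _ fun i _ => tendsto_finsetSum _ fun j _ => (h i j).smul_const _

/-- The continuous linear map of a matrix, between the Euclidean spaces. -/
noncomputable def matMap (M : Matrix (Fin m) (Fin n) ℝ) : Param n →L[ℝ] Param m :=
  LinearMap.toContinuousLinearMap (Matrix.toLpLin 2 2 M)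

theorem matMap_apply (M : Matrix (Fin m) (Fin n) ℝ) (v : Param n) :
    matMap M v = WithLp.toLp 2 (M *ᵥ v.ofLp) := rfl

theorem matMap_mul_apply (M : Matrix (Fin l) (Fin m) ℝ) (N : Matrix (Fin m) (Fin n) ℝ)
    (v : Param n) : matMap (M * N) v = matMap M (matMap N v) := by
  simp only [matMap_apply, Matrix.mulVec_mulVec]

theorem matMap_one_apply (v : Param n) : matMap 1 v = v := by
  simp only [matMap_apply, Matrix.one_mulVec]

theorem matMap_sub_apply (M N : Matrix (Fin m) (Fin n) ℝ) (v : Param n) :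
    matMap (M - N) v = matMap M v - matMap N v := by
  simp only [matMap_apply, Matrix.sub_mulVec, WithLp.toLp_sub]

theorem continuous_matMap :
    Continuous (matMap : Matrix (Fin m) (Fin n) ℝ → Param n →L[ℝ] Param m) :=
  LinearMap.continuous_of_finiteDimensional
    ((Matrix.toLpLin 2 2).trans LinearMap.toContinuousLinearMap :
      Matrix (Fin m) (Fin n) ℝ ≃ₗ[ℝ] Param n →L[ℝ] Param m).toLinearMap

theorem inner_matMap (M : Matrix (Fin m) (Fin n) ℝ) (v : Param n) (w : Param m) :
    inner ℝ (matMap M v) w = w.ofLp ⬝ᵥ M *ᵥ v.ofLp := by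
  rw [EuclideanSpace.inner_eq_star_dotProduct, matMap_apply, star_trivial]

theorem inner_matMap_transpose (M : Matrix (Fin m) (Fin n) ℝ) (v : Param n) (w : Param m) :
    inner ℝ (matMap Mᵀ w) v = inner ℝ (matMap M v) w := by
  rw [inner_matMap, inner_matMap, Matrix.dotProduct_mulVec w, ← Matrix.mulVec_transpose,
    dotProduct_comm]

/-- The bilinear form of a square matrix, in the form taken by the second derivative. -/
noncomputable def matForm (M : Matrix (Fin p) (Fin p) ℝ) : Param p →L[ℝ] Param p →L[ℝ] ℝ :=
  (innerSL ℝ).comp (matMap M)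

theorem matForm_apply (M : Matrix (Fin p) (Fin p) ℝ) (v w : Param p) :
    matForm M v w = inner ℝ (matMap M v) w := rfl

theorem matForm_comm {M : Matrix (Fin p) (Fin p) ℝ} (hM : M.IsSymm) (v w : Param p) :
    matForm M v w = matForm M w v := by
  rw [matForm_apply, matForm_apply, ← inner_matMap_transpose, hM.eq]

theorem matForm_single (M : Matrix (Fin p) (Fin p) ℝ) (i j : Fin p) :
    matForm M (EuclideanSpace.single i 1) (EuclideanSpace.single j 1) = M j i := by
  rw [matForm_apply, inner_matMap]
  simp

end Matrices

section SecondMoment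

variable {𝒳 ι : Type*} [MeasurableSpace 𝒳] [Fintype ι] {ν : Measure 𝒳} [IsProbabilityMeasure ν]
  {w : 𝒳 → EuclideanSpace ℝ ι}

theorem secondMoment_sub_integral (hw : MemLp w 2 ν) :
    secondMoment ν (fun x => w x - ∫ y, w y ∂ν) =
      secondMoment ν w - vecMulVec (∫ y, w y ∂ν).ofLp (∫ y, w y ∂ν).ofLp := by
  have hcoord : ∀ i, (∫ y, w y ∂ν) i = ∫ y, w y i ∂ν :=
    eval_integral_piLp fun i => (hw.eval_piLp i).integrable one_le_two
  ext i j
  simpa [covariance, secondMoment, vecMulVec_apply, hcoord]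
    using covariance_eq_sub (hw.eval_piLp i) (hw.eval_piLp j)

end SecondMoment

section Objective

variable {𝒳 : Type*} [MeasurableSpace 𝒳] {μ : Measure 𝒳} {p : ℕ} {f : Param p → 𝒳 → ℝ} {β : ℝ}

theorem objective_of_ne_zero (hβ : β ≠ 0) (x : 𝒳) : (fun θ => objective μ f β θ x) =
    fun θ => ∫ y, f θ y ^ (1 + β) ∂μ - (1 + 1 / β) * f θ x ^ β :=
  funext fun _ => if_neg hβ

theorem objective_zero (x : 𝒳) :
    (fun θ => objective μ f 0 θ x) = fun θ => -Real.log (f θ x) :=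
  funext fun _ => if_pos rfl

/-- The score weighted by the power `β` of the density: its mean under the model is `ξ_β`. -/
noncomputable def weightedScore (f : Param p → 𝒳 → ℝ) (β : ℝ) (θ : Param p) (x : 𝒳) : Param p :=
  WithLp.toLp 2 fun i => score f θ x i * f θ x ^ β

/-- The estimating function: the estimating equation says that its sample mean vanishes. -/
noncomputable def estimatingFun (μ : Measure 𝒳) (f : Param p → 𝒳 → ℝ) (β : ℝ) (θ : Param p)
    (x : 𝒳) : Param p :=
  weightedScore f β θ x - WithLp.toLp 2 (xiVec μ f β θ)

end Objective

section Score

variable {𝒳 : Type*} [MeasurableSpace 𝒳] {μ : Measure 𝒳} {p : ℕ} {Θ U : Set (Param p)}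
  {f : Param p → 𝒳 → ℝ} {β : ℝ} {θ₀ θ : Param p} {x : 𝒳}

theorem IsParametricModel.fderiv_integral_rpow_one_add_zero (hf : IsParametricModel μ Θ f)
    (hθ : θ ∈ Θ) : fderiv ℝ (fun τ => ∫ x, f τ x ^ (1 + 0 : ℝ) ∂μ) θ = 0 :=
  fderiv_comp_eq_zero_of_forall_eq hf.isOpen (c := 1)
    (fun τ hτ => by simpa using hf.integral_eq_one τ hτ) hθ id

theorem IsParametricModel.fderiv_fderiv_integral_rpow_one_add_zero
    (hf : IsParametricModel μ Θ f) (hθ : θ ∈ Θ) :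
    fderiv ℝ (fderiv ℝ fun τ => ∫ x, f τ x ^ (1 + 0 : ℝ) ∂μ) θ = 0 :=
  fderiv_fderiv_comp_eq_zero_of_forall_eq hf.isOpen (c := 1)
    (fun τ hτ => by simpa using hf.integral_eq_one τ hτ) hθ id

theorem LehmannBasu.ae_isRegularPoint_or (hLB : LehmannBasu μ Θ f β θ₀ U)
    (hf : IsParametricModel μ Θ f) :
    ∀ᵐ x ∂μ, IsRegularPoint f U x ∨ ∀ θ ∈ U, f θ x = 0 := by
  filter_upwards [hLB.smooth] with x hx
  have hsupport : ∀ θ ∈ U, 0 < f θ x ↔ 0 < f θ₀ x := fun θ hθ =>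
    Set.ext_iff.1 (hf.common_support θ (hLB.subset hθ) θ₀ (hLB.subset hLB.mem)) x
  by_cases hpos : 0 < f θ₀ x
  · exact Or.inl ⟨hLB.isOpen, fun θ hθ => (hsupport θ hθ).2 hpos, hx⟩
  · exact Or.inr fun θ hθ =>
      (not_lt.1 (mt (hsupport θ hθ).1 hpos)).antisymm (hf.nonneg θ (hLB.subset hθ) x)

theorem LehmannBasu.ae_isRegularPoint (hLB : LehmannBasu μ Θ f β θ₀ U)
    (hf : IsParametricModel μ Θ f) : ∀ᵐ x ∂modelLaw μ f θ₀, IsRegularPoint f U x := by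
  rw [hf.ae_modelLaw_iff]
  filter_upwards [hLB.ae_isRegularPoint_or hf] with x hx hpos
  exact hx.resolve_right fun h => hpos.ne' (h θ₀ hLB.mem)

theorem LehmannBasu.fderiv_rpow_ae_eq (hLB : LehmannBasu μ Θ f β θ₀ U)
    (hf : IsParametricModel μ Θ f) (hθ : θ ∈ U) (i : Fin p) :
    (fun x => fderiv ℝ (fun τ => f τ x ^ (1 + β)) θ (EuclideanSpace.single i 1)) =ᵐ[μ]
      fun x => (1 + β) * (score f θ x i * f θ x ^ (1 + β)) := by
  filter_upwards [hLB.ae_isRegularPoint_or hf] with x hx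
  rcases hx with hx | hx
  · exact hx.fderiv_rpow hθ _ i
  · rw [fderiv_comp_eq_zero_of_forall_eq hLB.isOpen hx hθ (fun y => y ^ (1 + β)),
      score_eq_zero_of_forall_eq_zero hLB.isOpen hx hθ]
    simp

theorem LehmannBasu.integrable_score_mul_rpow (hLB : LehmannBasu μ Θ f β θ₀ U)
    (hf : IsParametricModel μ Θ f) (hβ : 0 ≤ β) (hθ : θ ∈ U) (i : Fin p) :
    Integrable (fun x => score f θ x i * f θ x ^ (1 + β)) μ := by
  have h := (hLB.diff_power.integrable_fderiv (by norm_num) hθ (EuclideanSpace.single i 1)).congr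
    (hLB.fderiv_rpow_ae_eq hf hθ i)
  have hc : 1 + β ≠ 0 := by positivity
  simpa [hc] using h.const_mul (1 + β)⁻¹

theorem LehmannBasu.fderiv_integral_rpow (hLB : LehmannBasu μ Θ f β θ₀ U)
    (hf : IsParametricModel μ Θ f) (hθ : θ ∈ U) (i : Fin p) :
    fderiv ℝ (fun τ => ∫ x, f τ x ^ (1 + β) ∂μ) θ (EuclideanSpace.single i 1) =
      (1 + β) * xiVec μ f β θ i := by
  rw [hLB.diff_power.fderiv_apply (by norm_num) hθ,
    integral_congr_ae (hLB.fderiv_rpow_ae_eq hf hθ i), integral_const_mul]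
  rfl

theorem LehmannBasu.xiVec_zero (hLB : LehmannBasu μ Θ f 0 θ₀ U)
    (hf : IsParametricModel μ Θ f) (hθ : θ ∈ U) (i : Fin p) : xiVec μ f 0 θ i = 0 := by
  have h := hLB.fderiv_integral_rpow hf hθ i
  rw [hf.fderiv_integral_rpow_one_add_zero (hLB.subset hθ)] at h
  simpa using h.symm

theorem IsRegularPoint.thriceDifferentiableOn_objective (h : IsRegularPoint f U x)
    (hLB : LehmannBasu μ Θ f β θ₀ U) :
    ThriceDifferentiableOn (fun θ => objective μ f β θ x) U := by
  rcases eq_or_ne β 0 with rfl | hβ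
  · rw [objective_zero]
    exact h.thriceDifferentiableOn_neg_log
  · rw [objective_of_ne_zero hβ]
    exact hLB.diff_power.thriceDifferentiableOn.sub_const_mul h.isOpen
      (h.thriceDifferentiableOn_rpow β) _

theorem IsRegularPoint.fderiv_objective (h : IsRegularPoint f U x)
    (hLB : LehmannBasu μ Θ f β θ₀ U) (hf : IsParametricModel μ Θ f) (hθ : θ ∈ U) :
    fderiv ℝ (fun θ => objective μ f β θ x) θ =
      -(1 + β) • innerSL ℝ (estimatingFun μ f β θ x) := by
  refine clm_ext_single fun i => ?_
  simp only [estimatingFun, weightedScore, _root_.smul_apply, innerSL_apply_apply, smul_eq_mul,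
    EuclideanSpace.inner_single_right, one_mul, conj_trivial, PiLp.sub_apply]
  rcases eq_or_ne β 0 with rfl | h0
  · rw [objective_zero, hLB.xiVec_zero hf hθ, fderiv_fun_neg]
    simp [score, partialDeriv]
  · rw [objective_of_ne_zero h0, hLB.diff_power.thriceDifferentiableOn.fderiv_sub_const_mul
      (h.thriceDifferentiableOn_rpow β) _ hθ, _root_.sub_apply, _root_.smul_apply, smul_eq_mul,
      hLB.fderiv_integral_rpow hf hθ, h.fderiv_rpow hθ]
    field_simp
    ring

theorem LehmannBasu.integrable_weightedScore_apply (hLB : LehmannBasu μ Θ f β θ₀ U)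
    (hf : IsParametricModel μ Θ f) (hβ : 0 ≤ β) (i : Fin p) :
    Integrable (fun x => weightedScore f β θ₀ x i) (modelLaw μ f θ₀) := by
  have hθ := hLB.subset hLB.mem
  rw [hf.integrable_modelLaw_iff hθ]
  refine (hLB.integrable_score_mul_rpow hf hβ hLB.mem i).congr (ae_of_all _ fun x => ?_)
  simp only [weightedScore]
  rw [add_comm, Real.rpow_add_one' (hf.nonneg _ hθ x) (by positivity), mul_assoc]

theorem mul_rpow_mul_mul_rpow_mul {y : ℝ} (hy : 0 ≤ y) (hβ : 0 ≤ β) (a b : ℝ) :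
    a * y ^ β * (b * y ^ β) * y = a * b * y ^ (1 + 2 * β) := by
  rw [add_comm, Real.rpow_add_one' hy (by positivity), two_mul,
    Real.rpow_add_of_nonneg hy hβ hβ]
  ring

theorem LehmannBasu.memLp_weightedScore (hLB : LehmannBasu μ Θ f β θ₀ U)
    (hf : IsParametricModel μ Θ f) (hβ : 0 ≤ β) :
    MemLp (weightedScore f β θ₀) 2 (modelLaw μ f θ₀) := by
  have hθ := hLB.subset hLB.mem
  refine MemLp.of_eval_piLp fun i => ?_
  rw [memLp_two_iff_integrable_sq (hLB.integrable_weightedScore_apply hf hβ i).1,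
    hf.integrable_modelLaw_iff hθ]
  refine (hLB.finite_kMat i).congr (ae_of_all _ fun x => ?_)
  simp only [weightedScore, pow_two]
  rw [mul_rpow_mul_mul_rpow_mul (hf.nonneg _ hθ x) hβ]

theorem LehmannBasu.integral_weightedScore (hLB : LehmannBasu μ Θ f β θ₀ U)
    (hf : IsParametricModel μ Θ f) (hβ : 0 ≤ β) :
    ∫ x, weightedScore f β θ₀ x ∂modelLaw μ f θ₀ = WithLp.toLp 2 (xiVec μ f β θ₀) := by
  have hθ := hLB.subset hLB.mem
  ext i
  rw [eval_integral_piLp (hLB.integrable_weightedScore_apply hf hβ), hf.integral_modelLaw hθ]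
  refine integral_congr_ae (ae_of_all _ fun x => ?_)
  simp only [weightedScore]
  rw [add_comm, Real.rpow_add_one' (hf.nonneg _ hθ x) (by positivity), mul_assoc]

theorem IsParametricModel.secondMoment_weightedScore (hf : IsParametricModel μ Θ f)
    (hβ : 0 ≤ β) (hθ : θ ∈ Θ) (i j : Fin p) :
    secondMoment (modelLaw μ f θ) (weightedScore f β θ) i j =
      ∫ x, score f θ x i * score f θ x j * f θ x ^ (1 + 2 * β) ∂μ := by
  simp only [secondMoment, Matrix.of_apply, weightedScore]
  rw [hf.integral_modelLaw hθ]
  simp only [mul_rpow_mul_mul_rpow_mul (hf.nonneg _ hθ _) hβ]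

theorem LehmannBasu.memLp_estimatingFun (hLB : LehmannBasu μ Θ f β θ₀ U)
    (hf : IsParametricModel μ Θ f) (hβ : 0 ≤ β) :
    MemLp (estimatingFun μ f β θ₀) 2 (modelLaw μ f θ₀) := by
  have hprob := hf.isProbabilityMeasure (hLB.subset hLB.mem)
  exact (hLB.memLp_weightedScore hf hβ).sub (memLp_const _)

theorem LehmannBasu.integral_estimatingFun (hLB : LehmannBasu μ Θ f β θ₀ U)
    (hf : IsParametricModel μ Θ f) (hβ : 0 ≤ β) :
    ∫ x, estimatingFun μ f β θ₀ x ∂modelLaw μ f θ₀ = 0 := by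
  have hprob := hf.isProbabilityMeasure (hLB.subset hLB.mem)
  simp only [estimatingFun]
  rw [integral_sub ((hLB.memLp_weightedScore hf hβ).integrable one_le_two) (integrable_const _),
    hLB.integral_weightedScore hf hβ, integral_const, probReal_univ, one_smul, sub_self]

theorem LehmannBasu.secondMoment_estimatingFun (hLB : LehmannBasu μ Θ f β θ₀ U)
    (hf : IsParametricModel μ Θ f) (hβ : 0 ≤ β) :
    secondMoment (modelLaw μ f θ₀) (estimatingFun μ f β θ₀) = kMat μ f β θ₀ := by
  have hθ := hLB.subset hLB.mem
  have hprob := hf.isProbabilityMeasure hθ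
  have hcov := secondMoment_sub_integral (hLB.memLp_weightedScore hf hβ)
  rw [hLB.integral_weightedScore hf hβ] at hcov
  ext i j
  refine (congrFun₂ hcov i j).trans ?_
  rw [Matrix.sub_apply, hf.secondMoment_weightedScore hβ hθ]
  rfl

theorem LehmannBasu.posSemidef_kMat (hLB : LehmannBasu μ Θ f β θ₀ U)
    (hf : IsParametricModel μ Θ f) (hβ : 0 ≤ β) : (kMat μ f β θ₀).PosSemidef :=
  hLB.secondMoment_estimatingFun hf hβ ▸ posSemidef_secondMoment (hLB.memLp_estimatingFun hf hβ)

end Score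

section Hessian

variable {𝒳 : Type*} {p : ℕ} {U : Set (Param p)} {f : Param p → 𝒳 → ℝ} {β : ℝ} {θ : Param p}
  {x : 𝒳}

theorem IsRegularPoint.fderiv_fderiv_rpow_single (h : IsRegularPoint f U x) (hθ : θ ∈ U) (s : ℝ)
    (i j : Fin p) :
    fderiv ℝ (fderiv ℝ fun τ => f τ x ^ s) θ (EuclideanSpace.single i 1)
        (EuclideanSpace.single j 1) =
      s * ((s - 1) * (score f θ x i * score f θ x j * f θ x ^ s) + f θ x ^ (s - 1) *
        fderiv ℝ (fderiv ℝ fun τ => f τ x) θ (EuclideanSpace.single i 1)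
          (EuclideanSpace.single j 1)) := by
  have hne := (h.pos θ hθ).ne'
  have hpow : f θ x ^ s = f θ x ^ (s - 1 - 1) * f θ x * f θ x := by
    rw [← Real.rpow_add_one hne, ← Real.rpow_add_one hne, sub_add_cancel, sub_add_cancel]
  rw [h.fderiv_fderiv_comp hθ (hasDerivAt_rpow s)
    fun y hy => (hasDerivAt_rpow (s - 1) y hy).const_mul s,
    h.fderiv_eq_score_mul hθ, h.fderiv_eq_score_mul hθ, hpow]
  ring

theorem IsRegularPoint.const_mul_fderiv_fderiv_rpow_mul (h : IsRegularPoint f U x) (hθ : θ ∈ U)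
    (hβ : β ≠ 0) (i j : Fin p) :
    (1 + 1 / β) * (f θ x * fderiv ℝ (fderiv ℝ fun τ => f τ x ^ β) θ (EuclideanSpace.single i 1)
        (EuclideanSpace.single j 1)) =
      fderiv ℝ (fderiv ℝ fun τ => f τ x ^ (1 + β)) θ (EuclideanSpace.single i 1)
        (EuclideanSpace.single j 1) -
      (1 + β) * (score f θ x i * score f θ x j * f θ x ^ (1 + β)) := by
  have hne := (h.pos θ hθ).ne'
  rw [h.fderiv_fderiv_rpow_single hθ, h.fderiv_fderiv_rpow_single hθ, add_sub_cancel_left,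
    add_comm 1 β, Real.rpow_add_one hne, show f θ x ^ β = f θ x ^ (β - 1) * f θ x by
      rw [← Real.rpow_add_one hne, sub_add_cancel]]
  field_simp
  ring

theorem IsRegularPoint.fderiv_fderiv_neg_log_mul (h : IsRegularPoint f U x) (hθ : θ ∈ U)
    (i j : Fin p) :
    fderiv ℝ (fderiv ℝ fun τ => -Real.log (f τ x)) θ (EuclideanSpace.single i 1)
        (EuclideanSpace.single j 1) * f θ x =
      score f θ x i * score f θ x j * f θ x -
        fderiv ℝ (fderiv ℝ fun τ => f τ x) θ (EuclideanSpace.single i 1)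
          (EuclideanSpace.single j 1) := by
  have hne := (h.pos θ hθ).ne'
  rw [h.fderiv_fderiv_comp hθ (g := fun y => -Real.log y) (g₁ := fun y => -y⁻¹)
    (g₂ := fun y => (y ^ 2)⁻¹) (fun y hy => (Real.hasDerivAt_log hy.ne').neg)
    (fun y hy => by simpa using (hasDerivAt_inv hy.ne').fun_neg),
    h.fderiv_eq_score_mul hθ, h.fderiv_eq_score_mul hθ]
  field_simp
  ring

end Hessian

section MeanHessian

variable {𝒳 : Type*} [MeasurableSpace 𝒳] {μ : Measure 𝒳} {p : ℕ} {Θ U : Set (Param p)}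
  {f : Param p → 𝒳 → ℝ} {β : ℝ} {θ₀ θ : Param p}

set_option maxSynthPendingDepth 5 in
theorem fderiv_fderiv_mul_const (F : Param p → ℝ) (a : ℝ) (θ : Param p) :
    fderiv ℝ (fderiv ℝ fun τ => F τ * a) θ = a • fderiv ℝ (fderiv ℝ F) θ := by
  have hfun : (fun τ => F τ * a) = a • F := funext fun τ => mul_comm _ _
  have hderiv : fderiv ℝ (a • F) = a • fderiv ℝ F := by
    ext1 τ
    rw [fderiv_const_smul_field, Pi.smul_apply]
  rw [hfun, hderiv, fderiv_const_smul_field]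
  rfl

/-- The Hessian matrix at `θ` of the objective function of one observation. -/
noncomputable def objectiveHess (μ : Measure 𝒳) (f : Param p → 𝒳 → ℝ) (β : ℝ) (θ : Param p)
    (i j : Fin p) (x : 𝒳) : ℝ :=
  fderiv ℝ (fderiv ℝ fun τ => objective μ f β τ x) θ (EuclideanSpace.single i 1)
    (EuclideanSpace.single j 1)

theorem LehmannBasu.objectiveHess_mul_ae_eq (hLB : LehmannBasu μ Θ f β θ₀ U)
    (hf : IsParametricModel μ Θ f) (hβ : 0 ≤ β) (hθ : θ ∈ U) (i j : Fin p) :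
    (fun x => objectiveHess μ f β θ i j x * f θ x) =ᵐ[μ] fun x =>
      (1 + β) * (score f θ x i * score f θ x j * f θ x ^ (1 + β)) +
        (fderiv ℝ (fderiv ℝ fun τ => ∫ y, f τ y ^ (1 + β) ∂μ) θ (EuclideanSpace.single i 1)
            (EuclideanSpace.single j 1) * f θ x -
          fderiv ℝ (fderiv ℝ fun τ => f τ x ^ (1 + β)) θ (EuclideanSpace.single i 1)
            (EuclideanSpace.single j 1)) := by
  filter_upwards [hLB.ae_isRegularPoint_or hf] with x hx
  rcases hx with hx | hx
  · rcases eq_or_ne β 0 with rfl | h0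
    · rw [objectiveHess, objective_zero, hx.fderiv_fderiv_neg_log_mul hθ,
        hf.fderiv_fderiv_integral_rpow_one_add_zero (hLB.subset hθ)]
      simp [sub_eq_add_neg]
    · rw [objectiveHess, objective_of_ne_zero h0,
        (hLB.diff_power.thriceDifferentiableOn.hasFDerivAt_fderiv_sub_const_mul hLB.isOpen
          (hx.thriceDifferentiableOn_rpow β) _ hθ).fderiv]
      simp only [_root_.sub_apply, _root_.smul_apply, smul_eq_mul]
      linear_combination -hx.const_mul_fderiv_fderiv_rpow_mul hθ h0 i j
  · have hc : 1 + β ≠ 0 := by positivity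
    rw [fderiv_fderiv_comp_eq_zero_of_forall_eq hLB.isOpen hx hθ fun y => y ^ (1 + β)]
    simp [hx θ hθ, Real.zero_rpow hc]

theorem LehmannBasu.integrable_score_mul_score (hLB : LehmannBasu μ Θ f β θ₀ U)
    (hf : IsParametricModel μ Θ f) (hβ : 0 ≤ β) (i j : Fin p) :
    Integrable (fun x => score f θ₀ x i * score f θ₀ x j * f θ₀ x ^ (1 + β)) μ := by
  rcases eq_or_ne β 0 with rfl | h0
  · have hw := hLB.memLp_weightedScore hf le_rfl
    have hprod := (hw.eval_piLp i).integrable_mul (hw.eval_piLp j)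
    rw [hf.integrable_modelLaw_iff (hLB.subset hLB.mem)] at hprod
    simpa [weightedScore] using hprod
  · have hcross : Integrable _ μ := (hLB.diff_cross.integrable_fderiv_fderiv (by norm_num)
      hLB.mem (EuclideanSpace.single i 1) (EuclideanSpace.single j 1)).const_mul (1 + 1 / β)
    have hpower : Integrable _ μ := hLB.diff_power.integrable_fderiv_fderiv (by norm_num) hLB.mem
      (EuclideanSpace.single i 1) (EuclideanSpace.single j 1)
    refine ((hpower.sub hcross).const_mul (1 + β)⁻¹).congr ?_
    filter_upwards [hLB.ae_isRegularPoint_or hf] with x hx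
    have hc : 1 + β ≠ 0 := by positivity
    simp only [Pi.sub_apply, fderiv_fderiv_mul_const, _root_.smul_apply, smul_eq_mul]
    rcases hx with hx | hx
    · rw [hx.const_mul_fderiv_fderiv_rpow_mul hLB.mem h0, sub_sub_cancel, inv_mul_cancel_left₀ hc]
    · rw [fderiv_fderiv_comp_eq_zero_of_forall_eq hLB.isOpen hx hLB.mem fun y => y ^ (1 + β)]
      simp [hx θ₀ hLB.mem, Real.zero_rpow hc]

theorem LehmannBasu.integrable_and_integral_objectiveHess (hLB : LehmannBasu μ Θ f β θ₀ U)
    (hf : IsParametricModel μ Θ f) (hβ : 0 ≤ β) (i j : Fin p) :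
    Integrable (objectiveHess μ f β θ₀ i j) (modelLaw μ f θ₀) ∧
    ∫ x, objectiveHess μ f β θ₀ i j x ∂modelLaw μ f θ₀ = (1 + β) * jMat μ f β θ₀ i j := by
  have hθ := hLB.subset hLB.mem
  have hhess := hLB.objectiveHess_mul_ae_eq hf hβ hLB.mem i j
  have hscore : Integrable _ μ := (hLB.integrable_score_mul_score hf hβ i j).const_mul (1 + β)
  have hdensity : Integrable _ μ := (hf.integrable hθ).const_mul
    (fderiv ℝ (fderiv ℝ fun τ => ∫ y, f τ y ^ (1 + β) ∂μ) θ₀ (EuclideanSpace.single i 1)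
      (EuclideanSpace.single j 1))
  have hpower : Integrable _ μ := hLB.diff_power.integrable_fderiv_fderiv (by norm_num) hLB.mem
    (EuclideanSpace.single i 1) (EuclideanSpace.single j 1)
  rw [hf.integrable_modelLaw_iff hθ, hf.integral_modelLaw hθ]
  refine ⟨(hscore.add (hdensity.sub' hpower)).congr hhess.symm, ?_⟩
  rw [integral_congr_ae hhess, integral_add hscore (hdensity.sub' hpower),
    integral_sub hdensity hpower, integral_const_mul, integral_const_mul, hf.integral_eq_one _ hθ,
    ← hLB.diff_power.fderiv_fderiv_apply (by norm_num) hLB.mem, mul_one, sub_self, add_zero]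
  rfl

end MeanHessian

section Divergence

variable {𝒳 : Type*} [MeasurableSpace 𝒳] {μ : Measure 𝒳} {p : ℕ} {Θ U : Set (Param p)}
  {f : Param p → 𝒳 → ℝ} {β γ : ℝ} {θ₀ τ : Param p} {x : 𝒳}

/-- The derivative at `h` of the divergence integrand `dpdIntegrand γ h y` in its first
argument. -/
noncomputable def dpdIntegrandDeriv (γ y h : ℝ) : ℝ :=
  if γ = 0 then Real.log (h / y) + 1 else (1 + 1 / γ) * (h ^ γ - y ^ γ)

theorem hasDerivAt_log_div {y h : ℝ} (hy : 0 < y) (hh : 0 < h) :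
    HasDerivAt (fun h : ℝ => Real.log (h / y)) h⁻¹ h := by
  convert! ((hasDerivAt_id h).div_const y).log (div_pos hh hy).ne' using 1
  simp only [id_eq]
  field_simp

theorem hasDerivAt_dpdIntegrand {y : ℝ} (hy : 0 < y) (h : ℝ) (hh : 0 < h) :
    HasDerivAt (fun h => dpdIntegrand γ h y) (dpdIntegrandDeriv γ y h) h := by
  rcases eq_or_ne γ 0 with h0 | h0
  · simp only [dpdIntegrand, dpdIntegrandDeriv, if_pos h0]
    convert! (hasDerivAt_id h).mul (hasDerivAt_log_div hy hh) using 1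
    simp only [id_eq, one_mul, mul_inv_cancel₀ hh.ne']
  · simp only [dpdIntegrand, dpdIntegrandDeriv, if_neg h0]
    convert! (((hasDerivAt_id h).const_mul ((1 + 1 / γ) * y ^ γ)).const_sub (y ^ (1 + γ))).add
      ((hasDerivAt_rpow (1 + γ) h hh).const_mul (1 / γ)) using 1
    rw [add_sub_cancel_left]
    field_simp
    ring

theorem hasDerivAt_dpdIntegrandDeriv {y : ℝ} (hy : 0 < y) (h : ℝ) (hh : 0 < h) :
    HasDerivAt (dpdIntegrandDeriv γ y) ((1 + γ) * h ^ (γ - 1)) h := by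
  unfold dpdIntegrandDeriv
  rcases eq_or_ne γ 0 with rfl | h0
  · simpa only [if_true, add_zero, one_mul, zero_sub, Real.rpow_neg_one] using
      (hasDerivAt_log_div hy hh).add_const 1
  · simp only [if_neg h0]
    convert! ((hasDerivAt_rpow γ h hh).sub_const (y ^ γ)).const_mul (1 + 1 / γ) using 1
    field_simp
    ring

theorem dpdIntegrandDeriv_self {y : ℝ} (hy : 0 < y) :
    dpdIntegrandDeriv γ y y = if γ = 0 then 1 else 0 := by
  simp [dpdIntegrandDeriv, hy.ne']

theorem dpdIntegrand_self (hγ : 0 ≤ γ) {y : ℝ} (hy : 0 ≤ y) : dpdIntegrand γ y y = 0 := by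
  rcases eq_or_ne γ 0 with h0 | h0
  · rcases eq_or_ne y 0 with hy0 | hy0 <;> simp [dpdIntegrand, h0, hy0]
  · rw [dpdIntegrand, if_neg h0, mul_assoc, ← Real.rpow_add_one' hy (by positivity), add_comm γ]
    ring

theorem dpd_self {h : 𝒳 → ℝ} (hγ : 0 ≤ γ) (hh : ∀ x, 0 ≤ h x) : dpd μ γ h h = 0 := by
  simp [dpd, dpdIntegrand_self hγ (hh _)]

theorem DivergenceRegular.integral_fderiv_eq_zero (hreg : DivergenceRegular μ f 0 U)
    (hf : IsParametricModel μ Θ f) (hU : U ⊆ Θ) (hτ : τ ∈ U) (v : Param p) :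
    ∫ x, fderiv ℝ (fun θ => f θ x) τ v ∂μ = 0 := by
  have h := hreg.diff_power.fderiv_apply one_le_two hτ v
  rw [hf.fderiv_integral_rpow_one_add_zero (hU hτ)] at h
  simpa only [add_zero, Real.rpow_one, _root_.zero_apply] using h.symm

theorem DivergenceRegular.integrable_fderiv_fderiv (hreg : DivergenceRegular μ f 0 U)
    (hτ : τ ∈ U) (v w : Param p) :
    Integrable (fun x => fderiv ℝ (fderiv ℝ fun θ => f θ x) τ v w) μ := by
  simpa only [add_zero, Real.rpow_one] using hreg.diff_power.integrable_fderiv_fderiv le_rfl hτ v w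

theorem DivergenceRegular.integral_fderiv_fderiv_eq_zero (hreg : DivergenceRegular μ f 0 U)
    (hf : IsParametricModel μ Θ f) (hU : U ⊆ Θ) (hτ : τ ∈ U) (v w : Param p) :
    ∫ x, fderiv ℝ (fderiv ℝ fun θ => f θ x) τ v w ∂μ = 0 := by
  have h := hreg.diff_power.fderiv_fderiv_apply le_rfl hτ v w
  rw [hf.fderiv_fderiv_integral_rpow_one_add_zero (hU hτ)] at h
  simpa only [add_zero, Real.rpow_one, _root_.zero_apply] using h.symm

theorem LehmannBasu.fderiv_dpdIntegrand_self_ae_eq (hLB : LehmannBasu μ Θ f β θ₀ U)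
    (hf : IsParametricModel μ Θ f) (hτ : τ ∈ U) (v : Param p) :
    (fun x => fderiv ℝ (fun θ => dpdIntegrand γ (f θ x) (f τ x)) τ v) =ᵐ[μ]
      fun x => (if γ = 0 then 1 else 0) * fderiv ℝ (fun θ => f θ x) τ v := by
  filter_upwards [hLB.ae_isRegularPoint_or hf] with x hx
  rcases hx with hx | hx
  · rw [hx.fderiv_comp hτ (hasDerivAt_dpdIntegrand (hx.pos τ hτ)),
      dpdIntegrandDeriv_self (hx.pos τ hτ)]
  · rw [fderiv_comp_eq_zero_of_forall_eq hLB.isOpen hx hτ fun y => dpdIntegrand γ y (f τ x),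
      fderiv_comp_eq_zero_of_forall_eq hLB.isOpen hx hτ fun y => y, _root_.zero_apply, mul_zero]

theorem DivergenceRegular.fderiv_dpd_self (hreg : DivergenceRegular μ f γ U)
    (hLB : LehmannBasu μ Θ f β θ₀ U) (hf : IsParametricModel μ Θ f) (hτ : τ ∈ U) :
    fderiv ℝ (fun θ => dpd μ γ (f θ) (f τ)) τ = 0 := by
  ext1 v
  refine ((hreg.diff_dpd τ hτ).fderiv_apply one_le_two hτ v).trans ?_
  rw [integral_congr_ae (hLB.fderiv_dpdIntegrand_self_ae_eq hf hτ v), integral_const_mul]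
  split_ifs with h0
  · subst h0
    rw [hreg.integral_fderiv_eq_zero hf hLB.subset hτ, mul_zero, _root_.zero_apply]
  · rw [zero_mul, _root_.zero_apply]

theorem LehmannBasu.fderiv_fderiv_dpdIntegrand_self_ae_eq (hLB : LehmannBasu μ Θ f β θ₀ U)
    (hf : IsParametricModel μ Θ f) (hτ : τ ∈ U) (v w : Param p) :
    (fun x => fderiv ℝ (fderiv ℝ fun θ => dpdIntegrand γ (f θ x) (f τ x)) τ v w) =ᵐ[μ] fun x =>
      (1 + γ) * (f τ x ^ (γ - 1) * fderiv ℝ (fun θ => f θ x) τ v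
        * fderiv ℝ (fun θ => f θ x) τ w) +
      (if γ = 0 then 1 else 0) * fderiv ℝ (fderiv ℝ fun θ => f θ x) τ v w := by
  filter_upwards [hLB.ae_isRegularPoint_or hf] with x hx
  rcases hx with hx | hx
  · rw [hx.fderiv_fderiv_comp hτ (hasDerivAt_dpdIntegrand (hx.pos τ hτ))
      (hasDerivAt_dpdIntegrandDeriv (hx.pos τ hτ)), dpdIntegrandDeriv_self (hx.pos τ hτ)]
    ring
  · rw [fderiv_fderiv_comp_eq_zero_of_forall_eq hLB.isOpen hx hτ
        fun y => dpdIntegrand γ y (f τ x),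
      fderiv_fderiv_comp_eq_zero_of_forall_eq hLB.isOpen hx hτ fun y => y,
      fderiv_comp_eq_zero_of_forall_eq hLB.isOpen hx hτ fun y => y]
    simp only [_root_.zero_apply, mul_zero, add_zero]

theorem isSymm_aMat : (aMat μ f γ τ).IsSymm := by
  ext i j
  simp only [Matrix.transpose_apply, aMat, Matrix.of_apply, mul_right_comm _ (partialDeriv _ τ i)]

theorem DivergenceRegular.fderiv_fderiv_dpd_self (hreg : DivergenceRegular μ f γ U)
    (hLB : LehmannBasu μ Θ f β θ₀ U) (hf : IsParametricModel μ Θ f) (hτ : τ ∈ U) :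
    fderiv ℝ (fderiv ℝ fun θ => dpd μ γ (f θ) (f τ)) τ = matForm (aMat μ f γ τ) := by
  refine clm_ext_single fun i => clm_ext_single fun j => ?_
  set v : Param p := EuclideanSpace.single i 1
  set w : Param p := EuclideanSpace.single j 1
  have hae := hLB.fderiv_fderiv_dpdIntegrand_self_ae_eq (γ := γ) hf hτ v w
  have hcurv : Integrable (fun x =>
        (if γ = 0 then 1 else 0) * fderiv ℝ (fderiv ℝ fun θ => f θ x) τ v w) μ ∧
      ∫ x, (if γ = 0 then 1 else 0) * fderiv ℝ (fderiv ℝ fun θ => f θ x) τ v w ∂μ = 0 := by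
    split_ifs with h0
    · subst h0
      simpa only [one_mul] using And.intro (hreg.integrable_fderiv_fderiv hτ v w)
        (hreg.integral_fderiv_fderiv_eq_zero hf hLB.subset hτ v w)
    · simp
  have hsq := (((hreg.diff_dpd τ hτ).integrable_fderiv_fderiv le_rfl hτ v w).congr hae).sub'
    hcurv.1
  simp only [add_sub_cancel_right] at hsq
  refine ((hreg.diff_dpd τ hτ).fderiv_fderiv_apply le_rfl hτ v w).trans ?_
  rw [integral_congr_ae hae, integral_add hsq hcurv.1, hcurv.2, add_zero, integral_const_mul,
    matForm_single]
  rfl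

end Divergence

section Taylor

variable {E F : Type*} [NormedAddCommGroup E] [NormedSpace ℝ E] [NormedAddCommGroup F]
  [NormedSpace ℝ F]

set_option maxSynthPendingDepth 5 in
theorem norm_sub_sub_fderiv_le_of_norm_fderiv_fderiv_le {g : E → F} {θ₀ : E} {ρ M : ℝ}
    (hg : ∀ θ ∈ Metric.ball θ₀ ρ, DifferentiableAt ℝ g θ)
    (hg₁ : ∀ θ ∈ Metric.ball θ₀ ρ, DifferentiableAt ℝ (fderiv ℝ g) θ)
    (hM : ∀ θ ∈ Metric.ball θ₀ ρ, ‖fderiv ℝ (fderiv ℝ g) θ‖ ≤ M) {θ : E}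
    (hθ : θ ∈ Metric.ball θ₀ ρ) :
    ‖g θ - g θ₀ - fderiv ℝ g θ₀ (θ - θ₀)‖ ≤ M * ρ * ‖θ - θ₀‖ := by
  have hcenter : θ₀ ∈ Metric.ball θ₀ ρ := Metric.mem_ball_self (Metric.pos_of_mem_ball hθ)
  have hM0 : 0 ≤ M := (norm_nonneg _).trans (hM θ₀ hcenter)
  refine (convex_ball θ₀ ρ).norm_image_sub_le_of_norm_fderiv_le' (𝕜 := ℝ) hg
    (fun τ hτ => ?_) hcenter hθ
  refine ((convex_ball θ₀ ρ).norm_image_sub_le_of_norm_fderiv_le (𝕜 := ℝ) hg₁ hM hcenter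
    hτ).trans (mul_le_mul_of_nonneg_left ?_ hM0)
  rw [← dist_eq_norm]
  exact (Metric.mem_ball.1 hτ).le

set_option maxSynthPendingDepth 5 in
theorem ThriceDifferentiableOn.norm_fderiv_sub_le {φ : E → ℝ} {U : Set E}
    (hφ : ThriceDifferentiableOn φ U) {θ₀ : E} {ρ : ℝ} (hρ : Metric.ball θ₀ ρ ⊆ U) {M : ℝ}
    (hM : ∀ θ ∈ U, ‖iteratedFDeriv ℝ 3 φ θ‖ ≤ M) {θ : E} (hθ : θ ∈ Metric.ball θ₀ ρ) :
    ‖fderiv ℝ φ θ - fderiv ℝ φ θ₀ - fderiv ℝ (fderiv ℝ φ) θ₀ (θ - θ₀)‖ ≤ M * ρ * ‖θ - θ₀‖ :=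
  norm_sub_sub_fderiv_le_of_norm_fderiv_fderiv_le
    (fun τ hτ => hφ.differentiableAt_fderiv τ (hρ hτ))
    (fun τ hτ => hφ.differentiableAt_fderiv_fderiv τ (hρ hτ))
    (fun τ hτ => (norm_fderiv_fderiv_fderiv φ τ).trans_le (hM τ (hρ hτ))) hθ

theorem hasFDerivAt_add_half_mul_bilinear (z : E →L[ℝ] ℝ) {J : E →L[ℝ] E →L[ℝ] ℝ}
    (hJ : ∀ v w, J v w = J w v) (θ₀ τ : E) :
    HasFDerivAt (fun τ => z (τ - θ₀) + 1 / 2 * J (τ - θ₀) (τ - θ₀)) (z + J (τ - θ₀)) τ := by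
  have hid : HasFDerivAt (fun τ : E => τ - θ₀) (ContinuousLinearMap.id ℝ E) τ :=
    (hasFDerivAt_id τ).sub_const θ₀
  have hlin : HasFDerivAt (fun τ : E => z (τ - θ₀)) z τ := z.hasFDerivAt.comp τ hid
  have hform : HasFDerivAt (fun τ : E => J (τ - θ₀)) J τ := J.hasFDerivAt.comp τ hid
  refine (hlin.add ((hform.clm_apply hid).const_mul (1 / 2))).congr_fderiv ?_
  ext v
  simp only [_root_.add_apply, _root_.smul_apply, smul_eq_mul, ContinuousLinearMap.comp_apply,
    ContinuousLinearMap.flip_apply, ContinuousLinearMap.id_apply, hJ v]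
  ring

theorem abs_sub_le_of_norm_fderiv_sub_le {φ : E → ℝ} {s : Set E} (hs : Convex ℝ s) {ε : ℝ}
    (hφ : ∀ τ ∈ s, DifferentiableAt ℝ φ τ) {z : E →L[ℝ] ℝ} {J : E →L[ℝ] E →L[ℝ] ℝ}
    (hJ : ∀ v w, J v w = J w v) (hε : 0 ≤ ε) {θ₀ θ : E} (hθ₀ : θ₀ ∈ s) (hθ : θ ∈ s)
    (h : ∀ τ ∈ s, ‖fderiv ℝ φ τ - (z + J (τ - θ₀))‖ ≤ ε * ‖τ - θ₀‖) :
    |φ θ - φ θ₀ - (z (θ - θ₀) + 1 / 2 * J (θ - θ₀) (θ - θ₀))| ≤ ε * ‖θ - θ₀‖ ^ 2 := by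
  have hconv : Convex ℝ (s ∩ Metric.closedBall θ₀ ‖θ - θ₀‖) := hs.inter (convex_closedBall _ _)
  have hmv := hconv.norm_image_sub_le_of_norm_hasFDerivWithin_le (C := ε * ‖θ - θ₀‖)
    (fun τ hτ => ((hφ τ hτ.1).hasFDerivAt.sub
      (hasFDerivAt_add_half_mul_bilinear z hJ θ₀ τ)).hasFDerivWithinAt)
    (fun τ hτ => (h τ hτ.1).trans
      (mul_le_mul_of_nonneg_left (by rw [← dist_eq_norm]; exact hτ.2) hε))
    ⟨hθ₀, Metric.mem_closedBall_self (norm_nonneg _)⟩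
    ⟨hθ, Metric.mem_closedBall.2 (dist_eq_norm θ θ₀).le⟩
  rw [Real.norm_eq_abs, mul_assoc, ← pow_two] at hmv
  convert! hmv using 2
  simp only [Pi.sub_apply, sub_self, map_zero, mul_zero, add_zero, sub_zero]
  ring

end Taylor

section EmpiricalObjective

variable {𝒳 : Type*} [MeasurableSpace 𝒳] {μ : Measure 𝒳} {p : ℕ} {Θ U : Set (Param p)}
  {f : Param p → 𝒳 → ℝ} {β : ℝ} {θ₀ θ : Param p} {n : ℕ} {x : Fin n → 𝒳}

theorem hasFDerivAt_empObjective (hLB : LehmannBasu μ Θ f β θ₀ U)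
    (hx : ∀ i, IsRegularPoint f U (x i)) (hθ : θ ∈ U) :
    HasFDerivAt (empObjective μ f β x)
      ((n : ℝ)⁻¹ • ∑ i, fderiv ℝ (fun θ => objective μ f β θ (x i)) θ) θ :=
  (HasFDerivAt.fun_sum fun i _ =>
    (((hx i).thriceDifferentiableOn_objective hLB).differentiableAt θ hθ).hasFDerivAt).const_mul _

theorem hasFDerivAt_fderiv_empObjective (hLB : LehmannBasu μ Θ f β θ₀ U)
    (hx : ∀ i, IsRegularPoint f U (x i)) (hθ : θ ∈ U) :
    HasFDerivAt (fderiv ℝ (empObjective μ f β x))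
      ((n : ℝ)⁻¹ • ∑ i, fderiv ℝ (fderiv ℝ fun θ => objective μ f β θ (x i)) θ) θ := by
  have heq : fderiv ℝ (empObjective μ f β x) =ᶠ[𝓝 θ]
      fun θ => (n : ℝ)⁻¹ • ∑ i, fderiv ℝ (fun θ => objective μ f β θ (x i)) θ := by
    filter_upwards [hLB.isOpen.mem_nhds hθ] with τ hτ
      using (hasFDerivAt_empObjective hLB hx hτ).fderiv
  refine HasFDerivAt.congr_of_eventuallyEq ?_ heq
  exact (HasFDerivAt.fun_sum fun i _ =>
    (((hx i).thriceDifferentiableOn_objective hLB).differentiableAt_fderiv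
      θ hθ).hasFDerivAt).const_smul (n : ℝ)⁻¹

theorem hasStrictFDerivAt_empObjective (hLB : LehmannBasu μ Θ f β θ₀ U)
    (hx : ∀ i, IsRegularPoint f U (x i)) (hθ : θ ∈ U) :
    HasStrictFDerivAt (empObjective μ f β x) (fderiv ℝ (empObjective μ f β x) θ) θ := by
  refine hasStrictFDerivAt_of_hasFDerivAt_of_continuousAt ?_
    (hasFDerivAt_fderiv_empObjective hLB hx hθ).continuousAt
  filter_upwards [hLB.isOpen.mem_nhds hθ] with τ hτ
  exact (hasFDerivAt_empObjective hLB hx hτ).differentiableAt.hasFDerivAt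

theorem fderiv_empObjective (hLB : LehmannBasu μ Θ f β θ₀ U) (hf : IsParametricModel μ Θ f)
    (hx : ∀ i, IsRegularPoint f U (x i)) (hθ : θ ∈ U) :
    fderiv ℝ (empObjective μ f β x) θ =
      -(1 + β) • innerSL ℝ ((n : ℝ)⁻¹ • ∑ i, estimatingFun μ f β θ (x i)) := by
  rw [(hasFDerivAt_empObjective hLB hx hθ).fderiv,
    Finset.sum_congr rfl fun i _ => (hx i).fderiv_objective hLB hf hθ, ← Finset.smul_sum,
    smul_comm, map_smul, map_sum]

theorem isEstimatingRoot_iff (hn : n ≠ 0) : IsEstimatingRoot μ Θ f β x θ ↔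
    θ ∈ Θ ∧ (n : ℝ)⁻¹ • ∑ i, estimatingFun μ f β θ (x i) = 0 := by
  refine and_congr_right fun _ => (forall_congr' fun j => ?_).trans PiLp.ext_iff.symm
  have hn' : (n : ℝ) ≠ 0 := Nat.cast_ne_zero.2 hn
  simp only [estimatingFun, weightedScore, xiVec, Finset.sum_sub_distrib, smul_sub, PiLp.sub_apply,
    PiLp.smul_apply, smul_eq_mul, Finset.sum_const, Finset.card_univ, Fintype.card_fin,
    ← Nat.cast_smul_eq_nsmul ℝ, inv_smul_smul₀ hn', WithLp.ofLp_sum, Finset.sum_apply,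
    PiLp.zero_apply]

theorem isEstimatingRoot_iff_fderiv_eq_zero (hLB : LehmannBasu μ Θ f β θ₀ U)
    (hf : IsParametricModel μ Θ f) (hβ : 0 ≤ β) (hx : ∀ i, IsRegularPoint f U (x i)) (hn : n ≠ 0)
    (hθ : θ ∈ U) : IsEstimatingRoot μ Θ f β x θ ↔ fderiv ℝ (empObjective μ f β x) θ = 0 := by
  have hc : -(1 + β) ≠ 0 := neg_ne_zero.2 (by positivity)
  rw [isEstimatingRoot_iff hn, fderiv_empObjective hLB hf hx hθ, smul_eq_zero_iff_right hc,
    ← norm_eq_zero (a := innerSL ℝ _), innerSL_apply_norm, norm_eq_zero,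
    and_iff_right (hLB.subset hθ)]

theorem norm_fderiv_empObjective_sub_le (hLB : LehmannBasu μ Θ f β θ₀ U)
    (hx : ∀ i, IsRegularPoint f U (x i)) {M : 𝒳 → ℝ}
    (hM : ∀ i, ∀ θ ∈ U, ‖iteratedFDeriv ℝ 3 (fun τ => objective μ f β τ (x i)) θ‖ ≤ M (x i))
    {ρ : ℝ} (hρ : Metric.ball θ₀ ρ ⊆ U) (hθ : θ ∈ Metric.ball θ₀ ρ) :
    ‖fderiv ℝ (empObjective μ f β x) θ - fderiv ℝ (empObjective μ f β x) θ₀ -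
      fderiv ℝ (fderiv ℝ (empObjective μ f β x)) θ₀ (θ - θ₀)‖ ≤
        ((n : ℝ)⁻¹ • ∑ i, M (x i)) * ρ * ‖θ - θ₀‖ := by
  rw [(hasFDerivAt_empObjective hLB hx (hρ hθ)).fderiv,
    (hasFDerivAt_empObjective hLB hx hLB.mem).fderiv,
    (hasFDerivAt_fderiv_empObjective hLB hx hLB.mem).fderiv]
  simp only [_root_.smul_apply, _root_.sum_apply]
  rw [← smul_sub, ← smul_sub, ← Finset.sum_sub_distrib, ← Finset.sum_sub_distrib, norm_smul,
    Real.norm_of_nonneg (by positivity), smul_eq_mul, mul_assoc, mul_assoc, Finset.sum_mul]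
  refine mul_le_mul_of_nonneg_left (norm_sum_le_of_le _ fun i _ => ?_) (by positivity)
  rw [← mul_assoc]
  exact ((hx i).thriceDifferentiableOn_objective hLB).norm_fderiv_sub_le hρ (hM i) hθ

end EmpiricalObjective

section Expansion

variable {𝒳 Ω : Type*} [MeasurableSpace 𝒳] {μ : Measure 𝒳} {p : ℕ} {Θ U : Set (Param p)}
  {f : Param p → 𝒳 → ℝ} {β : ℝ} {θ₀ θ : Param p}
  [MeasurableSpace Ω] {P : Measure Ω} {X : ℕ → Ω → 𝒳}

theorem IsRandomSample.eventually_isRegularPoint (hX : IsRandomSample P X (modelLaw μ f θ₀))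
    (hLB : LehmannBasu μ Θ f β θ₀ U) (hf : IsParametricModel μ Θ f) :
    ∀ᶠ q in probFilter atTop P, ∀ i, IsRegularPoint f U (sample X q.1 q.2 i) := by
  refine eventually_probFilter_of_ae ?_
  filter_upwards [hX.ae_forall (hLB.ae_isRegularPoint hf)] with ω hω n i using hω i

theorem isSymm_jMat : (jMat μ f β θ).IsSymm := by
  ext i j
  simp only [jMat, Matrix.transpose_apply, Matrix.of_apply, mul_comm (score f θ _ j)]

variable [IsProbabilityMeasure P]

theorem IsRandomSample.tendsto_sampleMean_estimatingFun
    (hX : IsRandomSample P X (modelLaw μ f θ₀)) (hLB : LehmannBasu μ Θ f β θ₀ U)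
    (hf : IsParametricModel μ Θ f) (hβ : 0 ≤ β) :
    Tendsto (sampleMean X (estimatingFun μ f β θ₀)) (probFilter atTop P) (𝓝 0) := by
  have hprob := hf.isProbabilityMeasure (hLB.subset hLB.mem)
  simpa only [hLB.integral_estimatingFun hf hβ] using
    hX.tendsto_sampleMean ((hLB.memLp_estimatingFun hf hβ).integrable one_le_two)

set_option maxSynthPendingDepth 5 in
theorem IsRandomSample.tendsto_fderiv_fderiv_empObjective
    (hX : IsRandomSample P X (modelLaw μ f θ₀)) (hLB : LehmannBasu μ Θ f β θ₀ U)
    (hf : IsParametricModel μ Θ f) (hβ : 0 ≤ β) :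
    Tendsto (fun q : ℕ × Ω => fderiv ℝ (fderiv ℝ (empObjective μ f β (sample X q.1 q.2))) θ₀)
      (probFilter atTop P) (𝓝 ((1 + β) • matForm (jMat μ f β θ₀))) := by
  refine tendsto_bilinear_of_tendsto_single fun i j => ?_
  obtain ⟨hint, hmean⟩ := hLB.integrable_and_integral_objectiveHess hf hβ i j
  simp only [_root_.smul_apply, matForm_single, smul_eq_mul]
  rw [isSymm_jMat.apply, ← hmean]
  refine (hX.tendsto_sampleMean hint).congr' ?_
  filter_upwards [hX.eventually_isRegularPoint hLB hf] with q hq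
  rw [(hasFDerivAt_fderiv_empObjective hLB hq hLB.mem).fderiv]
  simp only [_root_.smul_apply, _root_.sum_apply]
  rfl

theorem IsRandomSample.exists_eventually_norm_fderiv_empObjective_sub_le
    (hX : IsRandomSample P X (modelLaw μ f θ₀)) (hLB : LehmannBasu μ Θ f β θ₀ U)
    (hf : IsParametricModel μ Θ f) :
    ∃ C > 0, ∀ ρ, Metric.ball θ₀ ρ ⊆ U → ∀ᶠ q in probFilter atTop P, ∀ θ ∈ Metric.ball θ₀ ρ,
      ‖fderiv ℝ (empObjective μ f β (sample X q.1 q.2)) θ -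
        fderiv ℝ (empObjective μ f β (sample X q.1 q.2)) θ₀ -
        fderiv ℝ (fderiv ℝ (empObjective μ f β (sample X q.1 q.2))) θ₀ (θ - θ₀)‖ ≤
          C * ρ * ‖θ - θ₀‖ := by
  obtain ⟨M, hMint, hM⟩ := hLB.dominated
  have hmean := hX.tendsto_sampleMean
    ((hf.integrable_modelLaw_iff (hLB.subset hLB.mem)).2 hMint)
  set C : ℝ := |∫ x, M x ∂modelLaw μ f θ₀| + 1
  have hMC : ∀ᶠ q in probFilter atTop P, sampleMean X M q ≤ C :=
    hmean.eventually_le_const ((le_abs_self _).trans_lt (lt_add_one _))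
  have hdom : ∀ᶠ q in probFilter atTop P, ∀ i, ∀ θ ∈ U,
      ‖iteratedFDeriv ℝ 3 (fun τ => objective μ f β τ (sample X q.1 q.2 i)) θ‖
        ≤ M (sample X q.1 q.2 i) := by
    refine eventually_probFilter_of_ae ?_
    filter_upwards [hX.ae_forall (hf.ae_modelLaw_iff.2 hM)] with ω hω n i using hω i
  refine ⟨C, by positivity, fun ρ hρ => ?_⟩
  filter_upwards [hMC, hdom, hX.eventually_isRegularPoint hLB hf] with q hqC hqM hreg θ hθ
  have hρ0 : 0 < ρ := Metric.pos_of_mem_ball hθ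
  refine (norm_fderiv_empObjective_sub_le hLB hreg hqM hρ hθ).trans ?_
  gcongr
  exact hqC

set_option maxSynthPendingDepth 5 in
theorem IsRandomSample.exists_ball_norm_fderiv_empObjective_sub_le
    (hX : IsRandomSample P X (modelLaw μ f θ₀)) (hLB : LehmannBasu μ Θ f β θ₀ U)
    (hf : IsParametricModel μ Θ f) (hβ : 0 ≤ β) {ε : ℝ} (hε : 0 < ε) :
    ∃ ρ > 0, Metric.ball θ₀ ρ ⊆ U ∧ ∀ᶠ q in probFilter atTop P, ∀ θ ∈ Metric.ball θ₀ ρ,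
      ‖fderiv ℝ (empObjective μ f β (sample X q.1 q.2)) θ -
        (-(1 + β) • innerSL ℝ (sampleMean X (estimatingFun μ f β θ₀) q) +
          ((1 + β) • matForm (jMat μ f β θ₀)) (θ - θ₀))‖ ≤ ε * ‖θ - θ₀‖ := by
  obtain ⟨C, hC, hCρ⟩ := hX.exists_eventually_norm_fderiv_empObjective_sub_le hLB hf
  obtain ⟨r, hr, hrU⟩ := Metric.isOpen_iff.1 hLB.isOpen θ₀ hLB.mem
  set ρ : ℝ := min r (ε / (2 * C))
  have hρU : Metric.ball θ₀ ρ ⊆ U := (Metric.ball_subset_ball (min_le_left _ _)).trans hrU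
  have hρC : C * ρ ≤ ε / 2 := by
    calc C * ρ ≤ C * (ε / (2 * C)) := mul_le_mul_of_nonneg_left (min_le_right _ _) hC.le
      _ = ε / 2 := by field_simp
  have hhess := (hX.tendsto_fderiv_fderiv_empObjective hLB hf hβ).eventually
    (Metric.ball_mem_nhds _ (half_pos hε))
  refine ⟨ρ, lt_min hr (by positivity), hρU, ?_⟩
  filter_upwards [hCρ ρ hρU, hhess, hX.eventually_isRegularPoint hLB hf] with q hq hH hreg θ hθ
  set Q := empObjective μ f β (sample X q.1 q.2)
  set D := fderiv ℝ (fderiv ℝ Q) θ₀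
  have hgrad : fderiv ℝ Q θ₀ = -(1 + β) • innerSL ℝ (sampleMean X (estimatingFun μ f β θ₀) q) :=
    fderiv_empObjective hLB hf hreg hLB.mem
  have hcubic : ‖fderiv ℝ Q θ - fderiv ℝ Q θ₀ - D (θ - θ₀)‖ ≤ ε / 2 * ‖θ - θ₀‖ :=
    (hq θ hθ).trans (mul_le_mul_of_nonneg_right hρC (norm_nonneg _))
  have hquadratic : ‖(D - (1 + β) • matForm (jMat μ f β θ₀)) (θ - θ₀)‖ ≤ ε / 2 * ‖θ - θ₀‖ := by
    refine (ContinuousLinearMap.le_opNorm _ _).trans (mul_le_mul_of_nonneg_right ?_ (norm_nonneg _))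
    rw [← dist_eq_norm]
    exact (Metric.mem_ball.1 hH).le
  rw [← hgrad]
  calc ‖fderiv ℝ Q θ - (fderiv ℝ Q θ₀ + ((1 + β) • matForm (jMat μ f β θ₀)) (θ - θ₀))‖
      = ‖(fderiv ℝ Q θ - fderiv ℝ Q θ₀ - D (θ - θ₀)) +
          (D - (1 + β) • matForm (jMat μ f β θ₀)) (θ - θ₀)‖ := by
        rw [_root_.sub_apply]; congr 1; abel
    _ ≤ ε / 2 * ‖θ - θ₀‖ + ε / 2 * ‖θ - θ₀‖ :=
        (norm_add_le _ _).trans (add_le_add hcubic hquadratic)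
    _ = ε * ‖θ - θ₀‖ := by ring

end Expansion

section Existence

open scoped MatrixOrder Matrix.Norms.L2Operator in
theorem exists_pos_mul_sq_le_matForm {p : ℕ} {M : Matrix (Fin p) (Fin p) ℝ} (hM : M.PosDef) :
    ∃ κ > 0, ∀ v : Param p, κ * ‖v‖ ^ 2 ≤ matForm M v v := by
  rcases isEmpty_or_nonempty (Fin p) with _ | _
  · exact ⟨1, one_pos, fun v => by simp [Subsingleton.elim v 0]⟩
  obtain ⟨κ, hκ, hκM⟩ := (CFC.exists_pos_algebraMap_le_iff hM.isHermitian).2 fun x hx =>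
    hM.isStrictlyPositive.spectrum_pos hx
  refine ⟨κ, hκ, fun v => ?_⟩
  rw [matForm_apply, inner_matMap, EuclideanSpace.real_norm_sq_eq]
  simpa [Algebra.algebraMap_eq_smul_one, Matrix.sub_mulVec, dotProduct_sub, Matrix.smul_mulVec,
    dotProduct, sq, mul_sub, Finset.sum_sub_distrib, Finset.mul_sum, mul_left_comm κ]
    using (Matrix.le_iff.1 hκM).dotProduct_mulVec_nonneg v.ofLp

variable {𝒳 Ω : Type*} [MeasurableSpace 𝒳] {μ : Measure 𝒳} {p r : ℕ} {Θ U : Set (Param p)}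
  {f : Param p → 𝒳 → ℝ} {g : Param p → Param r} {β : ℝ} {θ₀ : Param p}

theorem IsParametricModel.measurable_objective (hf : IsParametricModel μ Θ f) (θ : Param p) :
    Measurable (objective μ f β θ) := by
  have hfθ := hf.measurable_apply θ
  unfold objective
  split_ifs <;> fun_prop

theorem IsParametricModel.measurable_empObjective (hf : IsParametricModel μ Θ f) (θ : Param p)
    (n : ℕ) : Measurable fun x : Fin n → 𝒳 => empObjective μ f β x θ :=
  (Finset.measurable_fun_sum _ fun i _ =>
    (hf.measurable_objective θ).comp (measurable_pi_apply i)).const_mul _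

variable [MeasurableSpace Ω] {P : Measure Ω} {X : ℕ → Ω → 𝒳}

-- The empirical objective function is continuous in the parameter only for regular data, so the
-- minimizer is selected for its product with the indicator of a measurable set of regular data.
theorem IsRandomSample.exists_measurable_minimizer (hX : IsRandomSample P X (modelLaw μ f θ₀))
    (hLB : LehmannBasu μ Θ f β θ₀ U) (hf : IsParametricModel μ Θ f) {K : Set (Param p)}
    (hK : IsCompact K) (hne : K.Nonempty) (hKU : K ⊆ U) :
    ∃ T : ∀ n : ℕ, (Fin n → 𝒳) → Param p, (∀ n, Measurable (T n)) ∧ (∀ n x, T n x ∈ K) ∧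
      ∀ᶠ q in probFilter atTop P, IsMinOn (empObjective μ f β (sample X q.1 q.2)) K
        (T q.1 (sample X q.1 q.2)) := by
  classical
  obtain ⟨N, hNreg, hN, hN0⟩ :=
    exists_measurable_superset_of_null (ae_iff.1 (hLB.ae_isRegularPoint hf))
  have hreg : ∀ x ∉ N, IsRegularPoint f U x := fun x hx => not_not.1 fun h => hx (hNreg h)
  have hNset : ∀ n : ℕ, MeasurableSet {x : Fin n → 𝒳 | ∀ i, x i ∉ N} := fun n => by
    rw [Set.ofPred_forall]
    exact .iInter fun i =>
      (measurable_pi_apply i : Measurable fun x : Fin n → 𝒳 => x i) hN.compl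
  have hsel : ∀ n : ℕ, ∃ T : (Fin n → 𝒳) → Param p, Measurable T ∧ ∀ x, T x ∈ K ∧ ∀ τ ∈ K,
      (if ∀ i, x i ∉ N then empObjective μ f β x (T x) else 0) ≤
        if ∀ i, x i ∉ N then empObjective μ f β x τ else 0 := fun n => by
    refine exists_measurable_argmin hK hne
      (F := fun θ (x : Fin n → 𝒳) => if ∀ i, x i ∉ N then empObjective μ f β x θ else 0)
      (fun θ _ => .ite (hNset n) (hf.measurable_empObjective θ n) measurable_const) fun x => ?_
    by_cases hx : ∀ i, x i ∉ N
    · simp only [if_pos hx]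
      exact fun θ hθ => (hasFDerivAt_empObjective hLB (fun i => hreg _ (hx i))
        (hKU hθ)).continuousAt.continuousWithinAt
    · simp only [if_neg hx]
      exact continuousOn_const
  choose T hT hTmin using hsel
  refine ⟨T, hT, fun n x => (hTmin n x).1, eventually_probFilter_of_ae ?_⟩
  filter_upwards [hX.ae_forall (measure_eq_zero_iff_ae_notMem.1 hN0)] with ω hω n τ hτ
  have hsample : ∀ i, sample X n ω i ∉ N := fun i => hω i
  simpa only [if_pos hsample, Set.mem_ofPred_eq] using (hTmin n (sample X n ω)).2 τ hτ

variable [IsProbabilityMeasure P]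

theorem IsRandomSample.exists_ball_norm_sub_le_of_empObjective_le
    (hX : IsRandomSample P X (modelLaw μ f θ₀)) (hLB : LehmannBasu μ Θ f β θ₀ U)
    (hf : IsParametricModel μ Θ f) (hβ : 0 ≤ β) :
    ∃ C, ∃ ρ > 0, Metric.ball θ₀ ρ ⊆ U ∧ ∀ᶠ q in probFilter atTop P, ∀ θ ∈ Metric.ball θ₀ ρ,
      empObjective μ f β (sample X q.1 q.2) θ ≤ empObjective μ f β (sample X q.1 q.2) θ₀ →
      ‖θ - θ₀‖ ≤ C * ‖sampleMean X (estimatingFun μ f β θ₀) q‖ := by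
  have hβ' : 0 < 1 + β := by positivity
  obtain ⟨κ, hκ, hκJ⟩ := exists_pos_mul_sq_le_matForm hLB.posDef
  have hε : 0 < (1 + β) * κ / 4 := by positivity
  obtain ⟨ρ, hρ, hρU, hev⟩ := hX.exists_ball_norm_fderiv_empObjective_sub_le hLB hf hβ hε
  refine ⟨4 / κ, ρ, hρ, hρU, ?_⟩
  filter_upwards [hev, hX.eventually_isRegularPoint hLB hf] with q hq hreg θ hθ hle
  have hsymm : ∀ v w, ((1 + β) • matForm (jMat μ f β θ₀)) v w =
      ((1 + β) • matForm (jMat μ f β θ₀)) w v := fun v w =>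
    congrArg ((1 + β) • ·) (matForm_comm isSymm_jMat v w)
  have htaylor := (abs_le.1 <| abs_sub_le_of_norm_fderiv_sub_le (convex_ball θ₀ ρ)
    (fun τ hτ => (hasFDerivAt_empObjective hLB hreg (hρU hτ)).differentiableAt)
    hsymm hε.le (Metric.mem_ball_self hρ) hθ hq).1
  simp only [_root_.smul_apply, smul_eq_mul, innerSL_apply_apply] at htaylor
  set z := sampleMean X (estimatingFun μ f β θ₀) q
  set δ := θ - θ₀
  have hquad : κ / 4 * ‖δ‖ * ‖δ‖ ≤ ‖z‖ * ‖δ‖ := by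
    refine le_trans (le_of_mul_le_mul_left ?_ hβ') (real_inner_le_norm z δ)
    linarith [mul_le_mul_of_nonneg_left (hκJ δ) hβ'.le]
  rcases (norm_nonneg δ).eq_or_lt with h0 | h0
  · rw [← h0]; positivity
  · rw [div_mul_eq_mul_div, le_div_iff₀ hκ]
    linarith [le_of_mul_le_mul_right hquad h0]

theorem IsRandomSample.exists_consistent_localMin
    (hX : IsRandomSample P X (modelLaw μ f θ₀)) (hLB : LehmannBasu μ Θ f β θ₀ U)
    (hf : IsParametricModel μ Θ f) (hβ : 0 ≤ β) {S : Set (Param p)} (hθ₀ : θ₀ ∈ S)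
    (hS : ∀ r, Metric.closedBall θ₀ r ⊆ U → IsClosed (Metric.closedBall θ₀ r ∩ S)) :
    ∃ T : ∀ n : ℕ, (Fin n → 𝒳) → Param p, (∀ n, Measurable (T n)) ∧
      Tendsto (fun q : ℕ × Ω => T q.1 (sample X q.1 q.2)) (probFilter atTop P) (𝓝 θ₀) ∧
      ∀ᶠ q in probFilter atTop P, T q.1 (sample X q.1 q.2) ∈ S ∧
        IsLocalMinOn (empObjective μ f β (sample X q.1 q.2)) S (T q.1 (sample X q.1 q.2)) := by
  obtain ⟨C, ρ, hρ, hρU, hbound⟩ := hX.exists_ball_norm_sub_le_of_empObjective_le hLB hf hβ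
  have hball : Metric.closedBall θ₀ (ρ / 2) ⊆ Metric.ball θ₀ ρ :=
    Metric.closedBall_subset_ball (half_lt_self hρ)
  have hθ₀K : θ₀ ∈ Metric.closedBall θ₀ (ρ / 2) ∩ S :=
    ⟨Metric.mem_closedBall_self (half_pos hρ).le, hθ₀⟩
  obtain ⟨T, hT, hTK, hmin⟩ := hX.exists_measurable_minimizer hLB hf
    ((isCompact_closedBall θ₀ (ρ / 2)).of_isClosed_subset (hS _ (hball.trans hρU))
      Set.inter_subset_left) ⟨θ₀, hθ₀K⟩ fun θ hθ => hρU (hball hθ.1)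
  have hcons : Tendsto (fun q : ℕ × Ω => T q.1 (sample X q.1 q.2)) (probFilter atTop P)
      (𝓝 θ₀) := by
    have hz := (hX.tendsto_sampleMean_estimatingFun hLB hf hβ).norm.const_mul C
    rw [norm_zero, mul_zero] at hz
    refine tendsto_iff_norm_sub_tendsto_zero.2 <|
      squeeze_zero' (Eventually.of_forall fun _ => norm_nonneg _) ?_ hz
    filter_upwards [hbound, hmin] with q hq hqmin using hq _ (hball (hTK _ _).1) (hqmin hθ₀K)
  refine ⟨T, hT, hcons, ?_⟩
  filter_upwards [hmin, hcons.eventually (Metric.ball_mem_nhds θ₀ (half_pos hρ))] with q hq hqball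
  refine ⟨(hTK _ _).2, ?_⟩
  filter_upwards [mem_nhdsWithin_of_mem_nhds (Metric.isOpen_ball.mem_nhds hqball),
    self_mem_nhdsWithin] with τ hτ hτS using hq ⟨Metric.ball_subset_closedBall hτ, hτS⟩

theorem IsRandomSample.exists_isMDPDE (hX : IsRandomSample P X (modelLaw μ f θ₀))
    (hLB : LehmannBasu μ Θ f β θ₀ U) (hf : IsParametricModel μ Θ f) (hβ : 0 ≤ β) :
    ∃ T, IsMDPDE μ Θ f β θ₀ P X T := by
  obtain ⟨T, hT, hcons, hmin⟩ := hX.exists_consistent_localMin hLB hf hβ (S := Θ)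
    (hLB.subset hLB.mem) fun r hr => by
      rw [Set.inter_eq_left.2 (hr.trans hLB.subset)]
      exact Metric.isClosed_closedBall
  refine ⟨T, hT, tendstoInMeasure_const_iff.2 hcons, (eventually_probFilter (p := fun q =>
    IsEstimatingRoot μ Θ f β (sample X q.1 q.2) (T q.1 (sample X q.1 q.2)))).1 ?_⟩
  filter_upwards [hmin, hX.eventually_isRegularPoint hLB hf,
    hcons.eventually (hLB.isOpen.mem_nhds hLB.mem),
    tendsto_fst_probFilter.eventually (eventually_ne_atTop 0)] with q hq hreg hU hn
  rw [isEstimatingRoot_iff_fderiv_eq_zero hLB hf hβ hreg hn hU]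
  exact (hq.2.isLocalMin (hf.isOpen.mem_nhds hq.1)).fderiv_eq_zero

theorem IsRandomSample.exists_isRMDPDE (hX : IsRandomSample P X (modelLaw μ f θ₀))
    (hLB : LehmannBasu μ Θ f β θ₀ U) (hf : IsParametricModel μ Θ f) (hβ : 0 ≤ β)
    (hg : IsConstraint Θ g) (hθ₀ : θ₀ ∈ nullSet Θ g) : ∃ S, IsRMDPDE μ Θ f g β θ₀ P X S := by
  obtain ⟨T, hT, hcons, hmin⟩ := hX.exists_consistent_localMin hLB hf hβ hθ₀ fun r hr => by
    have hball : Metric.closedBall θ₀ r ∩ nullSet Θ g = Metric.closedBall θ₀ r ∩ g ⁻¹' {0} :=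
      Set.ext fun τ => ⟨fun h => ⟨h.1, h.2.2⟩, fun h => ⟨h.1, hLB.subset (hr h.1), h.2⟩⟩
    rw [hball]
    exact ContinuousOn.preimage_isClosed_of_isClosed
      (fun τ hτ => (hg.differentiable τ (hLB.subset (hr hτ))).continuousAt.continuousWithinAt)
      Metric.isClosed_closedBall isClosed_singleton
  exact ⟨T, hT, tendstoInMeasure_const_iff.2 hcons, (eventually_probFilter (p := fun q =>
    IsRestrictedMin μ Θ f g β (sample X q.1 q.2) (T q.1 (sample X q.1 q.2)))).1 hmin⟩

end Existence

section Constraint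

variable {E F : Type*} [NormedAddCommGroup E] [NormedSpace ℝ E] [CompleteSpace E]
  [NormedAddCommGroup F] [NormedSpace ℝ F] [CompleteSpace F]

theorem exists_dual_comp_eq_of_isLocalExtrOn {g : E → F} {g' : E →L[ℝ] F} {φ : E → ℝ}
    {φ' : E →L[ℝ] ℝ} {θ : E} (hextr : IsLocalExtrOn φ {τ | g τ = g θ} θ)
    (hg : HasStrictFDerivAt g g' θ) (hsurj : Function.Surjective g')
    (hφ : HasStrictFDerivAt φ φ' θ) : ∃ Λ : F →ₗ[ℝ] ℝ, ∀ v, φ' v = Λ (g' v) := by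
  obtain ⟨Λ, Λ₀, hne, hΛ⟩ := hextr.exists_linear_map_of_hasStrictFDerivAt hg hφ
  have hΛ₀ : Λ₀ ≠ 0 := by
    rintro rfl
    refine hne (Prod.ext (LinearMap.ext fun w => ?_) rfl)
    obtain ⟨v, rfl⟩ := hsurj w
    simpa using hΛ v
  refine ⟨-(Λ₀⁻¹ • Λ), fun v => ?_⟩
  rw [LinearMap.neg_apply, LinearMap.smul_apply, eq_neg_of_add_eq_zero_left (hΛ v), smul_neg,
    neg_neg, inv_smul_smul₀ hΛ₀]

variable {p r : ℕ} {Θ : Set (Param p)} {g : Param p → Param r} {θ : Param p}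

theorem IsConstraint.fderiv_eq (hg : IsConstraint Θ g) (hθ : θ ∈ Θ) :
    fderiv ℝ g θ = matMap (gMat g θ)ᵀ := by
  refine clm_ext_single fun i => ?_
  ext j
  have hj : HasFDerivAt (fun τ => g τ j)
      ((EuclideanSpace.proj j : Param r →L[ℝ] ℝ).comp (fderiv ℝ g θ)) θ :=
    (EuclideanSpace.proj j : Param r →L[ℝ] ℝ).hasFDerivAt.comp θ
      (hg.differentiable θ hθ).hasFDerivAt
  simp [matMap_apply, gMat, partialDeriv, hj.fderiv]

theorem IsConstraint.hasStrictFDerivAt (hg : IsConstraint Θ g) (hΘ : IsOpen Θ) (hθ : θ ∈ Θ) :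
    HasStrictFDerivAt g (matMap (gMat g θ)ᵀ) θ := by
  rw [← hg.fderiv_eq hθ]
  refine hasStrictFDerivAt_of_hasFDerivAt_of_continuousAt ?_ ?_
  · filter_upwards [hΘ.mem_nhds hθ] with τ hτ using (hg.differentiable τ hτ).hasFDerivAt
  · have hcont : ContinuousAt (fun τ => matMap (gMat g τ)ᵀ) θ :=
      (continuous_matMap.comp continuous_id.matrix_transpose).continuousAt.comp
        (hg.continuous.continuousAt (hΘ.mem_nhds hθ))
    refine hcont.congr ?_
    filter_upwards [hΘ.mem_nhds hθ] with τ hτ using (hg.fderiv_eq hτ).symm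

theorem IsConstraint.injective_mulVec (hg : IsConstraint Θ g) (hθ : θ ∈ Θ) :
    Function.Injective (gMat g θ).mulVec := by
  rw [Matrix.mulVec_injective_iff, linearIndependent_iff_card_eq_finrank_span,
    Set.finrank, ← Matrix.rank_eq_finrank_span_cols, hg.rank θ hθ, Fintype.card_fin]

theorem IsConstraint.exists_mul_gMat_eq_one (hg : IsConstraint Θ g) (hθ : θ ∈ Θ) :
    ∃ L : Matrix (Fin r) (Fin p) ℝ, L * gMat g θ = 1 := by
  have hunit : IsUnit ((gMat g θ)ᵀ * gMat g θ).det :=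
    (Matrix.isUnit_iff_isUnit_det _).1
      (Matrix.PosDef.conjTranspose_mul_self _ (hg.injective_mulVec hθ)).isUnit
  exact ⟨((gMat g θ)ᵀ * gMat g θ)⁻¹ * (gMat g θ)ᵀ, by
    rw [Matrix.mul_assoc, Matrix.nonsing_inv_mul _ hunit]⟩

theorem IsConstraint.surjective_matMap_transpose (hg : IsConstraint Θ g) (hθ : θ ∈ Θ) :
    Function.Surjective (matMap (gMat g θ)ᵀ) := fun v => by
  obtain ⟨L, hL⟩ := hg.exists_mul_gMat_eq_one hθ
  refine ⟨matMap Lᵀ v, ?_⟩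
  rw [← matMap_mul_apply, ← Matrix.transpose_mul, hL, Matrix.transpose_one, matMap_one_apply]

theorem IsConstraint.exists_fderiv_eq_innerSL (hg : IsConstraint Θ g) (hΘ : IsOpen Θ)
    {φ : Param p → ℝ} (hθ : θ ∈ nullSet Θ g) (hmin : IsLocalMinOn φ (nullSet Θ g) θ)
    (hφ : HasStrictFDerivAt φ (fderiv ℝ φ θ) θ) :
    ∃ a : Param r, fderiv ℝ φ θ = innerSL ℝ (matMap (gMat g θ) a) := by
  have hextr : IsLocalExtrOn φ {τ | g τ = g θ} θ := by
    refine Or.inl (eventually_nhdsWithin_iff.2 ?_)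
    filter_upwards [eventually_nhdsWithin_iff.1 hmin, hΘ.mem_nhds hθ.1] with τ hτ hτΘ hgτ
    exact hτ ⟨hτΘ, (hgτ : g τ = g θ).trans hθ.2⟩
  obtain ⟨Λ, hΛ⟩ := exists_dual_comp_eq_of_isLocalExtrOn hextr (hg.hasStrictFDerivAt hΘ hθ.1)
    (hg.surjective_matMap_transpose hθ.1) hφ
  refine ⟨(InnerProductSpace.toDual ℝ _).symm Λ.toContinuousLinearMap, ?_⟩
  ext v
  rw [hΛ, innerSL_apply_apply, ← inner_matMap_transpose, real_inner_comm,
    InnerProductSpace.toDual_symm_apply, LinearMap.coe_toContinuousLinearMap']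

end Constraint

section LagrangeMatrix

variable {p r : ℕ} {J : Matrix (Fin p) (Fin p) ℝ} {G : Matrix (Fin p) (Fin r) ℝ}

/-- The matrix `J⁻¹ G [Gᵀ J⁻¹ G]⁻¹ Gᵀ J⁻¹`, of which `B_β` is a special case: it is the
correction of `J⁻¹` due to the linear constraint `Gᵀ δ = 0` in minimizing the quadratic
function `½ δᵀ J δ - zᵀ δ`, whose minimizer is `(J⁻¹ - lagrangeMat J G) z`. -/
noncomputable def lagrangeMat (J : Matrix (Fin p) (Fin p) ℝ) (G : Matrix (Fin p) (Fin r) ℝ) :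
    Matrix (Fin p) (Fin p) ℝ :=
  J⁻¹ * G * (Gᵀ * J⁻¹ * G)⁻¹ * Gᵀ * J⁻¹

theorem isSymm_lagrangeMat (hJ : J.IsSymm) : (lagrangeMat J G).IsSymm := by
  have hinv : (J⁻¹)ᵀ = J⁻¹ := by rw [Matrix.transpose_nonsing_inv, hJ.eq]
  simp only [Matrix.IsSymm, lagrangeMat, Matrix.transpose_mul, Matrix.transpose_nonsing_inv, hinv,
    Matrix.transpose_transpose, Matrix.mul_assoc]

theorem mul_lagrangeMat_mul (hJ : J.PosDef) (hG : Function.Injective G.mulVec) :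
    J * lagrangeMat J G * G = G := by
  have hunit : IsUnit (Gᵀ * J⁻¹ * G).det :=
    (Matrix.isUnit_iff_isUnit_det _).1 (hJ.inv.conjTranspose_mul_mul_same hG).isUnit
  calc J * lagrangeMat J G * G
      = J * J⁻¹ * G * ((Gᵀ * J⁻¹ * G)⁻¹ * (Gᵀ * J⁻¹ * G)) := by
        simp only [lagrangeMat, Matrix.mul_assoc]
    _ = G := by
        rw [Matrix.mul_nonsing_inv _ ((Matrix.isUnit_iff_isUnit_det _).1 hJ.isUnit),
          Matrix.nonsing_inv_mul _ hunit, Matrix.one_mul, Matrix.mul_one]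

theorem lagrangeMat_mul (hJ : IsUnit J.det) :
    lagrangeMat J G * J = J⁻¹ * G * (Gᵀ * J⁻¹ * G)⁻¹ * Gᵀ := by
  rw [lagrangeMat, Matrix.mul_assoc _ _ J, Matrix.nonsing_inv_mul _ hJ, Matrix.mul_one]

end LagrangeMatrix

section Asymptotics

open Asymptotics

variable {ι : Type*} {l : Filter ι}

theorem isLittleO_sub_of_isLittleO_norm_add {E F : Type*} [NormedAddCommGroup E]
    [NormedAddCommGroup F] {δ y : ι → E} {z : ι → F}
    (h : (fun q => δ q - y q) =o[l] fun q => ‖z q‖ + ‖δ q‖) (hy : y =O[l] z) :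
    (fun q => δ q - y q) =o[l] z := by
  obtain ⟨C, hC⟩ := hy.bound
  refine h.trans_isBigO ((isBigO_refl z l).norm_left.add (IsBigO.norm_left ?_))
  refine IsBigO.of_bound (2 * C + 1) ?_
  filter_upwards [isLittleO_iff.1 h one_half_pos, hC] with q hq hCq
  rw [Real.norm_of_nonneg (by positivity)] at hq
  linarith [norm_le_norm_add_norm_sub' (δ q) (y q)]

variable {p r : ℕ}

theorem isLittleO_matMap_of_tendsto_zero {F : ι → Matrix (Fin p) (Fin p) ℝ}
    (hF : Tendsto F l (𝓝 0)) (w : ι → Param p) : (fun q => matMap (F q) (w q)) =o[l] w := by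
  have hnorm : Tendsto (fun q => ‖matMap (F q)‖) l (𝓝 0) := by
    have hzero : ‖(matMap 0 : Param p →L[ℝ] Param p)‖ = 0 := by
      rw [norm_eq_zero]
      ext v : 1
      simp [matMap_apply]
    simpa only [hzero, Function.comp_def] using ((continuous_matMap.norm.tendsto 0).comp hF)
  refine isLittleO_iff.2 fun ε hε => ?_
  filter_upwards [hnorm.eventually_le_const hε] with q hq
  exact ContinuousLinearMap.le_of_opNorm_le _ hq _

theorem isLittleO_matMap_of_mul_eq_zero {G : Matrix (Fin p) (Fin r) ℝ}
    {L : Matrix (Fin r) (Fin p) ℝ} (hL : L * G = 1) {N : Matrix (Fin p) (Fin p) ℝ}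
    (hN : N * G = 0) {H : ι → Matrix (Fin p) (Fin r) ℝ} (hH : Tendsto H l (𝓝 G))
    {w : ι → Param p} (hw : ∀ᶠ q in l, ∃ a, w q = matMap (H q) a) :
    (fun q => matMap N (w q)) =o[l] w := by
  have hLH : Tendsto (fun q => L * H q) l (𝓝 1) := by
    rw [← hL]
    exact ((continuous_const.matrix_mul continuous_id).tendsto G).comp hH
  have hunit : ∀ᶠ q in l, IsUnit (L * H q).det := by
    have hdet : Tendsto (fun q => (L * H q).det) l (𝓝 1) := by
      rw [← Matrix.det_one (n := Fin r)]
      exact (continuous_id.matrix_det.tendsto 1).comp hLH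
    filter_upwards [hdet.eventually_ne one_ne_zero] with q hq using hq.isUnit
  have hinv : Tendsto (fun q => (L * H q)⁻¹) l (𝓝 1) := by
    have hcont : ContinuousAt Inv.inv (1 : Matrix (Fin r) (Fin r) ℝ) :=
      continuousAt_matrix_inv 1 (by
        simpa only [Matrix.det_one, Units.val_one] using NormedRing.inverse_continuousAt (1 : ℝˣ))
    simpa only [inv_one, Function.comp_def] using hcont.tendsto.comp hLH
  have hproj : Tendsto (fun q => N * H q * ((L * H q)⁻¹ * L)) l (𝓝 0) := by
    have hcont : Continuous fun M : Matrix (Fin p) (Fin r) ℝ × Matrix (Fin r) (Fin r) ℝ =>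
        N * M.1 * (M.2 * L) := by fun_prop
    simpa only [hN, Matrix.zero_mul, Function.comp_def] using
      (hcont.tendsto (G, 1)).comp (hH.prodMk_nhds hinv)
  -- `H (L H)⁻¹ L` fixes the range of `H`, and `N H (L H)⁻¹ L → N G L = 0`
  refine (isLittleO_matMap_of_tendsto_zero hproj w).congr' ?_ .rfl
  filter_upwards [hw, hunit] with q ⟨a, ha⟩ hq
  rw [ha, ← matMap_mul_apply, ← matMap_mul_apply, Matrix.mul_assoc _ (_ * L), Matrix.mul_assoc _ L,
    Matrix.nonsing_inv_mul _ hq, Matrix.mul_one]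

theorem isLittleO_sub_matMap_inv_sub {J B : Matrix (Fin p) (Fin p) ℝ} (hJ : IsUnit J.det)
    {w z δ : ι → Param p} (h : (fun q => w q - (z q - matMap J (δ q))) =o[l] δ)
    (hw : (fun q => matMap (1 - J * B) (w q)) =o[l] w)
    (hδ : (fun q => matMap (B * J) (δ q)) =o[l] δ) :
    (fun q => δ q - matMap (J⁻¹ - B) (z q)) =o[l] z := by
  refine isLittleO_sub_of_isLittleO_norm_add ?_ ((matMap _).isBigO_comp z l)
  have hzO : z =O[l] fun q => ‖z q‖ + ‖δ q‖ := .of_norm_le fun q => by simp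
  have hδO : δ =O[l] fun q => ‖z q‖ + ‖δ q‖ := .of_norm_le fun q => by simp
  have hwO : w =O[l] fun q => ‖z q‖ + ‖δ q‖ :=
    ((h.isBigO.trans hδO).add (hzO.sub (((matMap J).isBigO_comp δ l).trans hδO))).congr_left
      fun q => sub_add_cancel _ _
  have hexp := ((matMap (J⁻¹ - B)).isBigO_comp _ l).trans_isLittleO (h.trans_isBigO hδO)
  have hker := ((matMap J⁻¹).isBigO_comp _ l).trans_isLittleO (hw.trans_isBigO hwO)
  refine ((hexp.sub hker).add (hδ.trans_isBigO hδO)).congr_left fun q => ?_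
  have hJJ : J⁻¹ * J = 1 := Matrix.nonsing_inv_mul J hJ
  rw [← matMap_mul_apply, Matrix.mul_sub, ← Matrix.mul_assoc, hJJ, Matrix.mul_one, Matrix.one_mul,
    map_sub, map_sub, ← matMap_mul_apply, Matrix.sub_mul, hJJ, matMap_sub_apply 1, matMap_one_apply]
  abel

end Asymptotics

section Estimators

open Asymptotics

variable {𝒳 Ω : Type*} [MeasurableSpace 𝒳] {μ : Measure 𝒳} {p r : ℕ} {Θ U : Set (Param p)}
  {f : Param p → 𝒳 → ℝ} {g : Param p → Param r} {β : ℝ} {θ₀ : Param p} [MeasurableSpace Ω]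
  {P : Measure Ω} {X : ℕ → Ω → 𝒳}

section ConsistentSeq

variable {C : ∀ n : ℕ, (Fin n → 𝒳) → Param p → Prop} {T : ∀ n : ℕ, (Fin n → 𝒳) → Param p}

theorem IsConsistentSeq.tendsto (hT : IsConsistentSeq P X θ₀ C T) :
    Tendsto (fun q : ℕ × Ω => T q.1 (sample X q.1 q.2)) (probFilter atTop P) (𝓝 θ₀) :=
  (tendstoInMeasure_const_iff (f := fun n ω => T n (sample X n ω))).1 hT.consistent

theorem IsConsistentSeq.eventually (hT : IsConsistentSeq P X θ₀ C T) :
    ∀ᶠ q in probFilter atTop P, C q.1 (sample X q.1 q.2) (T q.1 (sample X q.1 q.2)) :=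
  (eventually_probFilter (p := fun q : ℕ × Ω =>
    C q.1 (sample X q.1 q.2) (T q.1 (sample X q.1 q.2)))).2 hT.property

end ConsistentSeq

theorem LehmannBasu.isUnit_det_jMat (hLB : LehmannBasu μ Θ f β θ₀ U) :
    IsUnit (jMat μ f β θ₀).det :=
  (Matrix.isUnit_iff_isUnit_det _).1 hLB.posDef.isUnit

theorem IsConstraint.isLittleO_matMap_transpose {ι : Type*} {l : Filter ι} {T : ι → Param p}
    (hg : IsConstraint Θ g) (hΘ : IsOpen Θ) (hθ₀ : θ₀ ∈ nullSet Θ g) (hT : Tendsto T l (𝓝 θ₀))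
    (hmem : ∀ᶠ q in l, T q ∈ nullSet Θ g) :
    (fun q => matMap (gMat g θ₀)ᵀ (T q - θ₀)) =o[l] fun q => T q - θ₀ := by
  refine ((hg.hasStrictFDerivAt hΘ hθ₀.1).hasFDerivAt.isLittleO.comp_tendsto
    hT).neg_left.congr' ?_ .rfl
  filter_upwards [hmem] with q hq
  rw [Function.comp_apply, hq.2, hθ₀.2, sub_self, zero_sub, neg_neg]

theorem IsRMDPDE.eventually_exists_eq_matMap {S : ∀ n : ℕ, (Fin n → 𝒳) → Param p}
    (hS : IsRMDPDE μ Θ f g β θ₀ P X S) (hX : IsRandomSample P X (modelLaw μ f θ₀))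
    (hLB : LehmannBasu μ Θ f β θ₀ U) (hf : IsParametricModel μ Θ f) (hβ : 0 ≤ β)
    (hg : IsConstraint Θ g) : ∀ᶠ q : ℕ × Ω in probFilter atTop P, ∃ a : Param r,
      sampleMean X (estimatingFun μ f β (S q.1 (sample X q.1 q.2))) q =
        matMap (gMat g (S q.1 (sample X q.1 q.2))) a := by
  filter_upwards [IsConsistentSeq.eventually hS, hX.eventually_isRegularPoint hLB hf,
    (IsConsistentSeq.tendsto hS).eventually (hLB.isOpen.mem_nhds hLB.mem)] with q hq hreg hU
  obtain ⟨a, ha⟩ := hg.exists_fderiv_eq_innerSL hf.isOpen hq.1 hq.2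
    (hasStrictFDerivAt_empObjective hLB hreg hU)
  rw [fderiv_empObjective hLB hf hreg hU] at ha
  have hc : -(1 + β) ≠ 0 := by linarith
  refine ⟨(-(1 + β))⁻¹ • a, (innerSL_inj (𝕜 := ℝ)).1 ?_⟩
  rw [map_smul, map_smul, ← ha, inv_smul_smul₀ hc]
  rfl

variable [IsProbabilityMeasure P]

theorem IsRandomSample.isLittleO_sampleMean_estimatingFun
    (hX : IsRandomSample P X (modelLaw μ f θ₀)) (hLB : LehmannBasu μ Θ f β θ₀ U)
    (hf : IsParametricModel μ Θ f) (hβ : 0 ≤ β) {T : ℕ × Ω → Param p}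
    (hT : Tendsto T (probFilter atTop P) (𝓝 θ₀)) :
    (fun q => sampleMean X (estimatingFun μ f β (T q)) q -
      (sampleMean X (estimatingFun μ f β θ₀) q - matMap (jMat μ f β θ₀) (T q - θ₀)))
      =o[probFilter atTop P] fun q => T q - θ₀ := by
  refine isLittleO_iff.2 fun ε hε => ?_
  obtain ⟨ρ, hρ, hρU, hexp⟩ :=
    hX.exists_ball_norm_fderiv_empObjective_sub_le hLB hf hβ (ε := (1 + β) * ε) (by positivity)
  filter_upwards [hexp, hX.eventually_isRegularPoint hLB hf,
    hT.eventually (Metric.ball_mem_nhds θ₀ hρ)] with q hq hreg hqρ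
  set z := sampleMean X (estimatingFun μ f β θ₀) q
  set w := sampleMean X (estimatingFun μ f β (T q)) q
  have hgrad : fderiv ℝ (empObjective μ f β (sample X q.1 q.2)) (T q) =
      -(1 + β) • innerSL ℝ w := fderiv_empObjective hLB hf hreg (hρU hqρ)
  have hform : ((1 + β) • matForm (jMat μ f β θ₀)) (T q - θ₀) =
      (1 + β) • innerSL ℝ (matMap (jMat μ f β θ₀) (T q - θ₀)) := by
    rw [_root_.smul_apply]
    rfl
  have hle := hq (T q) hqρ
  rw [hgrad, hform, show -(1 + β) • innerSL ℝ w - (-(1 + β) • innerSL ℝ z +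
      (1 + β) • innerSL ℝ (matMap (jMat μ f β θ₀) (T q - θ₀))) =
      -(1 + β) • innerSL ℝ (w - (z - matMap (jMat μ f β θ₀) (T q - θ₀))) by
    simp only [map_sub]; module, norm_smul, innerSL_apply_norm, norm_neg,
    Real.norm_of_nonneg (by positivity), mul_assoc] at hle
  exact le_of_mul_le_mul_left hle (by positivity)

variable {T S : ∀ n : ℕ, (Fin n → 𝒳) → Param p}

theorem IsMDPDE.isLittleO_sub (hT : IsMDPDE μ Θ f β θ₀ P X T)
    (hX : IsRandomSample P X (modelLaw μ f θ₀)) (hLB : LehmannBasu μ Θ f β θ₀ U)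
    (hf : IsParametricModel μ Θ f) (hβ : 0 ≤ β) :
    (fun q : ℕ × Ω => T q.1 (sample X q.1 q.2) - θ₀ -
      matMap (jMat μ f β θ₀)⁻¹ (sampleMean X (estimatingFun μ f β θ₀) q)) =o[probFilter atTop P]
      sampleMean X (estimatingFun μ f β θ₀) := by
  have hexp := hX.isLittleO_sampleMean_estimatingFun hLB hf hβ (IsConsistentSeq.tendsto hT)
  have hroot : ∀ᶠ q : ℕ × Ω in probFilter atTop P,
      sampleMean X (estimatingFun μ f β (T q.1 (sample X q.1 q.2))) q = 0 := by
    filter_upwards [IsConsistentSeq.eventually hT,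
      tendsto_fst_probFilter.eventually (eventually_ne_atTop 0)] with q hq hn
    exact ((isEstimatingRoot_iff hn).1 hq).2
  have h := isLittleO_sub_matMap_inv_sub (B := 0) hLB.isUnit_det_jMat hexp
    ((isLittleO_zero _ _).congr' (hroot.mono fun q hq => ?_) .rfl)
    ((isLittleO_zero _ _).congr_left fun q => ?_)
  · simpa only [sub_zero] using h
  · simp only [hq, map_zero]
  · rw [Matrix.zero_mul, matMap_apply, Matrix.zero_mulVec, WithLp.toLp_zero]

theorem IsRMDPDE.isLittleO_sub (hS : IsRMDPDE μ Θ f g β θ₀ P X S)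
    (hX : IsRandomSample P X (modelLaw μ f θ₀)) (hLB : LehmannBasu μ Θ f β θ₀ U)
    (hf : IsParametricModel μ Θ f) (hβ : 0 ≤ β) (hg : IsConstraint Θ g)
    (hθ₀ : θ₀ ∈ nullSet Θ g) :
    (fun q : ℕ × Ω => S q.1 (sample X q.1 q.2) - θ₀ -
      matMap ((jMat μ f β θ₀)⁻¹ - bMat μ f g β θ₀) (sampleMean X (estimatingFun μ f β θ₀) q))
      =o[probFilter atTop P] sampleMean X (estimatingFun μ f β θ₀) := by
  have hS₀ := IsConsistentSeq.tendsto hS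
  refine isLittleO_sub_matMap_inv_sub hLB.isUnit_det_jMat
    (hX.isLittleO_sampleMean_estimatingFun hLB hf hβ hS₀) ?_ ?_
  · obtain ⟨L, hL⟩ := hg.exists_mul_gMat_eq_one hθ₀.1
    refine isLittleO_matMap_of_mul_eq_zero hL ?_
      ((hg.continuous.continuousAt (hf.isOpen.mem_nhds hθ₀.1)).tendsto.comp hS₀)
      (hS.eventually_exists_eq_matMap hX hLB hf hβ hg)
    rw [Matrix.sub_mul, Matrix.one_mul, sub_eq_zero]
    exact (mul_lagrangeMat_mul hLB.posDef (hg.injective_mulVec hθ₀.1)).symm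
  · have hnull := hg.isLittleO_matMap_transpose hf.isOpen hθ₀ hS₀
      ((IsConsistentSeq.eventually hS).mono fun q hq => hq.1)
    have hmul : bMat μ f g β θ₀ * jMat μ f β θ₀ = _ := lagrangeMat_mul hLB.isUnit_det_jMat
    simp only [hmul, matMap_mul_apply _ (gMat g θ₀)ᵀ]
    exact ((matMap _).isBigO_comp _ _).trans_isLittleO hnull

theorem IsMDPDE.isLittleO_sub_sub (hT : IsMDPDE μ Θ f β θ₀ P X T)
    (hS : IsRMDPDE μ Θ f g β θ₀ P X S) (hX : IsRandomSample P X (modelLaw μ f θ₀))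
    (hLB : LehmannBasu μ Θ f β θ₀ U) (hf : IsParametricModel μ Θ f) (hβ : 0 ≤ β)
    (hg : IsConstraint Θ g) (hθ₀ : θ₀ ∈ nullSet Θ g) :
    (fun q : ℕ × Ω => T q.1 (sample X q.1 q.2) - S q.1 (sample X q.1 q.2) -
      matMap (bMat μ f g β θ₀) (sampleMean X (estimatingFun μ f β θ₀) q)) =o[probFilter atTop P]
      sampleMean X (estimatingFun μ f β θ₀) := by
  refine ((hT.isLittleO_sub hX hLB hf hβ).sub
    (hS.isLittleO_sub hX hLB hf hβ hg hθ₀)).congr_left fun q => ?_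
  rw [matMap_sub_apply]
  abel

end Estimators

section TestStatistic

open Asymptotics

theorem isLittleO_bilinear_apply_sub {ι E F : Type*} {l : Filter ι} [NormedAddCommGroup E]
    [NormedSpace ℝ E] [NormedAddCommGroup F] (A : E →L[ℝ] E →L[ℝ] ℝ) {u v : ι → E} {z : ι → F}
    (huv : (fun q => u q - v q) =o[l] z) (hv : v =O[l] z) :
    (fun q => A (u q) (u q) - A (v q) (v q)) =o[l] fun q => ‖z q‖ ^ 2 := by
  have hA : ∀ a b : ι → E, (fun q => A (a q) (b q)) =O[l] fun q => ‖a q‖ * ‖b q‖ := fun a b =>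
    .of_bound ‖A‖ (.of_forall fun q => by
      rw [Real.norm_of_nonneg (by positivity : 0 ≤ ‖a q‖ * ‖b q‖), ← mul_assoc]
      exact A.le_opNorm₂ _ _)
  have hu : u =O[l] z := (huv.isBigO.add hv).congr_left fun q => sub_add_cancel _ _
  have hleft := (hA (fun q => u q - v q) u).trans_isLittleO
    (huv.norm_norm.mul_isBigO hu.norm_norm)
  have hright := (hA v fun q => u q - v q).trans_isLittleO
    (hv.norm_norm.mul_isLittleO huv.norm_norm)
  refine (hleft.add hright).congr (fun q => ?_) fun q => (pow_two _).symm
  simp only [map_sub, _root_.sub_apply]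
  ring

variable {𝒳 Ω : Type*} [MeasurableSpace 𝒳] {μ : Measure 𝒳} {p r : ℕ} {Θ U : Set (Param p)}
  {f : Param p → 𝒳 → ℝ} {g : Param p → Param r} {β γ : ℝ} {θ₀ : Param p}

theorem DivergenceRegular.tendsto_fderiv_fderiv_dpd (hreg : DivergenceRegular μ f γ U)
    (hLB : LehmannBasu μ Θ f β θ₀ U) (hf : IsParametricModel μ Θ f) :
    Tendsto (fun q : Param p × Param p =>
      fderiv ℝ (fderiv ℝ fun θ => dpd μ γ (f θ) (f q.2)) q.1) (𝓝 (θ₀, θ₀))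
      (𝓝 (matForm (aMat μ f γ θ₀))) := by
  refine tendsto_bilinear_of_tendsto_single fun i j => ?_
  have hU : U ×ˢ U ∈ 𝓝 (θ₀, θ₀) :=
    prod_mem_nhds (hLB.isOpen.mem_nhds hLB.mem) (hLB.isOpen.mem_nhds hLB.mem)
  have hcont := ((hreg.continuous
    ![EuclideanSpace.single i 1, EuclideanSpace.single j 1]).continuousAt hU).tendsto
  simp only [iteratedFDeriv_two_apply, Matrix.cons_val_zero, Matrix.cons_val_one] at hcont
  rwa [hreg.fderiv_fderiv_dpd_self hLB hf hLB.mem] at hcont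

set_option maxSynthPendingDepth 5 in
theorem DivergenceRegular.exists_ball_norm_fderiv_dpd_sub_le (hreg : DivergenceRegular μ f γ U)
    (hLB : LehmannBasu μ Θ f β θ₀ U) (hf : IsParametricModel μ Θ f) {ε : ℝ} (hε : 0 < ε) :
    ∃ ρ > 0, Metric.ball θ₀ ρ ⊆ U ∧ ∀ τ ∈ Metric.ball θ₀ ρ, ∀ θ ∈ Metric.ball θ₀ ρ,
      ‖fderiv ℝ (fun θ => dpd μ γ (f θ) (f τ)) θ - matForm (aMat μ f γ θ₀) (θ - τ)‖
        ≤ ε * ‖θ - τ‖ := by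
  have hnear := (hreg.tendsto_fderiv_fderiv_dpd hLB hf).eventually (Metric.ball_mem_nhds _ hε)
  obtain ⟨s, hs, hball⟩ := Metric.eventually_nhds_iff_ball.1 hnear
  obtain ⟨t, ht, htU⟩ := Metric.isOpen_iff.1 hLB.isOpen θ₀ hLB.mem
  have hρU : Metric.ball θ₀ (min s t) ⊆ U := (Metric.ball_subset_ball (min_le_right _ _)).trans htU
  have hρs : Metric.ball θ₀ (min s t) ⊆ Metric.ball θ₀ s :=
    Metric.ball_subset_ball (min_le_left _ _)
  refine ⟨min s t, lt_min hs ht, hρU, fun τ hτ θ hθ => ?_⟩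
  have hmv := (convex_ball θ₀ (min s t)).norm_image_sub_le_of_norm_fderiv_le' (𝕜 := ℝ)
    (f := fderiv ℝ fun θ => dpd μ γ (f θ) (f τ)) (φ := matForm (aMat μ f γ θ₀)) (C := ε)
    (fun σ hσ => (hreg.diff_dpd τ (hρU hτ)).differentiableAt_fderiv one_lt_two (hρU hσ))
    (fun σ hσ => ?_) hτ hθ
  · rwa [hreg.fderiv_dpd_self hLB hf (hρU hτ), sub_zero] at hmv
  · rw [← dist_eq_norm]
    refine (Metric.mem_ball.1 (hball (σ, τ) ?_)).le
    rw [← ball_prod_same]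
    exact ⟨hρs hσ, hρs hτ⟩

theorem DivergenceRegular.exists_ball_abs_dpd_sub_le (hreg : DivergenceRegular μ f γ U)
    (hLB : LehmannBasu μ Θ f β θ₀ U) (hf : IsParametricModel μ Θ f) (hγ : 0 ≤ γ) {ε : ℝ}
    (hε : 0 < ε) : ∃ ρ > 0, ∀ θ ∈ Metric.ball θ₀ ρ, ∀ τ ∈ Metric.ball θ₀ ρ,
      |dpd μ γ (f θ) (f τ) - 1 / 2 * matForm (aMat μ f γ θ₀) (θ - τ) (θ - τ)|
        ≤ ε * ‖θ - τ‖ ^ 2 := by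
  obtain ⟨ρ, hρ, hρU, hgrad⟩ := hreg.exists_ball_norm_fderiv_dpd_sub_le hLB hf hε
  refine ⟨ρ, hρ, fun θ hθ τ hτ => ?_⟩
  have htaylor := abs_sub_le_of_norm_fderiv_sub_le (φ := fun θ => dpd μ γ (f θ) (f τ)) (z := 0)
    (convex_ball θ₀ ρ)
    (fun σ hσ => (hreg.diff_dpd τ (hρU hτ)).differentiableAt two_pos (hρU hσ))
    (matForm_comm isSymm_aMat) hε.le hτ hθ
    (fun σ hσ => (zero_add (matForm (aMat μ f γ θ₀) (σ - τ))).symm ▸ hgrad τ hτ σ hσ)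
  rwa [dpd_self hγ (hf.nonneg τ (hLB.subset (hρU hτ))), sub_zero, _root_.zero_apply,
    zero_add] at htaylor

theorem DivergenceRegular.isLittleO_dpd_sub {ι : Type*} {l : Filter ι}
    (hreg : DivergenceRegular μ f γ U) (hLB : LehmannBasu μ Θ f β θ₀ U)
    (hf : IsParametricModel μ Θ f) (hγ : 0 ≤ γ) {T S : ι → Param p} (hT : Tendsto T l (𝓝 θ₀))
    (hS : Tendsto S l (𝓝 θ₀)) :
    (fun q => dpd μ γ (f (T q)) (f (S q)) -
      1 / 2 * matForm (aMat μ f γ θ₀) (T q - S q) (T q - S q)) =o[l] fun q => ‖T q - S q‖ ^ 2 := by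
  refine isLittleO_iff.2 fun ε hε => ?_
  obtain ⟨ρ, hρ, h⟩ := hreg.exists_ball_abs_dpd_sub_le hLB hf hγ hε
  filter_upwards [hT.eventually (Metric.ball_mem_nhds θ₀ hρ),
    hS.eventually (Metric.ball_mem_nhds θ₀ hρ)] with q hTq hSq
  rw [Real.norm_of_nonneg (sq_nonneg ‖T q - S q‖)]
  exact h _ hTq _ hSq

theorem IsParametricModel.measurable_dpd [SFinite μ] (hf : IsParametricModel μ Θ f) :
    Measurable fun q : Param p × Param p => dpd μ γ (f q.1) (f q.2) := by
  have hfst : Measurable fun q : (Param p × Param p) × 𝒳 => f q.1.1 q.2 :=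
    hf.measurable.comp ((measurable_fst.comp measurable_fst).prodMk measurable_snd)
  have hsnd : Measurable fun q : (Param p × Param p) × 𝒳 => f q.1.2 q.2 :=
    hf.measurable.comp ((measurable_snd.comp measurable_fst).prodMk measurable_snd)
  have hintegrand : Measurable fun q : (Param p × Param p) × 𝒳 =>
      dpdIntegrand γ (f q.1.1 q.2) (f q.1.2 q.2) := by
    unfold dpdIntegrand
    split_ifs
    · exact hfst.mul (hfst.div hsnd).log
    · exact ((hsnd.pow_const _).sub (((hsnd.pow_const _).const_mul _).mul hfst)).add
        ((hfst.pow_const _).const_mul _)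
  exact hintegrand.stronglyMeasurable.integral_prod_right'.measurable

variable [MeasurableSpace Ω] {P : Measure Ω} {X : ℕ → Ω → 𝒳}
  {T S : ∀ n : ℕ, (Fin n → 𝒳) → Param p}

theorem IsRandomSample.measurable_testStat [SFinite μ] {ν : Measure 𝒳}
    (hX : IsRandomSample P X ν) (hf : IsParametricModel μ Θ f) (hT : ∀ n, Measurable (T n))
    (hS : ∀ n, Measurable (S n)) (n : ℕ) : Measurable (testStat μ f γ X T S n) := by
  have hsample : Measurable (sample X n) := measurable_pi_lambda _ fun i => hX.measurable i
  exact (hf.measurable_dpd.comp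
    (((hT n).comp hsample).prodMk ((hS n).comp hsample))).const_mul _

variable [IsProbabilityMeasure P]

theorem IsMDPDE.isLittleO_testStat_sub (hT : IsMDPDE μ Θ f β θ₀ P X T)
    (hS : IsRMDPDE μ Θ f g β θ₀ P X S) (hX : IsRandomSample P X (modelLaw μ f θ₀))
    (hLB : LehmannBasu μ Θ f β θ₀ U) (hreg : DivergenceRegular μ f γ U)
    (hf : IsParametricModel μ Θ f) (hβ : 0 ≤ β) (hγ : 0 ≤ γ) (hg : IsConstraint Θ g)
    (hθ₀ : θ₀ ∈ nullSet Θ g) :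
    (fun q : ℕ × Ω => testStat μ f γ X T S q.1 q.2 - q.1 * matForm (aMat μ f γ θ₀)
        (matMap (bMat μ f g β θ₀) (sampleMean X (estimatingFun μ f β θ₀) q))
        (matMap (bMat μ f g β θ₀) (sampleMean X (estimatingFun μ f β θ₀) q)))
      =o[probFilter atTop P]
      fun q : ℕ × Ω => (q.1 : ℝ) * ‖sampleMean X (estimatingFun μ f β θ₀) q‖ ^ 2 := by
  set z := sampleMean X (estimatingFun μ f β θ₀)
  have hdiff := hT.isLittleO_sub_sub hS hX hLB hf hβ hg hθ₀
  have hBz := (matMap (bMat μ f g β θ₀)).isBigO_comp z (probFilter atTop P)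
  have hO : (fun q : ℕ × Ω => T q.1 (sample X q.1 q.2) - S q.1 (sample X q.1 q.2))
      =O[probFilter atTop P] z := (hdiff.isBigO.add hBz).congr_left fun q => sub_add_cancel _ _
  have hdpd := (hreg.isLittleO_dpd_sub hLB hf hγ (IsConsistentSeq.tendsto hT)
    (IsConsistentSeq.tendsto hS)).trans_isBigO (hO.norm_norm.pow 2)
  have hform := isLittleO_bilinear_apply_sub (matForm (aMat μ f γ θ₀)) hdiff hBz
  refine ((isBigO_refl (fun q : ℕ × Ω => (q.1 : ℝ)) _).mul_isLittleO
    ((hdpd.const_mul_left 2).add hform)).congr_left fun q => ?_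
  rw [testStat]
  ring

theorem IsRandomSample.tendstoInDistribution_sqrt_smul_sampleMean_estimatingFun
    (hX : IsRandomSample P X (modelLaw μ f θ₀)) (hLB : LehmannBasu μ Θ f β θ₀ U)
    (hf : IsParametricModel μ Θ f) (hβ : 0 ≤ β) :
    TendstoInDistribution
      (fun (n : ℕ) ω => √n • sampleMean X (estimatingFun μ f β θ₀) (n, ω)) atTop id
      (fun _ => P) (multivariateGaussian 0 (kMat μ f β θ₀)) := by
  rw [← hLB.secondMoment_estimatingFun hf hβ]
  exact hX.tendstoInDistribution_sqrt_smul_sampleMean (hLB.memLp_estimatingFun hf hβ)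
    (hLB.integral_estimatingFun hf hβ)

theorem IsMDPDE.tendsto_testStat_sub (hT : IsMDPDE μ Θ f β θ₀ P X T)
    (hS : IsRMDPDE μ Θ f g β θ₀ P X S) (hX : IsRandomSample P X (modelLaw μ f θ₀))
    (hLB : LehmannBasu μ Θ f β θ₀ U) (hreg : DivergenceRegular μ f γ U)
    (hf : IsParametricModel μ Θ f) (hβ : 0 ≤ β) (hγ : 0 ≤ γ) (hg : IsConstraint Θ g)
    (hθ₀ : θ₀ ∈ nullSet Θ g) :
    Tendsto (fun q : ℕ × Ω => testStat μ f γ X T S q.1 q.2 - q.1 * matForm (aMat μ f γ θ₀)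
        (matMap (bMat μ f g β θ₀) (sampleMean X (estimatingFun μ f β θ₀) q))
        (matMap (bMat μ f g β θ₀) (sampleMean X (estimatingFun μ f β θ₀) q)))
      (probFilter atTop P) (𝓝 0) := by
  have hclt := hX.tendstoInDistribution_sqrt_smul_sampleMean_estimatingFun hLB hf hβ
  have hsq := hclt.continuous_comp (g := fun v => ‖v‖ ^ 2) (by fun_prop)
  refine tendsto_zero_of_isLittleO_probFilter hsq
    ((hT.isLittleO_testStat_sub hS hX hLB hreg hf hβ hγ hg hθ₀).congr_right fun q => ?_)
  rw [Function.comp_apply, norm_smul, mul_pow, Real.norm_of_nonneg (Real.sqrt_nonneg _),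
    Real.sq_sqrt q.1.cast_nonneg]

theorem IsMDPDE.tendstoInDistribution_testStat [SFinite μ] (hT : IsMDPDE μ Θ f β θ₀ P X T)
    (hS : IsRMDPDE μ Θ f g β θ₀ P X S) (hX : IsRandomSample P X (modelLaw μ f θ₀))
    (hLB : LehmannBasu μ Θ f β θ₀ U) (hreg : DivergenceRegular μ f γ U)
    (hf : IsParametricModel μ Θ f) (hβ : 0 ≤ β) (hγ : 0 ≤ γ) (hg : IsConstraint Θ g)
    (hθ₀ : θ₀ ∈ nullSet Θ g) :
    TendstoInDistribution (testStat μ f γ X T S) atTop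
      (fun x : Param p =>
        (bMat μ f g β θ₀ *ᵥ x.ofLp) ⬝ᵥ aMat μ f γ θ₀ *ᵥ (bMat μ f g β θ₀ *ᵥ x.ofLp))
      (fun _ => P) (multivariateGaussian 0 (kMat μ f β θ₀)) := by
  set A := matForm (aMat μ f γ θ₀)
  set B := matMap (bMat μ f g β θ₀)
  have hlim : TendstoInDistribution
      (fun (n : ℕ) ω => A (B (√n • sampleMean X (estimatingFun μ f β θ₀) (n, ω)))
        (B (√n • sampleMean X (estimatingFun μ f β θ₀) (n, ω)))) atTop
      (fun x => (bMat μ f g β θ₀ *ᵥ x.ofLp) ⬝ᵥ aMat μ f γ θ₀ *ᵥ (bMat μ f g β θ₀ *ᵥ x.ofLp))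
      (fun _ => P) (multivariateGaussian 0 (kMat μ f β θ₀)) := by
    have hclt := hX.tendstoInDistribution_sqrt_smul_sampleMean_estimatingFun hLB hf hβ
    exact hclt.continuous_comp (g := fun v => A (B v) (B v)) (by fun_prop)
  refine tendstoInDistribution_of_tendstoInMeasure_sub _ _ hlim
    ((tendstoInMeasure_const_iff (c := (0 : ℝ))).2 ?_)
    fun n => (hX.measurable_testStat hf hT.measurable hS.measurable n).aemeasurable
  refine (hT.tendsto_testStat_sub hS hX hLB hreg hf hβ hγ hg hθ₀).congr fun q => ?_
  simp only [Pi.sub_apply, map_smul, _root_.smul_apply, smul_eq_mul, ← mul_assoc,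
    Real.mul_self_sqrt q.1.cast_nonneg]
  rfl

end TestStatistic

end DPD

theorem theorem3 {𝒳 : Type*} [MeasurableSpace 𝒳] (μ : Measure 𝒳) [SigmaFinite μ]
    {p r : ℕ} (hrp : r < p)
    (Θ : Set (Param p)) (f : Param p → 𝒳 → ℝ) (hf : IsParametricModel μ Θ f)
    (g : Param p → Param r) (hg : IsConstraint Θ g)
    (β γ : ℝ) (hβ : 0 ≤ β) (hγ : 0 ≤ γ)
    (θ₀ : Param p) (hθ₀ : θ₀ ∈ nullSet Θ g)
    (U : Set (Param p)) (hLB : LehmannBasu μ Θ f β θ₀ U) (hreg : DivergenceRegular μ f γ U)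
    {Ω : Type*} [MeasurableSpace Ω] (P : Measure Ω) [IsProbabilityMeasure P]
    (X : ℕ → Ω → 𝒳) (hX : IsRandomSample P X (modelLaw μ f θ₀)) :
    (∃ T, IsMDPDE μ Θ f β θ₀ P X T) ∧
    (∃ S, IsRMDPDE μ Θ f g β θ₀ P X S) ∧
    ∃ lam : Fin (limitRank μ f g β γ θ₀) → ℝ,
      -- the `lam i` are the nonzero eigenvalues of `A B K B`, with multiplicity
      (∀ i, lam i ≠ 0) ∧
      (limitMat μ f g β γ θ₀).charpoly
        = Polynomial.X ^ (p - limitRank μ f g β γ θ₀) * ∏ i, (Polynomial.X - C (lam i)) ∧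
      ∀ T S, IsMDPDE μ Θ f β θ₀ P X T → IsRMDPDE μ Θ f g β θ₀ P X S →
        TendstoInDistribution (testStat μ f γ X T S) atTop
          (fun z : Fin (limitRank μ f g β γ θ₀) → ℝ => ∑ i, lam i * z i ^ 2)
          (fun _ => P) (Measure.pi fun _ => gaussianReal 0 1) := by
  obtain ⟨lam, hne, hchar, hlaw⟩ := exists_eigenvalues_ne_zero (hLB.posSemidef_kMat hf hβ)
    (A := aMat μ f γ θ₀) (B := bMat μ f g β θ₀) isSymm_aMat (isSymm_lagrangeMat isSymm_jMat)
  have hmeas : Measurable fun z : Fin (limitRank μ f g β γ θ₀) → ℝ => ∑ i, lam i * z i ^ 2 := by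
    fun_prop
  exact ⟨hX.exists_isMDPDE hLB hf hβ, hX.exists_isRMDPDE hLB hf hβ hg hθ₀, lam, hne, hchar,
    fun T S hT hS => tendstoInDistribution_congr_law
      (hT.tendstoInDistribution_testStat hS hX hLB hreg hf hβ hγ hg hθ₀) hmeas.aemeasurable hlaw⟩
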